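/- **Setting.** Let $h:\mathbb R\to\mathbb R$ be an odd polynomial. Let $n,m,p$ be positive integers tending to infinity (along a sequence) with $n/m\to\varphi_m>0$ and $n/p\to\varphi_p>0$, and put $N=n+m+2p$, $c_n=\sqrt{N/n}$, $c_p=\sqrt{N/p}$. Let $\Upsilon_x\in\mathbb R^{n\times p}$ be deterministic matrices such that, for a constant $\gamma>0$ independent of the dimensions, $\Upsilon_x=U^\top V$ for some real matrices $U,V$ (with $r$ rows, $r$ arbitrary) all of whose columns have Euclidean norm at most $\sqrt\gamma$. For $\xi\sim\mathcal N(0,1)$ let $D_2$ be the $n\times n$ diagonal matrix with entries $D_2(i,i)=\big(\frac1p\sum_j\Upsilon_x(i,j)^2\big)^{1/2}$, and let $D_{lin}$, $D_{chaos}$ be the diagonal matrices with entries $\mathbb E[h'(\xi D_2(i,i))]$ and $\sum_{\ell\ge2}\frac1{\ell!}\mathbb E[h^{(\ell)}(\xi D_2(i,i))]$. With $\mathbf 1_{k\times l}$ the all-ones matrix, define the $N\times N$ block matrices (block sizes $n,m,p,p$) $$ \Upsilon_L=(\gamma_{ij})=\begin{pmatrix}0&c_nD_{chaos}\mathbf 1_{n\times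 m}&c_nD_{lin}\Upsilon_x&0\\ c_n\mathbf 1_{m\times n}D_{chaos}&0&0&c_p\mathbf 1_{m\times p}\\ c_n\Upsilon_x^\top D_{lin}&0&0&0\\ 0&c_p\mathbf 1_{p\times m}&0&0\end{pmatrix},\qquad C_N=\begin{pmatrix}0&0&0&0\\0&-I_m&0&0\\0&0&0&-I_p\\0&0&-I_p&0\end{pmatrix}. $$ Let $A_N=(a_{ij}/\sqrt N)$ be a GOE matrix, i.e. $A_N$ is symmetric and $(a_{ij})_{i\le j}$ are independent standard real Gaussian variables. Let $L=\Upsilon_L\circ A_N+C_N$ ($\circ$ is the entrywise product) and $\mathfrak Q(\Lambda)=(L-\Lambda)^{-1}$. For a complex $N\times N$ matrix $M$ with blocks $M_{IJ}$, $1\le I,J\le4$, let $id_4\otimes\Delta[M]$ be the matrix obtained from $M$ by keeping the diagonals of the blocks $M_{11},M_{22},M_{33},M_{34},M_{43},M_{44}$ and replacing all other entries by $0$. Let $\Im m\,M=\frac1{2\mathbf i}(M-M^*)$, let $\mathrm D_N(\mathbb C)^+$ be the set of diagonal matrices with $\Im m\,\Lambda>0$, and let $\mathrm B_N(\mathbb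 C)^+$ be the set of matrices $M$ with $id_4\otimes\Delta[M]=M$ and $\Im m\,M>0$. Let $\mathcal R_N(M)=\operatorname{diag}_i\big(\sum_j\frac{\gamma_{ij}^2}N M(j,j)\big)$ and $\gamma_{\max}=\max_{i,j}|\gamma_{ij}|$; $\|\cdot\|$ is the operator norm. **Theorem 3.2.** (i) In every dimension there is a unique function $\mathfrak Q^\square:\mathrm D_N(\mathbb C)^+\to\mathrm B_N(\mathbb C)^+$, analytic in each of the $N$ diagonal entries of its argument, such that for all $\Lambda\in\mathrm D_N(\mathbb C)^+$ $$\mathfrak Q^\square(\Lambda)=id_4\otimes\Delta\big[(C_N-\Lambda-\mathcal R_N(\mathfrak Q^\square(\Lambda)))^{-1}\big].$$ (ii) Let $\kappa>0$ and $0<\delta<1$ be constants. Then for all sufficiently large $N$ (that is, far enough along the sequence of dimensions) the following holds for every $d>1$ and every $\Lambda\in\mathrm D_N(\mathbb C)^+$ such that $$\Im m\,\Lambda\ \ge\ \eta_N\,I_N,\qquad \eta_N=\Big(\frac{\gamma_{\max}^2}{(1-\delta)n}\big(2\sqrt2\,\gamma_{\max}^3+\kappa\big)\Big)^{1/5},$$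 and such that $\|\Upsilon_L^{\circ2}\circ\mathfrak Q(\Lambda)\|\le\kappa$ almost surely. With $S=\|(\Im m\,\Lambda)^{-1}\|$ and $$\varepsilon_N(d)=6\gamma_{\max}S^2\sqrt{\frac2N\log\Big(\frac{N+2p}{N^{1-d}}\Big)}+\frac1n\Big(1+\frac{\gamma_{\max}^2S^2}{\delta}\Big)\big(2\sqrt2\,\gamma_{\max}^3S^4+\kappa S^2\big),$$ one has $$\mathbb P\Big(\big\|id_4\otimes\Delta[\mathfrak Q(\Lambda)]-\mathfrak Q^\square(\Lambda)\big\|\ge\varepsilon_N(d)\Big)\le4N^{1-d}.$$ -/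

import Mathlib

open Filter Topology MeasureTheory ProbabilityTheory Matrix
open scoped ComplexOrder Matrix.Norms.L2Operator

noncomputable section

namespace RFRidge

/-- The index set of `N × N` matrices, `N = n + m + 2p`, cut into the four consecutive blocks
of sizes `n`, `m`, `p`, `p`. -/
abbrev Idx (n m p : ℕ) : Type := (Fin n ⊕ Fin m) ⊕ (Fin p ⊕ Fin p)

/-- The size `N = n + m + 2p`. -/
def size (n m p : ℕ) : ℕ := n + m + 2 * p

section Deterministic

variable {n m p : ℕ}

/-- The `4 × 4` block matrix with the listed blocks (row by row). -/
def blocks {R : Type*}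
    (M11 : Matrix (Fin n) (Fin n) R) (M12 : Matrix (Fin n) (Fin m) R)
    (M13 : Matrix (Fin n) (Fin p) R) (M14 : Matrix (Fin n) (Fin p) R)
    (M21 : Matrix (Fin m) (Fin n) R) (M22 : Matrix (Fin m) (Fin m) R)
    (M23 : Matrix (Fin m) (Fin p) R) (M24 : Matrix (Fin m) (Fin p) R)
    (M31 : Matrix (Fin p) (Fin n) R) (M32 : Matrix (Fin p) (Fin m) R)
    (M33 : Matrix (Fin p) (Fin p) R) (M34 : Matrix (Fin p) (Fin p) R)
    (M41 : Matrix (Fin p) (Fin n) R) (M42 : Matrix (Fin p) (Fin m) R)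
    (M43 : Matrix (Fin p) (Fin p) R) (M44 : Matrix (Fin p) (Fin p) R) :
    Matrix (Idx n m p) (Idx n m p) R :=
  fromBlocks (fromBlocks M11 M12 M21 M22) (fromBlocks M13 M14 M23 M24)
    (fromBlocks M31 M32 M41 M42) (fromBlocks M33 M34 M43 M44)

/-- `Δ[M]`: the diagonal part of a square matrix. -/
def diagPart {k : ℕ} (M : Matrix (Fin k) (Fin k) ℂ) : Matrix (Fin k) (Fin k) ℂ :=
  diagonal M.diag

/-- `id₄ ⊗ Δ`: keeps the diagonals of the blocks `11, 22, 33, 34, 43, 44` and replaces every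
other entry by `0`. -/
def blockDelta (M : Matrix (Idx n m p) (Idx n m p) ℂ) : Matrix (Idx n m p) (Idx n m p) ℂ :=
  blocks
    (diagPart M.toBlocks₁₁.toBlocks₁₁) 0 0 0
    0 (diagPart M.toBlocks₁₁.toBlocks₂₂) 0 0
    0 0 (diagPart M.toBlocks₂₂.toBlocks₁₁) (diagPart M.toBlocks₂₂.toBlocks₁₂)
    0 0 (diagPart M.toBlocks₂₂.toBlocks₂₁) (diagPart M.toBlocks₂₂.toBlocks₂₂)

/-- The imaginary part `(A - A*) / (2i)` of a square complex matrix. -/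
def imPart {ι : Type*} (A : Matrix ι ι ℂ) : Matrix ι ι ℂ :=
  (1 / (2 * Complex.I)) • (A - Aᴴ)

/-- `D_N(ℂ)⁺`: the diagonal matrices with positive definite imaginary part. -/
def DPlus (n m p : ℕ) : Set (Matrix (Idx n m p) (Idx n m p) ℂ) :=
  {M | M.IsDiag ∧ (imPart M).PosDef}

/-- The matrices in the range of `id₄ ⊗ Δ` with positive definite imaginary part. -/
def BPlus (n m p : ℕ) : Set (Matrix (Idx n m p) (Idx n m p) ℂ) :=
  {M | blockDelta M = M ∧ (imPart M).PosDef}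

/-- The diagonal entries of `D₂ = deg(p⁻¹ Υ_x^{∘2})^{1/2}`. -/
def dTwo (Υx : Matrix (Fin n) (Fin p) ℝ) (i : Fin n) : ℝ :=
  √((∑ j, Υx i j ^ 2) / p)

/-- The diagonal entries of `D_lin(h) = 𝔼[h'(ξ D₂)]`, with `ξ` standard Gaussian. -/
def dLin (h : Polynomial ℝ) (Υx : Matrix (Fin n) (Fin p) ℝ) (i : Fin n) : ℝ :=
  ∫ ξ, h.derivative.eval (ξ * dTwo Υx i) ∂(gaussianReal 0 1)

/-- The diagonal entries of `D_chaos(h) = ∑_{ℓ ≥ 2} 𝔼[h^{(ℓ)}(ξ D₂)] / ℓ!`, with `ξ` standard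
Gaussian; the terms with `ℓ > deg h` vanish. -/
def dChaos (h : Polynomial ℝ) (Υx : Matrix (Fin n) (Fin p) ℝ) (i : Fin n) : ℝ :=
  ∑ l ∈ Finset.Icc 2 h.natDegree,
    (1 / (l.factorial : ℝ)) *
      ∫ ξ, (Polynomial.derivative^[l] h).eval (ξ * dTwo Υx i) ∂(gaussianReal 0 1)

/-- The matrix with all entries equal to `1`. -/
def ones (k l : ℕ) : Matrix (Fin k) (Fin l) ℝ := Matrix.of fun _ _ => 1

/-- The profile `Υ_L`, for the constant profile `Υ_w = 1` of the weights. -/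
def profileL (m : ℕ) (h : Polynomial ℝ) (Υx : Matrix (Fin n) (Fin p) ℝ) :
    Matrix (Idx n m p) (Idx n m p) ℝ :=
  let cn : ℝ := √((size n m p : ℝ) / n)
  let cp : ℝ := √((size n m p : ℝ) / p)
  let Dlin : Matrix (Fin n) (Fin n) ℝ := diagonal (dLin h Υx)
  let Dchaos : Matrix (Fin n) (Fin n) ℝ := diagonal (dChaos h Υx)
  blocks
    0 (cn • (Dchaos * ones n m)) (cn • (Dlin * Υx)) 0
    (cn • (ones m n * Dchaos)) 0 0 (cp • ones m p)
    (cn • (Υxᵀ * Dlin)) 0 0 0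
    0 (cp • ones p m) 0 0

/-- The deterministic matrix `C_N`. -/
def matC (n m p : ℕ) : Matrix (Idx n m p) (Idx n m p) ℝ :=
  blocks
    0 0 0 0
    0 (-1) 0 0
    0 0 0 (-1)
    0 0 (-1) 0

/-- The map `R_N(M) = diag_i (∑_j (γ_ij² / N) M(j, j))` attached to the profile `Υ = (γ_ij)`. -/
def mapR (Υ : Matrix (Idx n m p) (Idx n m p) ℝ) (M : Matrix (Idx n m p) (Idx n m p) ℂ) :
    Matrix (Idx n m p) (Idx n m p) ℂ :=
  diagonal fun i => ∑ j, ((Υ i j ^ 2 / (size n m p : ℝ) : ℝ) : ℂ) * M j j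

/-- `Q` maps `D_N(ℂ)⁺` to the matrices in the range of `id₄ ⊗ Δ` with positive imaginary part,
is analytic in each of the `N` diagonal entries of its argument, and solves
`Q(Λ) = id₄ ⊗ Δ [(C_N - Λ - R_N(Q(Λ)))⁻¹]` on `D_N(ℂ)⁺`. -/
structure IsSquareEquivalent (Υ : Matrix (Idx n m p) (Idx n m p) ℝ)
    (Q : Matrix (Idx n m p) (Idx n m p) ℂ → Matrix (Idx n m p) (Idx n m p) ℂ) : Prop where
  mapsTo : Set.MapsTo Q (DPlus n m p) (BPlus n m p)
  analytic : ∀ Λ ∈ DPlus n m p, ∀ i a b : Idx n m p,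
    AnalyticOnNhd ℂ (fun z : ℂ => Q (diagonal (Function.update Λ.diag i z)) a b) {z | 0 < z.im}
  fixedPoint : ∀ Λ ∈ DPlus n m p,
    Q Λ = blockDelta (((matC n m p).map Complex.ofReal - Λ - mapR Υ (Q Λ))⁻¹)

/-- `γ_max = max_{i,j} |γ_ij|`, the nonnegative square root of `max_{i,j} γ_ij²`. -/
def gammaMax (Υ : Matrix (Idx n m p) (Idx n m p) ℝ) : ℝ :=
  ⨆ q : Idx n m p × Idx n m p, |Υ q.1 q.2|

/-- The threshold `η_N`. -/
def etaN (Υ : Matrix (Idx n m p) (Idx n m p) ℝ) (κ δ : ℝ) : ℝ :=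
  (gammaMax Υ ^ 2 / ((1 - δ) * n) * (2 * √2 * gammaMax Υ ^ 3 + κ)) ^ (1 / 5 : ℝ)

/-- The error bound `ε_N(d)` at the point `Λ`. -/
def epsN (Υ : Matrix (Idx n m p) (Idx n m p) ℝ) (κ δ d : ℝ)
    (Λ : Matrix (Idx n m p) (Idx n m p) ℂ) : ℝ :=
  let N : ℝ := size n m p
  let γ : ℝ := gammaMax Υ
  let S : ℝ := ‖(imPart Λ)⁻¹‖
  6 * γ * S ^ 2 * √(2 / N * Real.log ((N + 2 * p) / N ^ (1 - d)))
    + 1 / n * (1 + γ ^ 2 * S ^ 2 / δ) * (2 * √2 * γ ^ 3 * S ^ 4 + κ * S ^ 2)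

/-- `Υ_x = U* V`, where the columns of `U` and `V` have Euclidean norm at most `√γ`. -/
def HasBoundedFactorization (γ : ℝ) (Υx : Matrix (Fin n) (Fin p) ℝ) : Prop :=
  ∃ (r : ℕ) (U : Matrix (Fin r) (Fin n) ℝ) (V : Matrix (Fin r) (Fin p) ℝ),
    Υx = Uᵀ * V ∧ (∀ i, √(∑ s, U s i ^ 2) ≤ √γ) ∧ (∀ j, √(∑ s, V s j ^ 2) ≤ √γ)

/-- The symmetric matrix `(a_ij / √N)`; a family indexed by unordered pairs is the same as a
family `(a_ij)_{i ≤ j}`. -/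
def symMatrix (a : Sym2 (Idx n m p) → ℝ) : Matrix (Idx n m p) (Idx n m p) ℝ :=
  Matrix.of fun i j => a s(i, j) / √(size n m p : ℝ)

/-- `L = Υ ∘ A_N + C_N`, with `∘` the entrywise product and `A_N = (a_ij / √N)`. -/
def matL (Υ : Matrix (Idx n m p) (Idx n m p) ℝ) (a : Sym2 (Idx n m p) → ℝ) :
    Matrix (Idx n m p) (Idx n m p) ℝ :=
  Υ ⊙ symMatrix a + matC n m p

/-- The operator-valued resolvent `𝔔(Λ) = (L - Λ)⁻¹`. -/
def resolventL (Υ : Matrix (Idx n m p) (Idx n m p) ℝ) (a : Sym2 (Idx n m p) → ℝ)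
    (Λ : Matrix (Idx n m p) (Idx n m p) ℂ) : Matrix (Idx n m p) (Idx n m p) ℂ :=
  ((matL Υ a).map Complex.ofReal - Λ)⁻¹

end Deterministic

/-- The `a_ij`, `i ≤ j`, are independent standard real Gaussian variables, so that
`A_N = (a_ij / √N)` is a GOE matrix. -/
structure IsGOEFamily {ι Ω : Type*} [MeasurableSpace Ω] (μ : Measure Ω)
    (a : Sym2 ι → Ω → ℝ) : Prop where
  law : ∀ e, HasLaw (a e) (gaussianReal 0 1) μ
  indep : iIndepFun a μ

end RFRidge

end

open RFRidge

/-! For z, z' in the upper half-plane, |z - z'| / √(Im z · Im z') is 2 sinh of half their hyperbolic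
distance, and the deterministic part of the proof is carried out in this quantity, taken
coordinatewise. If C is Hermitian, passing from w to the diagonal of (C - diag w)⁻¹ does not
increase it (`norm_bilin_res_sub_res_le`, a Schwarz–Pick inequality), and neither does the positive
linear map `shift` (`norm_shift_sub_le`). Adding a vector lam with positive imaginary parts
contracts it strictly (`contraction_scalar`). Hence the iteration of the vector Dyson equation g =
diag of (C - diag(lam + shift g))⁻¹ converges geometrically, locally uniformly in lam, which gives
existence, uniqueness and analyticity of the solution.

The matrix equation reduces to the vector one: R_N sees only the diagonal of its argument, and since
C_N is block diagonal for the index classes, id₄ ⊗ Δ fixes the resolvents that occur (`pinch_res`).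
The same contraction compares solutions at two parameters: `IsDysonSol.norm_res_sub_res_le` has the
constant that the plain resolvent identity would give, with no loss from the nonlinearity.

Bias. Gaussian integration by parts shows that the expected resolvent solves the Dyson equation up
to a fluctuation term and a Hadamard term of size κ/N (`sub_diagonal_mul_meanRes`). A variance bound
for Frobenius–Lipschitz functionals makes the fluctuation term of order 1/N as well
(`norm_meanRes_sub_res_le`). The resolvent built from the diagonal of the mean is then an exact
solution at a slightly moved parameter, and stability yields the factor 1 + γ²S²/δ. The threshold
η_N is what keeps the moved parameter at imaginary part at least δ/S once the dimensions are large.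

Concentration. The Maurey–Pisier rotation argument gives sub-Gaussian tails for each entry
(`hasSubgaussianMGF_sub_integral`). A block-diagonal part with at most two entries per row has norm
at most twice its largest entry; there are at most N + 2p entries, each tested in eight directions
of the complex plane (`exists_octagon_le`). The numerical constants leave 4 N^(1-d). -/

open RFRidge

namespace RFRidge

/-! ### Resolvents of Hermitian matrices with a diagonal spectral parameter. -/

section LinearAlgebra

variable {ι : Type*} [Fintype ι]

/-- The squared Euclidean norm of a complex vector. -/
noncomputable def normSq (u : ι → ℂ) : ℝ := ∑ i, ‖u i‖ ^ 2

lemma normSq_nonneg (u : ι → ℂ) : 0 ≤ normSq u := Finset.sum_nonneg fun _ _ => by positivity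

lemma normSq_eq_norm_toLp (u : ι → ℂ) : normSq u = ‖WithLp.toLp 2 u‖ ^ 2 := by
  rw [EuclideanSpace.norm_sq_eq]; rfl

lemma eq_zero_of_normSq_le_zero {u : ι → ℂ} (h : normSq u ≤ 0) : u = 0 := by
  have h0 : normSq u = 0 := le_antisymm h (normSq_nonneg u)
  ext i
  have := (Finset.sum_eq_zero_iff_of_nonneg (fun i _ => by positivity)).1 h0 i (Finset.mem_univ i)
  simpa using this

lemma star_dotProduct_self (u : ι → ℂ) : star u ⬝ᵥ u = (normSq u : ℂ) := by
  simp only [dotProduct, Pi.star_apply, normSq, Complex.ofReal_sum]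
  refine Finset.sum_congr rfl fun i _ => ?_
  rw [RCLike.star_def, Complex.conj_mul']
  simp

lemma sum_norm_mul_norm_le (u v : ι → ℂ) :
    ∑ i, ‖u i‖ * ‖v i‖ ≤ √(normSq u) * √(normSq v) := by
  rw [← Real.sqrt_mul (normSq_nonneg u)]
  exact Real.le_sqrt_of_sq_le (Finset.sum_mul_sq_le_sq_mul_sq _ _ _)

lemma norm_star_dotProduct_le (u v : ι → ℂ) : ‖star u ⬝ᵥ v‖ ≤ √(normSq u) * √(normSq v) := by
  refine le_trans ?_ (sum_norm_mul_norm_le u v)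
  refine (norm_sum_le _ _).trans_eq (Finset.sum_congr rfl fun i _ => ?_)
  simp

lemma star_dotProduct_mulVec_conj (B : Matrix ι ι ℂ) (v u : ι → ℂ) :
    star (B *ᵥ v) ⬝ᵥ u = star v ⬝ᵥ Bᴴ *ᵥ u := by
  rw [star_mulVec, dotProduct_mulVec]

lemma star_star_dotProduct (u v : ι → ℂ) : star (star u ⬝ᵥ v) = star v ⬝ᵥ u := by
  rw [← star_dotProduct_star, star_star, dotProduct_comm, dotProduct_comm]

lemma exists_pos_le_of_forall_pos {f : ι → ℝ} (hf : ∀ i, 0 < f i) :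
    ∃ η : ℝ, 0 < η ∧ ∀ i, η ≤ f i := by
  rcases isEmpty_or_nonempty ι with h | h
  · exact ⟨1, one_pos, fun i => h.elim i⟩
  · obtain ⟨i, hi⟩ := Finite.exists_min f
    exact ⟨f i, hf i, hi⟩

variable [DecidableEq ι]

lemma normSq_single (i : ι) (c : ℂ) : normSq (Pi.single i c) = ‖c‖ ^ 2 := by
  rw [normSq, Finset.sum_eq_single i] <;> simp +contextual

lemma normSq_mulVec_le (A : Matrix ι ι ℂ) (v : ι → ℂ) :
    normSq (A *ᵥ v) ≤ ‖A‖ ^ 2 * normSq v := by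
  rw [normSq_eq_norm_toLp, normSq_eq_norm_toLp, ← mul_pow]
  exact pow_le_pow_left₀ (norm_nonneg _) (l2_opNorm_mulVec A (WithLp.toLp 2 v)) 2

lemma sqrt_normSq_mulVec_le (A : Matrix ι ι ℂ) (v : ι → ℂ) :
    √(normSq (A *ᵥ v)) ≤ ‖A‖ * √(normSq v) := by
  rw [← Real.sqrt_sq (norm_nonneg A), ← Real.sqrt_mul (sq_nonneg _)]
  exact Real.sqrt_le_sqrt (normSq_mulVec_le A v)

lemma norm_star_dotProduct_mulVec_le (A : Matrix ι ι ℂ) (u v : ι → ℂ) :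
    ‖star u ⬝ᵥ A *ᵥ v‖ ≤ ‖A‖ * √(normSq u) * √(normSq v) := by
  refine (norm_star_dotProduct_le _ _).trans ?_
  rw [mul_comm ‖A‖, mul_assoc]
  exact mul_le_mul_of_nonneg_left (sqrt_normSq_mulVec_le A v) (Real.sqrt_nonneg _)

lemma opNorm_le_of_normSq_mulVec_le {A : Matrix ι ι ℂ} {K : ℝ} (hK : 0 ≤ K)
    (h : ∀ v, normSq (A *ᵥ v) ≤ K ^ 2 * normSq v) : ‖A‖ ≤ K := by
  rw [cstar_norm_def]
  refine ContinuousLinearMap.opNorm_le_bound _ hK fun x => ?_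
  have := h x.ofLp
  rw [normSq_eq_norm_toLp, normSq_eq_norm_toLp, ← mul_pow] at this
  exact le_of_sq_le_sq this (by positivity)

/-- Test the form on the pair (A v, v) and divide by the norm of A v. -/
lemma opNorm_le_of_bilin_le {A : Matrix ι ι ℂ} {K : ℝ} (hK : 0 ≤ K)
    (h : ∀ u v, ‖star u ⬝ᵥ A *ᵥ v‖ ≤ K * √(normSq u) * √(normSq v)) : ‖A‖ ≤ K := by
  refine opNorm_le_of_normSq_mulVec_le hK fun v => ?_
  have h1 := h (A *ᵥ v) v
  rw [star_dotProduct_self, Complex.norm_real, Real.norm_of_nonneg (normSq_nonneg _)] at h1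
  set a := √(normSq (A *ᵥ v)) with ha
  have ha2 : normSq (A *ᵥ v) = a ^ 2 := (Real.sq_sqrt (normSq_nonneg _)).symm
  have hv2 : normSq v = √(normSq v) ^ 2 := (Real.sq_sqrt (normSq_nonneg _)).symm
  have ha0 : 0 ≤ a := Real.sqrt_nonneg _
  rw [ha2] at h1 ⊢
  rw [hv2, ← mul_pow]
  have hb : 0 ≤ K * √(normSq v) := by positivity
  rcases ha0.eq_or_lt with h0 | h0
  · rw [← h0, zero_pow two_ne_zero]; positivity
  · refine pow_le_pow_left₀ ha0 ?_ 2
    refine le_of_mul_le_mul_right ?_ h0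
    nlinarith

lemma star_single_dotProduct_mulVec_single (A : Matrix ι ι ℂ) (i j : ι) :
    star (Pi.single i (1 : ℂ)) ⬝ᵥ A *ᵥ Pi.single j 1 = A i j := by
  rw [← Pi.single_star, star_one]
  simp

lemma norm_entry_le (A : Matrix ι ι ℂ) (i j : ι) : ‖A i j‖ ≤ ‖A‖ := by
  have := norm_star_dotProduct_mulVec_le A (Pi.single i 1) (Pi.single j 1)
  rw [star_single_dotProduct_mulVec_single] at this
  simpa [normSq_single] using this

lemma opNorm_diagonal_le {w : ι → ℂ} {K : ℝ} (hK : 0 ≤ K) (h : ∀ i, ‖w i‖ ≤ K) :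
    ‖(diagonal w : Matrix ι ι ℂ)‖ ≤ K := by
  rw [l2_opNorm_diagonal]
  exact (pi_norm_le_iff_of_nonneg hK).2 h

/-- The imaginary part of the quadratic form of `A`. -/
noncomputable def imForm (A : Matrix ι ι ℂ) (u : ι → ℂ) : ℝ := (star u ⬝ᵥ A *ᵥ u).im

lemma imForm_single (A : Matrix ι ι ℂ) (i : ι) : imForm A (Pi.single i 1) = (A i i).im := by
  rw [imForm, star_single_dotProduct_mulVec_single]

lemma imForm_le (A : Matrix ι ι ℂ) (u : ι → ℂ) : imForm A u ≤ ‖A‖ * normSq u := by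
  refine (Complex.im_le_norm _).trans ((norm_star_dotProduct_mulVec_le A u u).trans_eq ?_)
  rw [mul_assoc, Real.mul_self_sqrt (normSq_nonneg u)]

/-- The generalized resolvent `(C - diag w)⁻¹`. -/
noncomputable def res (C : Matrix ι ι ℂ) (w : ι → ℂ) : Matrix ι ι ℂ := (C - diagonal w)⁻¹

variable {C : Matrix ι ι ℂ} {w : ι → ℂ}

/-- The quadratic form of a Hermitian matrix is real, so only the diagonal parameter contributes.
All positivity and norm bounds on resolvents come from this identity. -/
lemma im_form_hermitian_sub_diagonal (hC : C.IsHermitian) (w v : ι → ℂ) :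
    (star v ⬝ᵥ (C - diagonal w) *ᵥ v).im = - ∑ i, (w i).im * ‖v i‖ ^ 2 := by
  have h1 : (star v ⬝ᵥ C *ᵥ v).im = 0 := by
    have : star (star v ⬝ᵥ C *ᵥ v) = star v ⬝ᵥ C *ᵥ v := by
      rw [star_star_dotProduct, star_dotProduct_mulVec_conj, hC.eq]
    exact Complex.conj_eq_iff_im.1 this
  rw [sub_mulVec, dotProduct_sub, Complex.sub_im, h1, zero_sub]
  congr 1
  rw [dotProduct, Complex.im_sum]
  refine Finset.sum_congr rfl fun i _ => ?_
  rw [mulVec_diagonal, Pi.star_apply, RCLike.star_def,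
    show (starRingEnd ℂ) (v i) * (w i * v i) = w i * ((starRingEnd ℂ) (v i) * v i) by ring,
    Complex.conj_mul', ← Complex.ofReal_pow, Complex.im_mul_ofReal]

/-- Coercivity: the imaginary part of the form is at least η times the squared norm, and
Cauchy–Schwarz converts this into a lower bound on the matrix itself. It gives invertibility and the
bound η⁻¹ on the resolvent. -/
lemma le_normSq_sub_diagonal (hC : C.IsHermitian) {η : ℝ} (hw : ∀ i, η ≤ (w i).im)
    (v : ι → ℂ) : η * √(normSq v) ≤ √(normSq ((C - diagonal w) *ᵥ v)) := by
  have h1 := im_form_hermitian_sub_diagonal hC w v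
  have h2 := (Complex.abs_im_le_norm _).trans (norm_star_dotProduct_le v ((C - diagonal w) *ᵥ v))
  have h3 : η * normSq v ≤ ∑ i, (w i).im * ‖v i‖ ^ 2 := by
    rw [normSq, Finset.mul_sum]
    exact Finset.sum_le_sum fun i _ => mul_le_mul_of_nonneg_right (hw i) (by positivity)
  rw [h1, abs_neg] at h2
  have h4 := (h3.trans (le_abs_self _)).trans h2
  rw [← Real.sq_sqrt (normSq_nonneg v)] at h4
  rcases (Real.sqrt_nonneg (normSq v)).eq_or_lt with h0 | h0
  · rw [← h0, mul_zero]; exact Real.sqrt_nonneg _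
  · rw [Real.sqrt_sq h0.le] at h4
    refine le_of_mul_le_mul_left ?_ h0
    linarith

lemma isUnit_sub_diagonal (hC : C.IsHermitian) (hw : ∀ i, 0 < (w i).im) :
    IsUnit (C - diagonal w) := by
  obtain ⟨η, hη, hle⟩ := exists_pos_le_of_forall_pos hw
  rw [← mulVec_injective_iff_isUnit]
  refine (injective_iff_map_eq_zero (C - diagonal w).mulVecLin).2 fun v hv => ?_
  have := le_normSq_sub_diagonal hC hle v
  rw [show (C - diagonal w) *ᵥ v = 0 from hv] at this
  apply eq_zero_of_normSq_le_zero
  have h0 : √(normSq (0 : ι → ℂ)) = 0 := by simp [normSq]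
  rw [h0] at this
  have h1 : √(normSq v) ≤ 0 := by
    by_contra hcon
    push Not at hcon
    nlinarith
  exact Real.sqrt_eq_zero'.1 (le_antisymm h1 (Real.sqrt_nonneg _))

lemma isUnit_det_sub_diagonal (hC : C.IsHermitian) (hw : ∀ i, 0 < (w i).im) :
    IsUnit (C - diagonal w).det :=
  (isUnit_iff_isUnit_det _).1 (isUnit_sub_diagonal hC hw)

lemma sub_diagonal_mul_res (hC : C.IsHermitian) (hw : ∀ i, 0 < (w i).im) :
    (C - diagonal w) * res C w = 1 :=
  mul_nonsing_inv _ (isUnit_det_sub_diagonal hC hw)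

lemma res_mul_sub_diagonal (hC : C.IsHermitian) (hw : ∀ i, 0 < (w i).im) :
    res C w * (C - diagonal w) = 1 :=
  nonsing_inv_mul _ (isUnit_det_sub_diagonal hC hw)

lemma norm_res_le (hC : C.IsHermitian) {η : ℝ} (hη : 0 < η) (hw : ∀ i, η ≤ (w i).im) :
    ‖res C w‖ ≤ η⁻¹ := by
  refine opNorm_le_of_normSq_mulVec_le (by positivity) fun v => ?_
  have := le_normSq_sub_diagonal hC hw (res C w *ᵥ v)
  rw [mulVec_mulVec, sub_diagonal_mul_res hC fun i => hη.trans_le (hw i), one_mulVec] at this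
  have h2 := pow_le_pow_left₀ (by positivity) this 2
  rw [mul_pow, Real.sq_sqrt (normSq_nonneg _), Real.sq_sqrt (normSq_nonneg _)] at h2
  rw [inv_pow, inv_mul_eq_div, le_div_iff₀ (by positivity)]
  linarith

lemma imForm_res (hC : C.IsHermitian) (hw : ∀ i, 0 < (w i).im) (u : ι → ℂ) :
    imForm (res C w) u = ∑ i, (w i).im * ‖(res C w *ᵥ u) i‖ ^ 2 := by
  have h1 := im_form_hermitian_sub_diagonal hC w (res C w *ᵥ u)
  rw [mulVec_mulVec, sub_diagonal_mul_res hC hw, one_mulVec] at h1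
  rw [imForm, ← star_star_dotProduct, RCLike.star_def, Complex.conj_im, h1, neg_neg]

/-- The adjoint version of `imForm_res`. Both are needed: in the difference of two resolvents the
left vector meets the adjoint of the first resolvent and the right vector meets the second. -/
lemma imForm_res' (hC : C.IsHermitian) (hw : ∀ i, 0 < (w i).im) (u : ι → ℂ) :
    imForm (res C w) u = ∑ i, (w i).im * ‖((res C w)ᴴ *ᵥ u) i‖ ^ 2 := by
  have h1 := im_form_hermitian_sub_diagonal hC w ((res C w)ᴴ *ᵥ u)
  have h2 : (C - diagonal w)ᴴ *ᵥ ((res C w)ᴴ *ᵥ u) = u := by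
    rw [mulVec_mulVec, ← conjTranspose_mul, res_mul_sub_diagonal hC hw, conjTranspose_one,
      one_mulVec]
  rw [← neg_eq_iff_eq_neg] at h1
  rw [← h1, ← Complex.conj_im, ← RCLike.star_def, star_star_dotProduct,
    star_dotProduct_mulVec_conj, h2, imForm, star_dotProduct_mulVec_conj,
    conjTranspose_conjTranspose]

lemma imForm_res_nonneg (hC : C.IsHermitian) (hw : ∀ i, 0 < (w i).im) (u : ι → ℂ) :
    0 ≤ imForm (res C w) u := by
  rw [imForm_res hC hw]
  exact Finset.sum_nonneg fun i _ => mul_nonneg (hw i).le (by positivity)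

/-- Writing u as (C - diag w) applied to its resolvent image bounds the norm of u by R times that of
the image, whose weighted norm is the imaginary form. This gives a uniform start for the Dyson
iteration. -/
lemma le_imForm_res (hC : C.IsHermitian) {η : ℝ} (hη : 0 < η) (hw : ∀ i, η ≤ (w i).im)
    {R : ℝ} (hR : ‖C - diagonal w‖ ≤ R) (u : ι → ℂ) :
    η * normSq u ≤ R ^ 2 * imForm (res C w) u := by
  have hw' := fun i => hη.trans_le (hw i)
  have h1 := normSq_mulVec_le (C - diagonal w) (res C w *ᵥ u)
  rw [mulVec_mulVec, sub_diagonal_mul_res hC hw', one_mulVec] at h1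
  have h2 : η * normSq (res C w *ᵥ u) ≤ imForm (res C w) u := by
    rw [imForm_res hC hw', normSq, Finset.mul_sum]
    exact Finset.sum_le_sum fun i _ => mul_le_mul_of_nonneg_right (hw i) (by positivity)
  have h3 : ‖C - diagonal w‖ ^ 2 ≤ R ^ 2 := pow_le_pow_left₀ (norm_nonneg _) hR 2
  have h4 := normSq_nonneg (res C w *ᵥ u)
  nlinarith [mul_le_mul_of_nonneg_right h3 h4, mul_le_mul_of_nonneg_left h1 hη.le, sq_nonneg R]

lemma imForm_res_pos (hC : C.IsHermitian) (hw : ∀ i, 0 < (w i).im) {u : ι → ℂ} (hu : u ≠ 0) :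
    0 < imForm (res C w) u := by
  obtain ⟨η, hη, hle⟩ := exists_pos_le_of_forall_pos hw
  have h := le_imForm_res hC hη hle le_rfl u
  have hu' : 0 < normSq u := by
    by_contra hcon
    exact hu (eq_zero_of_normSq_le_zero (not_lt.1 hcon))
  by_contra hcon
  push Not at hcon
  nlinarith [sq_nonneg ‖C - diagonal w‖, mul_pos hη hu']

lemma im_res_diag_pos (hC : C.IsHermitian) (hw : ∀ i, 0 < (w i).im) (i : ι) :
    0 < (res C w i i).im := by
  rw [← imForm_single]
  exact imForm_res_pos hC hw (by simp)

lemma res_sub_res {w' : ι → ℂ} (hC : C.IsHermitian) (hw : ∀ i, 0 < (w i).im)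
    (hw' : ∀ i, 0 < (w' i).im) :
    res C w - res C w' = res C w * diagonal (w - w') * res C w' := by
  have : diagonal (w - w') = (C - diagonal w') - (C - diagonal w) := by
    rw [sub_sub_sub_cancel_left, diagonal_sub]; rfl
  rw [this, mul_sub, sub_mul, mul_assoc, sub_diagonal_mul_res hC hw', mul_one,
    res_mul_sub_diagonal hC hw, one_mul]

/-- A matrix form of the Schwarz–Pick inequality for `w ↦ (C - diag w)⁻¹`. -/
lemma norm_bilin_res_sub_res_le {w' : ι → ℂ} (hC : C.IsHermitian) (hw : ∀ i, 0 < (w i).im)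
    (hw' : ∀ i, 0 < (w' i).im) {M : ℝ} (hM : 0 ≤ M)
    (h : ∀ i, ‖w i - w' i‖ ≤ M * √((w i).im * (w' i).im)) (u v : ι → ℂ) :
    ‖star u ⬝ᵥ (res C w - res C w') *ᵥ v‖ ≤
      M * √(imForm (res C w) u * imForm (res C w') v) := by
  rw [res_sub_res hC hw hw', ← mulVec_mulVec, ← mulVec_mulVec]
  have e1 : star u ⬝ᵥ res C w *ᵥ diagonal (w - w') *ᵥ res C w' *ᵥ v =
      star ((res C w)ᴴ *ᵥ u) ⬝ᵥ diagonal (w - w') *ᵥ res C w' *ᵥ v := by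
    rw [star_dotProduct_mulVec_conj, conjTranspose_conjTranspose]
  rw [e1]
  set x := (res C w)ᴴ *ᵥ u
  set y := res C w' *ᵥ v
  rw [imForm_res' hC hw, imForm_res hC hw', Real.sqrt_mul
    (Finset.sum_nonneg fun i _ => mul_nonneg (hw i).le (by positivity))]
  -- Cauchy–Schwarz with weights √Im w on one side and √Im w' on the other: the two factors are
  -- exactly the imaginary forms of the two resolvents.
  have cs := Real.sum_mul_le_sqrt_mul_sqrt Finset.univ (fun i => √((w i).im) * ‖x i‖)
    (fun i => √((w' i).im) * ‖y i‖)
  simp only [mul_pow] at cs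
  simp only [Real.sq_sqrt (hw _).le, Real.sq_sqrt (hw' _).le] at cs
  refine le_trans ?_ (mul_le_mul_of_nonneg_left cs hM)
  rw [Finset.mul_sum]
  refine (norm_sum_le _ _).trans (Finset.sum_le_sum fun i _ => ?_)
  rw [mulVec_diagonal, Pi.star_apply, norm_mul, norm_mul, norm_star, Pi.sub_apply]
  have := h i
  rw [Real.sqrt_mul (hw i).le] at this
  calc ‖x i‖ * (‖w i - w' i‖ * ‖y i‖) = ‖w i - w' i‖ * (‖x i‖ * ‖y i‖) := by ring
    _ ≤ M * (√((w i).im) * √((w' i).im)) * (‖x i‖ * ‖y i‖) := by gcongr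
    _ = _ := by ring

end LinearAlgebra

/-! ### The vector Dyson equation: contraction, existence, uniqueness, stability, analyticity. -/

section Dyson

variable {ι : Type*} [Fintype ι]

/-- The linear map `g ↦ (∑_j s_ij g_j)_i`. -/
def shift (s : ι → ι → ℝ) (g : ι → ℂ) : ι → ℂ := fun i => ∑ j, (s i j : ℂ) * g j

lemma shift_im (s : ι → ι → ℝ) (g : ι → ℂ) (i : ι) :
    (shift s g i).im = ∑ j, s i j * (g j).im := by
  simp [shift, Complex.im_sum]

lemma shift_sub (s : ι → ι → ℝ) (g g' : ι → ℂ) (i : ι) :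
    shift s g i - shift s g' i = shift s (g - g') i := by
  simp [shift, ← Finset.sum_sub_distrib, mul_sub]

lemma norm_shift_le {s : ι → ι → ℝ} (hs : ∀ i j, 0 ≤ s i j) (g : ι → ℂ) (i : ι) :
    ‖shift s g i‖ ≤ ∑ j, s i j * ‖g j‖ := by
  refine (norm_sum_le _ _).trans (Finset.sum_le_sum fun j _ => ?_)
  rw [norm_mul, Complex.norm_real, Real.norm_of_nonneg (hs i j)]

lemma shift_im_nonneg {s : ι → ι → ℝ} (hs : ∀ i j, 0 ≤ s i j) {g : ι → ℂ}
    (hg : ∀ i, 0 ≤ (g i).im) (i : ι) : 0 ≤ (shift s g i).im := by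
  rw [shift_im]
  exact Finset.sum_nonneg fun j _ => mul_nonneg (hs i j) (hg j)

/-- Nonnegative combinations do not increase the hyperbolic ratio: Cauchy–Schwarz on the weighted
sum of √(Im g · Im g'). -/
lemma norm_shift_sub_le {s : ι → ι → ℝ} (hs : ∀ i j, 0 ≤ s i j) {g g' : ι → ℂ}
    (hg : ∀ i, 0 ≤ (g i).im) (hg' : ∀ i, 0 ≤ (g' i).im) {M : ℝ} (hM : 0 ≤ M)
    (h : ∀ i, ‖g i - g' i‖ ≤ M * √((g i).im * (g' i).im)) (i : ι) :
    ‖shift s g i - shift s g' i‖ ≤ M * √((shift s g i).im * (shift s g' i).im) := by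
  rw [shift_sub]
  refine (norm_shift_le hs _ i).trans ?_
  rw [Real.sqrt_mul (shift_im_nonneg hs hg i), shift_im, shift_im]
  have cs := Real.sum_mul_le_sqrt_mul_sqrt Finset.univ (fun j => √(s i j * (g j).im))
    (fun j => √(s i j * (g' j).im))
  simp only [Real.sq_sqrt (mul_nonneg (hs _ _) (hg _)),
    Real.sq_sqrt (mul_nonneg (hs _ _) (hg' _))] at cs
  refine le_trans ?_ (mul_le_mul_of_nonneg_left cs hM)
  rw [Finset.mul_sum]
  refine Finset.sum_le_sum fun j _ => ?_
  rw [← Real.sqrt_mul (mul_nonneg (hs i j) (hg j)),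
    show s i j * (g j).im * (s i j * (g' j).im) = s i j ^ 2 * ((g j).im * (g' j).im) by ring,
    Real.sqrt_mul (sq_nonneg _), Real.sqrt_sq (hs i j), Pi.sub_apply]
  calc s i j * ‖g j - g' j‖ ≤ s i j * (M * √((g j).im * (g' j).im)) :=
        mul_le_mul_of_nonneg_left (h j) (hs i j)
    _ = _ := by ring

lemma sqrt_mul_add_sqrt_mul_le {a b c d : ℝ} (ha : 0 ≤ a) (hb : 0 ≤ b) (hc : 0 ≤ c) (hd : 0 ≤ d) :
    √(a * b) + √(c * d) ≤ √((a + c) * (b + d)) := by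
  refine Real.le_sqrt_of_sq_le ?_
  rw [Real.sqrt_mul ha, Real.sqrt_mul hc]
  nlinarith [sq_nonneg (√a * √d - √c * √b), Real.sq_sqrt ha, Real.sq_sqrt hb, Real.sq_sqrt hc,
    Real.sq_sqrt hd]

/-- Here a, b are imaginary parts of the parameters and c, d those of the shifted vectors. Only the
excess K is to be shrunk, and it multiplies √(cd), which is at most the fraction θ of the total; M₀
is carried through unchanged by Cauchy–Schwarz. -/
lemma contraction_scalar {a b c d θ M₀ K : ℝ} (ha : 0 ≤ a) (hb : 0 ≤ b) (hc : 0 ≤ c) (hd : 0 ≤ d)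
    (hθ : 0 ≤ θ) (hM₀ : 0 ≤ M₀) (hK : 0 ≤ K) (hcθ : c ≤ θ * (a + c)) (hdθ : d ≤ θ * (b + d)) :
    M₀ * √(a * b) + (M₀ + K) * √(c * d) ≤ (M₀ + θ * K) * √((a + c) * (b + d)) := by
  have h1 := sqrt_mul_add_sqrt_mul_le ha hb hc hd
  have h2 : √(c * d) ≤ θ * √((a + c) * (b + d)) := by
    rw [← Real.sqrt_sq hθ, ← Real.sqrt_mul (sq_nonneg θ)]
    refine Real.sqrt_le_sqrt ?_
    rw [show θ ^ 2 * ((a + c) * (b + d)) = (θ * (a + c)) * (θ * (b + d)) by ring]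
    exact mul_le_mul hcθ hdθ hd (by positivity)
  nlinarith [mul_le_mul_of_nonneg_left h1 hM₀, mul_le_mul_of_nonneg_left h2 hK]

lemma norm_add_shift_sub_le {s : ι → ι → ℝ} (hs : ∀ i j, 0 ≤ s i j) {lam lam' g g' : ι → ℂ}
    (hlam : ∀ i, 0 < (lam i).im) (hlam' : ∀ i, 0 < (lam' i).im)
    (hg : ∀ i, 0 ≤ (g i).im) (hg' : ∀ i, 0 ≤ (g' i).im) {θ M₀ K : ℝ} (hθ : 0 ≤ θ)
    (hM₀ : 0 ≤ M₀) (hK : 0 ≤ K) (hd : ∀ i, ‖lam i - lam' i‖ ≤ M₀ * √((lam i).im * (lam' i).im))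
    (hcon : ∀ i, (shift s g i).im ≤ θ * ((lam i).im + (shift s g i).im))
    (hcon' : ∀ i, (shift s g' i).im ≤ θ * ((lam' i).im + (shift s g' i).im))
    (h : ∀ i, ‖g i - g' i‖ ≤ (M₀ + K) * √((g i).im * (g' i).im)) (i : ι) :
    ‖(lam + shift s g) i - (lam' + shift s g') i‖ ≤
      (M₀ + θ * K) * √(((lam + shift s g) i).im * ((lam' + shift s g') i).im) := by
  have h1 := norm_shift_sub_le hs hg hg' (add_nonneg hM₀ hK) h i
  have h2 := contraction_scalar (hlam i).le (hlam' i).le (shift_im_nonneg hs hg i)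
    (shift_im_nonneg hs hg' i) hθ hM₀ hK (hcon i) (hcon' i)
  simp only [Pi.add_apply, Complex.add_im]
  rw [add_sub_add_comm]
  exact (norm_add_le _ _).trans ((add_le_add (hd i) h1).trans h2)

/-- The shift has imaginary part at most σY while the parameter contributes at least η, and x / (η +
x) increases in x. This produces the contraction ratio. -/
lemma shift_im_le_of_le {s : ι → ι → ℝ} {σ Y η : ℝ} (hη : 0 < η) (hσ : 0 ≤ σ) (hY : 0 ≤ Y)
    (hs : ∀ i j, 0 ≤ s i j) (hsσ : ∀ i, ∑ j, s i j ≤ σ) {lam g : ι → ℂ}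
    (hlam : ∀ i, η ≤ (lam i).im) (hg : ∀ i, (g i).im ≤ Y) (i : ι) :
    (shift s g i).im ≤ σ * Y / (η + σ * Y) * ((lam i).im + (shift s g i).im) := by
  have h1 : (shift s g i).im ≤ σ * Y := by
    rw [shift_im]
    calc ∑ j, s i j * (g j).im ≤ ∑ j, s i j * Y :=
          Finset.sum_le_sum fun j _ => mul_le_mul_of_nonneg_left (hg j) (hs i j)
      _ ≤ σ * Y := by
          rw [← Finset.sum_mul]; exact mul_le_mul_of_nonneg_right (hsσ i) hY
  have h0 : 0 ≤ σ * Y := by positivity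
  rw [div_mul_eq_mul_div, le_div_iff₀ (by positivity)]
  nlinarith [hlam i, mul_le_mul_of_nonneg_left (hlam i) h0, mul_le_mul_of_nonneg_left h1 hη.le]

lemma add_shift_im_pos {s : ι → ι → ℝ} (hs : ∀ i j, 0 ≤ s i j) {lam g : ι → ℂ}
    (hlam : ∀ i, 0 < (lam i).im) (hg : ∀ i, 0 ≤ (g i).im) (i : ι) :
    0 < ((lam + shift s g) i).im := by
  rw [Pi.add_apply, Complex.add_im]
  exact add_pos_of_pos_of_nonneg (hlam i) (shift_im_nonneg hs hg i)

lemma le_add_shift_im {s : ι → ι → ℝ} (hs : ∀ i j, 0 ≤ s i j) {lam g : ι → ℂ} {η : ℝ}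
    (hlam : ∀ i, η ≤ (lam i).im) (hg : ∀ i, 0 ≤ (g i).im) (i : ι) :
    η ≤ ((lam + shift s g) i).im := by
  rw [Pi.add_apply, Complex.add_im]
  linarith [hlam i, shift_im_nonneg hs hg i]

lemma exists_norm_sub_le_mul_sqrt {g g' : ι → ℂ} (hg : ∀ i, 0 < (g i).im)
    (hg' : ∀ i, 0 < (g' i).im) :
    ∃ K : ℝ, 0 ≤ K ∧ ∀ i, ‖g i - g' i‖ ≤ K * √((g i).im * (g' i).im) := by
  have hpos : ∀ i, 0 < √((g i).im * (g' i).im) := fun i =>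
    Real.sqrt_pos.2 (mul_pos (hg i) (hg' i))
  have hnn : ∀ i, 0 ≤ ‖g i - g' i‖ / √((g i).im * (g' i).im) := fun i => by positivity
  refine ⟨∑ i, ‖g i - g' i‖ / √((g i).im * (g' i).im), Finset.sum_nonneg fun i _ => hnn i,
    fun i => ?_⟩
  rw [← div_le_iff₀ (hpos i)]
  exact Finset.single_le_sum (f := fun i => ‖g i - g' i‖ / √((g i).im * (g' i).im))
    (fun j _ => hnn j) (Finset.mem_univ i)

lemma exists_sum_le (s : ι → ι → ℝ) (hs : ∀ i j, 0 ≤ s i j) :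
    ∃ σ : ℝ, 0 ≤ σ ∧ ∀ i, ∑ j, s i j ≤ σ :=
  ⟨∑ i, ∑ j, s i j, Finset.sum_nonneg fun i _ => Finset.sum_nonneg fun j _ => hs i j, fun i =>
    Finset.single_le_sum (f := fun i => ∑ j, s i j)
      (fun i _ => Finset.sum_nonneg fun j _ => hs i j) (Finset.mem_univ i)⟩

variable [DecidableEq ι]

/-- The right-hand side of the vector Dyson equation. -/
noncomputable def dysonStep (C : Matrix ι ι ℂ) (s : ι → ι → ℝ) (lam g : ι → ℂ) : ι → ℂ :=
  fun i => res C (lam + shift s g) i i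

/-- `g` solves the vector Dyson equation at `lam`. -/
structure IsDysonSol (C : Matrix ι ι ℂ) (s : ι → ι → ℝ) (lam g : ι → ℂ) : Prop where
  im_pos : ∀ i, 0 < (g i).im
  eq : ∀ i, g i = res C (lam + shift s g) i i

variable {C : Matrix ι ι ℂ} {s : ι → ι → ℝ} {lam lam' g g' : ι → ℂ}

lemma norm_diag_res_sub_res_le {w w' : ι → ℂ} (hC : C.IsHermitian) (hw : ∀ i, 0 < (w i).im)
    (hw' : ∀ i, 0 < (w' i).im) {M : ℝ} (hM : 0 ≤ M)
    (h : ∀ i, ‖w i - w' i‖ ≤ M * √((w i).im * (w' i).im)) (i : ι) :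
    ‖res C w i i - res C w' i i‖ ≤ M * √((res C w i i).im * (res C w' i i).im) := by
  have := norm_bilin_res_sub_res_le hC hw hw' hM h (Pi.single i 1) (Pi.single i 1)
  rwa [star_single_dotProduct_mulVec_single, imForm_single, imForm_single] at this

lemma IsDysonSol.im_le (hC : C.IsHermitian) (hs : ∀ i j, 0 ≤ s i j) {η : ℝ} (hη : 0 < η)
    (hlam : ∀ i, η ≤ (lam i).im) (hg : IsDysonSol C s lam g) (i : ι) : (g i).im ≤ η⁻¹ := by
  rw [hg.eq]
  exact (Complex.im_le_norm _).trans ((norm_entry_le _ _ _).trans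
    (norm_res_le hC hη (le_add_shift_im hs hlam fun i => (hg.im_pos i).le)))

/-- Solutions have imaginary part at most η⁻¹, so one ratio below 1 serves both of them. -/
lemma IsDysonSol.exists_contraction (hC : C.IsHermitian) (hs : ∀ i j, 0 ≤ s i j)
    (hlam : ∀ i, 0 < (lam i).im) (hlam' : ∀ i, 0 < (lam' i).im)
    (hg : IsDysonSol C s lam g) (hg' : IsDysonSol C s lam' g') :
    ∃ θ : ℝ, 0 ≤ θ ∧ θ < 1 ∧
      (∀ i, (shift s g i).im ≤ θ * ((lam i).im + (shift s g i).im)) ∧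
      ∀ i, (shift s g' i).im ≤ θ * ((lam' i).im + (shift s g' i).im) := by
  obtain ⟨σ, hσ, hsσ⟩ := exists_sum_le s hs
  obtain ⟨η₁, hη₁, hle₁⟩ := exists_pos_le_of_forall_pos hlam
  obtain ⟨η₂, hη₂, hle₂⟩ := exists_pos_le_of_forall_pos hlam'
  have hη : 0 < min η₁ η₂ := lt_min hη₁ hη₂
  have h1 := fun i => (min_le_left η₁ η₂).trans (hle₁ i)
  have h2 := fun i => (min_le_right η₁ η₂).trans (hle₂ i)
  refine ⟨σ * (min η₁ η₂)⁻¹ / (min η₁ η₂ + σ * (min η₁ η₂)⁻¹), by positivity, ?_,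
    shift_im_le_of_le hη hσ (by positivity) hs hsσ h1 (hg.im_le hC hs hη h1),
    shift_im_le_of_le hη hσ (by positivity) hs hsσ h2 (hg'.im_le hC hs hη h2)⟩
  rw [div_lt_one (by positivity)]
  linarith

/-- Stability of the vector Dyson equation in the hyperbolic metric. -/
lemma IsDysonSol.stability (hC : C.IsHermitian) (hs : ∀ i j, 0 ≤ s i j)
    (hlam : ∀ i, 0 < (lam i).im) (hlam' : ∀ i, 0 < (lam' i).im)
    (hg : IsDysonSol C s lam g) (hg' : IsDysonSol C s lam' g') {M₀ : ℝ} (hM₀ : 0 ≤ M₀)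
    (hd : ∀ i, ‖lam i - lam' i‖ ≤ M₀ * √((lam i).im * (lam' i).im)) (i : ι) :
    ‖(lam + shift s g) i - (lam' + shift s g') i‖ ≤
      M₀ * √(((lam + shift s g) i).im * ((lam' + shift s g') i).im) := by
  obtain ⟨θ, hθ, hθ1, hc, hc'⟩ := hg.exists_contraction hC hs hlam hlam' hg'
  obtain ⟨K, hK, hKle⟩ := exists_norm_sub_le_mul_sqrt hg.im_pos hg'.im_pos
  have hn := fun i => (hg.im_pos i).le
  have hn' := fun i => (hg'.im_pos i).le
  -- Feeding the equation into itself replaces the excess K over M₀ by θK at every round; in the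
  -- limit only M₀ remains. The initial K is finite because there are finitely many coordinates.
  have key : ∀ k : ℕ, ∀ i, ‖g i - g' i‖ ≤ (M₀ + θ ^ k * K) * √((g i).im * (g' i).im) := by
    intro k
    induction k with
    | zero =>
      intro i
      refine (hKle i).trans (mul_le_mul_of_nonneg_right ?_ (Real.sqrt_nonneg _))
      simpa using hM₀
    | succ k ih =>
      intro i
      have := norm_diag_res_sub_res_le hC (add_shift_im_pos hs hlam hn)
        (add_shift_im_pos hs hlam' hn') (by positivity)
        (norm_add_shift_sub_le hs hlam hlam' hn hn' hθ hM₀ (by positivity) hd hc hc' ih) i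
      rw [← hg.eq, ← hg'.eq] at this
      rwa [pow_succ', mul_assoc]
  have hlim : ∀ i, ‖g i - g' i‖ ≤ (M₀ + 0) * √((g i).im * (g' i).im) := by
    intro i
    have ht : Tendsto (fun k : ℕ => (M₀ + θ ^ k * K) * √((g i).im * (g' i).im)) atTop
        (𝓝 ((M₀ + 0 * K) * √((g i).im * (g' i).im))) :=
      (((tendsto_pow_atTop_nhds_zero_of_lt_one hθ hθ1).mul_const K).const_add M₀).mul_const _
    rw [zero_mul] at ht
    exact ge_of_tendsto' ht fun k => key k i
  -- One more half-step, with zero excess, passes from the solutions to the arguments of the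
  -- resolvents.
  simpa using norm_add_shift_sub_le hs hlam hlam' hn hn' hθ hM₀ le_rfl hd hc hc' hlim i

/-- Stability with M₀ = 0 makes the arguments of the two resolvents coincide. -/
lemma IsDysonSol.unique (hC : C.IsHermitian) (hs : ∀ i j, 0 ≤ s i j)
    (hlam : ∀ i, 0 < (lam i).im) (hg : IsDysonSol C s lam g) (hg' : IsDysonSol C s lam g') :
    g = g' := by
  have h := hg.stability hC hs hlam hlam hg' le_rfl (fun i => by simp)
  simp only [zero_mul, norm_le_zero_iff, sub_eq_zero] at h
  ext i
  rw [hg.eq, hg'.eq, funext h]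

lemma tendsto_res {α : Type*} {l : Filter α} (hC : C.IsHermitian) {f : α → ι → ℂ} {w : ι → ℂ}
    (hw : ∀ i, 0 < (w i).im) (hf : Tendsto f l (𝓝 w)) :
    Tendsto (fun k => res C (f k)) l (𝓝 (res C w)) := by
  obtain ⟨u, hu⟩ := isUnit_sub_diagonal hC hw
  have h1 := NormedRing.inverse_continuousAt u
  rw [hu] at h1
  have h2 : Continuous fun v : ι → ℂ => C - diagonal v := by fun_prop
  have h3 := h1.tendsto.comp ((h2.tendsto w).comp hf)
  simpa [res, nonsing_inv_eq_ringInverse, Function.comp_def] using h3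

lemma differentiableAt_res (hC : C.IsHermitian) {f : ℂ → ι → ℂ} {z : ℂ}
    (hw : ∀ i, 0 < (f z i).im) (hf : ∀ i, DifferentiableAt ℂ (fun x => f x i) z) (a b : ι) :
    DifferentiableAt ℂ (fun x => res C (f x) a b) z := by
  have h1 := differentiableAt_inverse (𝕜 := ℂ) (isUnit_sub_diagonal hC hw)
  have h2 : DifferentiableAt ℂ (fun x => C - diagonal (f x)) z := by
    refine (differentiableAt_const C).sub ?_
    exact ((Matrix.diagonalLinearMap ι ℂ ℂ).toContinuousLinearMap.differentiableAt).comp z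
      (differentiableAt_pi.2 hf)
  have h3 := h1.comp z h2
  have h4 := ((Matrix.entryLinearMap ℂ ℂ a b).toContinuousLinearMap.differentiableAt).comp z h3
  simpa [res, nonsing_inv_eq_ringInverse, Function.comp_def] using h4

/-- The iteration of the Dyson equation, started at the constant vector `i`. -/
noncomputable def dysonSeq (C : Matrix ι ι ℂ) (s : ι → ι → ℝ) (lam : ι → ℂ) : ℕ → ι → ℂ
  | 0 => fun _ => Complex.I
  | k + 1 => dysonStep C s lam (dysonSeq C s lam k)

lemma dysonSeq_im_pos (hC : C.IsHermitian) (hs : ∀ i j, 0 ≤ s i j)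
    (hlam : ∀ i, 0 < (lam i).im) (k : ℕ) (i : ι) : 0 < (dysonSeq C s lam k i).im := by
  induction k generalizing i with
  | zero => simp [dysonSeq]
  | succ k ih => exact im_res_diag_pos hC (add_shift_im_pos hs hlam fun i => (ih i).le) i

lemma norm_dysonSeq_le (hC : C.IsHermitian) (hs : ∀ i j, 0 ≤ s i j) {η : ℝ} (hη : 0 < η)
    (hlam : ∀ i, η ≤ (lam i).im) (k : ℕ) (i : ι) : ‖dysonSeq C s lam k i‖ ≤ 1 + η⁻¹ := by
  have : 0 < η⁻¹ := inv_pos.2 hη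
  cases k with
  | zero => simp [dysonSeq, this.le]
  | succ k =>
    have := (norm_entry_le _ i i).trans (norm_res_le hC hη (le_add_shift_im hs hlam
      fun i => (dysonSeq_im_pos hC hs (fun i => hη.trans_le (hlam i)) k i).le))
    exact this.trans (by linarith)

/-- The iteration of the Dyson equation converges geometrically, locally uniformly in `lam`. -/
lemma exists_geometric_bound (hC : C.IsHermitian) (hs : ∀ i j, 0 ≤ s i j) {η : ℝ} (hη : 0 < η)
    (ρ : ℝ) (hρ : 0 ≤ ρ) : ∃ K θ : ℝ, 0 ≤ θ ∧ θ < 1 ∧ ∀ lam : ι → ℂ,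
      (∀ i, η ≤ (lam i).im) → (∀ i, ‖lam i‖ ≤ ρ) → ∀ k i,
        ‖dysonSeq C s lam k i - dysonSeq C s lam (k + 1) i‖ ≤ K * θ ^ k := by
  obtain ⟨σ, hσ, hsσ⟩ := exists_sum_le s hs
  -- Y bounds all iterates (the 1 covers the starting vector), R bounds the matrix inverted in the
  -- first step, and K bounds the hyperbolic ratio between iterates 0 and 1, the latter having
  -- imaginary part at least η / R².
  set Y := 1 + η⁻¹ with hY
  have hY0 : 0 < Y := by positivity
  set R := ‖C‖ + (ρ + σ) + 1 with hR
  have hR0 : 0 < R := by positivity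
  set θ := σ * Y / (η + σ * Y) with hθ
  have hθ0 : 0 ≤ θ := by positivity
  set K := 2 * Y / √(η / R ^ 2) with hK
  have hr : 0 < √(η / R ^ 2) := Real.sqrt_pos.2 (by positivity)
  refine ⟨K * Y, θ, hθ0, ?_, fun lam hlam hlamρ k i => ?_⟩
  · rw [hθ, div_lt_one (by positivity)]; linarith
  have hlam0 := fun i => hη.trans_le (hlam i)
  have him := dysonSeq_im_pos (lam := lam) hC hs hlam0
  have hub := norm_dysonSeq_le (lam := lam) hC hs hη hlam
  have hcon : ∀ k i, (shift s (dysonSeq C s lam k) i).im ≤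
      θ * ((lam i).im + (shift s (dysonSeq C s lam k) i).im) := fun k =>
    shift_im_le_of_le hη hσ hY0.le hs hsσ hlam
      fun i => (Complex.im_le_norm _).trans (hub k i)
  have key : ∀ k i, ‖dysonSeq C s lam k i - dysonSeq C s lam (k + 1) i‖ ≤
      (0 + θ ^ k * K) * √((dysonSeq C s lam k i).im * (dysonSeq C s lam (k + 1) i).im) := by
    intro k
    induction k with
    | zero =>
      intro i
      have hw : ‖C - diagonal (lam + shift s (dysonSeq C s lam 0))‖ ≤ R := by
        refine (norm_sub_le _ _).trans ?_
        have : ‖(diagonal (lam + shift s (dysonSeq C s lam 0)) : Matrix ι ι ℂ)‖ ≤ ρ + σ := by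
          refine opNorm_diagonal_le (by positivity) fun i => ?_
          refine (norm_add_le _ _).trans (add_le_add (hlamρ i) ((norm_shift_le hs _ i).trans ?_))
          simpa [dysonSeq] using hsσ i
        linarith
      have h1 := le_imForm_res hC hη (le_add_shift_im hs hlam fun i => (him 0 i).le) hw
        (Pi.single i 1)
      rw [imForm_single, normSq_single, norm_one, one_pow, mul_one] at h1
      have h2 : η / R ^ 2 ≤ (dysonSeq C s lam 1 i).im := by
        rw [div_le_iff₀ (by positivity), mul_comm]; exact h1
      have h3 : (dysonSeq C s lam 0 i).im = 1 := by simp [dysonSeq]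
      rw [zero_add, pow_zero, one_mul, h3, one_mul, zero_add]
      calc ‖dysonSeq C s lam 0 i - dysonSeq C s lam 1 i‖ ≤ Y + Y :=
            (norm_sub_le _ _).trans (add_le_add (hub 0 i) (hub 1 i))
        _ = K * √(η / R ^ 2) := by rw [hK, div_mul_cancel₀ _ hr.ne']; ring
        _ ≤ K * √((dysonSeq C s lam 1 i).im) :=
            mul_le_mul_of_nonneg_left (Real.sqrt_le_sqrt h2) (by positivity)
    | succ k ih =>
      intro i
      have := norm_diag_res_sub_res_le hC (add_shift_im_pos hs hlam0 fun i => (him k i).le)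
        (add_shift_im_pos hs hlam0 fun i => (him (k + 1) i).le) (by positivity)
        (norm_add_shift_sub_le hs hlam0 hlam0 (fun i => (him k i).le)
          (fun i => (him (k + 1) i).le) hθ0 le_rfl (by positivity) (fun i => by simp)
          (hcon k) (hcon (k + 1)) ih) i
      rwa [pow_succ', mul_assoc]
  refine (key k i).trans ?_
  have h4 : √((dysonSeq C s lam k i).im * (dysonSeq C s lam (k + 1) i).im) ≤ Y := by
    rw [← Real.sqrt_mul_self hY0.le]
    exact Real.sqrt_le_sqrt (mul_le_mul ((Complex.im_le_norm _).trans (hub k i))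
      ((Complex.im_le_norm _).trans (hub (k + 1) i)) (him _ i).le hY0.le)
  calc (0 + θ ^ k * K) * √((dysonSeq C s lam k i).im * (dysonSeq C s lam (k + 1) i).im)
      ≤ (0 + θ ^ k * K) * Y := mul_le_mul_of_nonneg_left h4 (by positivity)
    _ = K * Y * θ ^ k := by ring

/-- The solution of the vector Dyson equation. -/
noncomputable def dysonSol (C : Matrix ι ι ℂ) (s : ι → ι → ℝ) (lam : ι → ℂ) : ι → ℂ :=
  fun i => limUnder atTop fun k => dysonSeq C s lam k i

lemma tendsto_dysonSeq (hC : C.IsHermitian) (hs : ∀ i j, 0 ≤ s i j)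
    (hlam : ∀ i, 0 < (lam i).im) (i : ι) :
    Tendsto (fun k => dysonSeq C s lam k i) atTop (𝓝 (dysonSol C s lam i)) := by
  obtain ⟨η, hη, hle⟩ := exists_pos_le_of_forall_pos hlam
  obtain ⟨K, θ, -, hθ1, hK⟩ := exists_geometric_bound hC hs hη (∑ i, ‖lam i‖)
    (Finset.sum_nonneg fun _ _ => norm_nonneg _)
  refine (cauchySeq_of_le_geometric θ K hθ1 fun k => ?_).tendsto_limUnder
  rw [dist_eq_norm]
  exact hK lam hle (fun i => Finset.single_le_sum (f := fun i => ‖lam i‖)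
    (fun _ _ => norm_nonneg _) (Finset.mem_univ i)) k i

/-- The limit a priori has only nonnegative imaginary parts. That suffices to pass to the limit
inside the resolvent, and the equation then restores strict positivity. -/
lemma isDysonSol_dysonSol (hC : C.IsHermitian) (hs : ∀ i j, 0 ≤ s i j)
    (hlam : ∀ i, 0 < (lam i).im) : IsDysonSol C s lam (dysonSol C s lam) := by
  have ht := tendsto_dysonSeq hC hs hlam
  have h0 : ∀ i, 0 ≤ (dysonSol C s lam i).im := fun i =>
    ge_of_tendsto' ((Complex.continuous_im.tendsto _).comp (ht i))
      fun k => (dysonSeq_im_pos hC hs hlam k i).le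
  have hpos := add_shift_im_pos hs hlam h0
  have heq : ∀ i, dysonSol C s lam i = res C (lam + shift s (dysonSol C s lam)) i i := by
    intro i
    have hsh : Tendsto (fun k => lam + shift s (dysonSeq C s lam k)) atTop
        (𝓝 (lam + shift s (dysonSol C s lam))) := by
      refine tendsto_const_nhds.add (tendsto_pi_nhds.2 fun i => ?_)
      exact tendsto_finsetSum _ fun j _ => (ht j).const_mul _
    have h1 := tendsto_res hC hpos hsh
    have h2 : Continuous fun M : Matrix ι ι ℂ => M i i := by fun_prop
    exact tendsto_nhds_unique ((tendsto_add_atTop_iff_nat 1).2 (ht i))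
      ((h2.tendsto _).comp h1)
  exact ⟨fun i => by rw [heq]; exact im_res_diag_pos hC hpos i, heq⟩

/-- A locally uniform limit of holomorphic iterates. The geometric rate depends only on a lower
bound for the imaginary parts and an upper bound for the moduli, both stable near a point. -/
lemma differentiableOn_dysonSol (hC : C.IsHermitian) (hs : ∀ i j, 0 ≤ s i j) {f : ℂ → ι → ℂ}
    {U : Set ℂ} (hU : IsOpen U) (hf : ∀ z ∈ U, ∀ i, 0 < (f z i).im)
    (hd : ∀ i, DifferentiableOn ℂ (fun z => f z i) U) (i : ι) :
    DifferentiableOn ℂ (fun z => dysonSol C s (f z) i) U := by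
  have hseq : ∀ k i, DifferentiableOn ℂ (fun z => dysonSeq C s (f z) k i) U := by
    intro k
    induction k with
    | zero => intro i; exact differentiableOn_const _
    | succ k ih =>
      intro i z hz
      refine (differentiableAt_res hC (add_shift_im_pos hs (hf z hz)
        fun i => (dysonSeq_im_pos hC hs (hf z hz) k i).le) (fun j => ?_) i i).differentiableWithinAt
      refine ((hd j).differentiableAt (hU.mem_nhds hz)).add ?_
      exact DifferentiableAt.fun_sum fun l _ =>
        ((ih l).differentiableAt (hU.mem_nhds hz)).const_mul _
  refine TendstoLocallyUniformlyOn.differentiableOn (φ := atTop)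
    (F := fun k z => dysonSeq C s (f z) k i) ?_ (Eventually.of_forall fun k => hseq k i) hU
  rw [Metric.tendstoLocallyUniformlyOn_iff]
  intro ε hε z hz
  obtain ⟨η, hη, hle⟩ := exists_pos_le_of_forall_pos (hf z hz)
  have hcont : ∀ j, ContinuousAt (fun z => f z j) z := fun j =>
    ((hd j).differentiableAt (hU.mem_nhds hz)).continuousAt
  have h1 : ∀ᶠ x in 𝓝 z, ∀ j, η / 2 ≤ (f x j).im := by
    refine eventually_all.2 fun j => ?_
    have : η / 2 < (f z j).im := by linarith [hle j]
    exact ((Complex.continuous_im.continuousAt.comp (hcont j)).eventually_const_lt this).mono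
      fun x hx => le_of_lt hx
  set ρ := ∑ j, ‖f z j‖ + 1 with hρ
  have h2 : ∀ᶠ x in 𝓝 z, ∀ j, ‖f x j‖ ≤ ρ := by
    refine eventually_all.2 fun j => ?_
    have : ‖f z j‖ < ρ := by
      have := Finset.single_le_sum (f := fun j => ‖f z j‖)
        (fun _ _ => norm_nonneg _) (Finset.mem_univ j)
      linarith
    exact ((hcont j).norm.eventually_lt_const this).mono fun x hx => le_of_lt hx
  obtain ⟨K, θ, hθ0, hθ1, hK⟩ := exists_geometric_bound hC hs (half_pos hη) ρ
    (add_nonneg (Finset.sum_nonneg fun _ _ => norm_nonneg _) zero_le_one)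
  refine ⟨{x | (∀ j, η / 2 ≤ (f x j).im) ∧ ∀ j, ‖f x j‖ ≤ ρ},
    mem_nhdsWithin_of_mem_nhds (h1.and h2), ?_⟩
  have ht : Tendsto (fun k : ℕ => K * θ ^ k / (1 - θ)) atTop (𝓝 (K * 0 / (1 - θ))) :=
    ((tendsto_pow_atTop_nhds_zero_of_lt_one hθ0 hθ1).const_mul K).div_const _
  rw [mul_zero, zero_div] at ht
  filter_upwards [ht.eventually_lt_const hε] with k hk x hx
  rw [dist_comm]
  refine lt_of_le_of_lt ?_ hk
  refine dist_le_of_le_geometric_of_tendsto θ K hθ1 (fun k => ?_)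
    (tendsto_dysonSeq hC hs (fun j => (half_pos hη).trans_le (hx.1 j)) i) k
  rw [dist_eq_norm]
  exact hK (f x) hx.1 hx.2 k i

/-- Stability holds with M₀ = ε / √(ηη'), and the imaginary forms of the two resolvents are at most
η⁻¹ and η'⁻¹ times the squared norms; the square roots combine to ε / (ηη'). -/
lemma IsDysonSol.norm_res_sub_res_le (hC : C.IsHermitian) (hs : ∀ i j, 0 ≤ s i j) {η η' ε : ℝ}
    (hη : 0 < η) (hη' : 0 < η') (hε : 0 ≤ ε)
    (hlam : ∀ i, η ≤ (lam i).im) (hlam' : ∀ i, η' ≤ (lam' i).im)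
    (hg : IsDysonSol C s lam g) (hg' : IsDysonSol C s lam' g')
    (hd : ∀ i, ‖lam i - lam' i‖ ≤ ε) :
    ‖res C (lam + shift s g) - res C (lam' + shift s g')‖ ≤ ε / (η * η') := by
  have hlam0 := fun i => hη.trans_le (hlam i)
  have hlam0' := fun i => hη'.trans_le (hlam' i)
  have hq : 0 < √(η * η') := Real.sqrt_pos.2 (by positivity)
  have hM : 0 ≤ ε / √(η * η') := by positivity
  have hst := hg.stability hC hs hlam0 hlam0' hg' hM fun i => by
    refine (hd i).trans ?_
    rw [div_mul_eq_mul_div, le_div_iff₀ hq]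
    exact mul_le_mul_of_nonneg_left (Real.sqrt_le_sqrt (mul_le_mul (hlam i) (hlam' i) hη'.le
      (hlam0 i).le)) hε
  have hw := add_shift_im_pos hs hlam0 fun i => (hg.im_pos i).le
  have hw' := add_shift_im_pos hs hlam0' fun i => (hg'.im_pos i).le
  refine opNorm_le_of_bilin_le (by positivity) fun u v => ?_
  refine (norm_bilin_res_sub_res_le hC hw hw' hM hst u v).trans ?_
  have h1 := (imForm_le (res C (lam + shift s g)) u).trans (mul_le_mul_of_nonneg_right
    (norm_res_le hC hη (le_add_shift_im hs hlam fun i => (hg.im_pos i).le)) (normSq_nonneg u))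
  have h2 := (imForm_le (res C (lam' + shift s g')) v).trans (mul_le_mul_of_nonneg_right
    (norm_res_le hC hη' (le_add_shift_im hs hlam' fun i => (hg'.im_pos i).le)) (normSq_nonneg v))
  have h3 : √(imForm (res C (lam + shift s g)) u * imForm (res C (lam' + shift s g')) v) ≤
      √(normSq u) * √(normSq v) / √(η * η') := by
    rw [← Real.sqrt_mul (normSq_nonneg u), ← Real.sqrt_div' _ (by positivity)]
    refine Real.sqrt_le_sqrt ((mul_le_mul h1 h2 (imForm_res_nonneg hC hw' v)
      (mul_nonneg (by positivity) (normSq_nonneg u))).trans_eq ?_)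
    field_simp
  calc ε / √(η * η') * √(imForm (res C (lam + shift s g)) u * imForm (res C (lam' + shift s g')) v)
      ≤ ε / √(η * η') * (√(normSq u) * √(normSq v) / √(η * η')) :=
        mul_le_mul_of_nonneg_left h3 hM
    _ = ε / (√(η * η') * √(η * η')) * √(normSq u) * √(normSq v) := by field_simp
    _ = _ := by rw [Real.mul_self_sqrt (by positivity)]

end Dyson

/-! ### Gaussian concentration, variance bound and integration by parts via rotations. -/

section Gaussian

lemma hasDerivAt_rotation_fst {G : Type*} [NormedAddCommGroup G] [NormedSpace ℝ G] (x y : G)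
    (θ : ℝ) :
    HasDerivAt (fun θ => Real.cos θ • x + Real.sin θ • y)
      (-Real.sin θ • x + Real.cos θ • y) θ :=
  ((Real.hasDerivAt_cos θ).smul_const x).add ((Real.hasDerivAt_sin θ).smul_const y)

/-- Jensen's inequality along the quarter circle from `x` to `y`. -/
lemma exp_sub_le_integral {G : Type*} [NormedAddCommGroup G] [NormedSpace ℝ G] {F : G → ℝ}
    (hF : ContDiff ℝ 1 F) (t : ℝ) (x y : G) :
    Real.exp (t * (F y - F x)) ≤ ∫ u in Set.Ioc (0 : ℝ) 1, Real.exp (t * (Real.pi / 2) *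
      fderiv ℝ F (Real.cos (Real.pi / 2 * u) • x + Real.sin (Real.pi / 2 * u) • y)
        (-Real.sin (Real.pi / 2 * u) • x + Real.cos (Real.pi / 2 * u) • y)) := by
  have hF' : Continuous (fderiv ℝ F) := hF.continuous_fderiv one_ne_zero
  set f : ℝ → ℝ := fun u => t * (Real.pi / 2) *
      fderiv ℝ F (Real.cos (Real.pi / 2 * u) • x + Real.sin (Real.pi / 2 * u) • y)
        (-Real.sin (Real.pi / 2 * u) • x + Real.cos (Real.pi / 2 * u) • y) with hf
  have hfc : Continuous f := by
    refine continuous_const.mul ?_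
    exact (hF'.comp (by fun_prop)).clm_apply (by fun_prop)
  have hint : ∫ u in (0 : ℝ)..1, f u = t * (F y - F x) := by
    have hd : ∀ u ∈ Set.uIcc (0 : ℝ) 1, HasDerivAt
        (fun u => t * F (Real.cos (Real.pi / 2 * u) • x + Real.sin (Real.pi / 2 * u) • y))
        (f u) u := by
      intro u _
      have h1 : HasDerivAt (fun u : ℝ => Real.pi / 2 * u) (Real.pi / 2) u := by
        simpa using (hasDerivAt_id u).const_mul (Real.pi / 2)
      have h2 := (hasDerivAt_rotation_fst x y (Real.pi / 2 * u)).scomp u h1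
      have h3 := ((hF.differentiable one_ne_zero _).hasFDerivAt.comp_hasDerivAt u h2).const_mul t
      refine h3.congr_deriv ?_
      simp only [Function.comp_apply, map_smul, smul_eq_mul, hf]
      ring
    rw [intervalIntegral.integral_eq_sub_of_hasDerivAt hd (hfc.intervalIntegrable _ _)]
    simp
    ring
  rw [intervalIntegral.integral_of_le zero_le_one] at hint
  rw [← hint]
  -- The increment of F is now an average over the unit interval, so Jensen applies to the
  -- exponential.
  have : IsProbabilityMeasure (volume.restrict (Set.Ioc (0 : ℝ) 1)) := ⟨by simp⟩
  refine convexOn_exp.map_integral_le Real.continuous_exp.continuousOn isClosed_univ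
    (ae_of_all _ fun _ => Set.mem_univ _) ?_ ?_
  · exact (hfc.integrableOn_Icc (a := 0) (b := 1)).mono_set Set.Ioc_subset_Icc_self
  · exact ((Real.continuous_exp.comp hfc).integrableOn_Icc (a := 0) (b := 1)).mono_set
      Set.Ioc_subset_Icc_self

variable {E : Type*} [NormedAddCommGroup E] [InnerProductSpace ℝ E] [FiniteDimensional ℝ E]
  [MeasurableSpace E] [BorelSpace E]

/-- Point and velocity on the quarter circle between two independent Gaussian vectors are again
independent Gaussian vectors. -/
lemma map_rotation_stdGaussian (θ : ℝ) :
    ((stdGaussian E).prod (stdGaussian E)).map (ContinuousLinearMap.rotation θ) =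
      (stdGaussian E).prod (stdGaussian E) :=
  IsGaussian.map_rotation_eq_self_of_forall_strongDual_eq_zero
    (fun L => integral_strongDual_stdGaussian L) θ

lemma mgf_dual_stdGaussian (ℓ : StrongDual ℝ E) (t : ℝ) :
    mgf ℓ (stdGaussian E) t = Real.exp (‖ℓ‖ ^ 2 * t ^ 2 / 2) := by
  have h := IsGaussian.map_eq_gaussianReal (μ := stdGaussian E) ℓ
  rw [mgf_gaussianReal h, integral_strongDual_stdGaussian, variance_dual_stdGaussian,
    Real.coe_toNNReal _ (sq_nonneg _), zero_mul, zero_add]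

lemma lintegral_exp_dual_stdGaussian (ℓ : StrongDual ℝ E) (t : ℝ) :
    ∫⁻ y, ENNReal.ofReal (Real.exp (t * ℓ y)) ∂(stdGaussian E) =
      ENNReal.ofReal (Real.exp (‖ℓ‖ ^ 2 * t ^ 2 / 2)) := by
  rw [← mgf_dual_stdGaussian, mgf, ofReal_integral_eq_lintegral_ofReal]
  -- Integrability comes from the closed form: otherwise the integral would take its default value
  -- 0, which is not an exponential.
  · have h := mgf_dual_stdGaussian ℓ t
    by_contra hcon
    rw [mgf, integral_undef hcon] at h
    exact (Real.exp_pos _).ne h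
  · exact ae_of_all _ fun _ => (Real.exp_pos _).le

variable {F : E → ℝ} {B L : ℝ}

/-- Rotation invariance replaces position and velocity by an independent pair. With the position
fixed, the derivative is a linear functional of norm at most L evaluated at a Gaussian vector. -/
lemma lintegral_exp_fderiv_le (hF : ContDiff ℝ 1 F) (hL : ∀ x, ‖fderiv ℝ F x‖ ≤ L) (t θ : ℝ) :
    ∫⁻ p : E × E, ENNReal.ofReal (Real.exp (t *
      fderiv ℝ F (Real.cos θ • p.1 + Real.sin θ • p.2) (-Real.sin θ • p.1 + Real.cos θ • p.2)))
      ∂((stdGaussian E).prod (stdGaussian E)) ≤ ENNReal.ofReal (Real.exp (L ^ 2 * t ^ 2 / 2)) := by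
  have hF' : Continuous (fderiv ℝ F) := hF.continuous_fderiv one_ne_zero
  have hG : Measurable fun p : E × E =>
      ENNReal.ofReal (Real.exp (t * fderiv ℝ F p.1 p.2)) := by
    refine (Continuous.measurable ?_).ennreal_ofReal
    exact Real.continuous_exp.comp
      (continuous_const.mul ((hF'.comp continuous_fst).clm_apply continuous_snd))
  have h1 := lintegral_map (μ := (stdGaussian E).prod (stdGaussian E)) hG
    (ContinuousLinearMap.rotation (E := E) θ).continuous.measurable
  rw [map_rotation_stdGaussian] at h1
  simp only [ContinuousLinearMap.rotation_apply] at h1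
  rw [← h1, lintegral_prod _ hG.aemeasurable]
  calc _ ≤ ∫⁻ _ : E, ENNReal.ofReal (Real.exp (L ^ 2 * t ^ 2 / 2)) ∂(stdGaussian E) := by
        refine lintegral_mono fun x => ?_
        simp only
        rw [lintegral_exp_dual_stdGaussian]
        gcongr
        exact hL x
    _ = _ := by simp

lemma integrable_of_bound {α : Type*} [MeasurableSpace α] [TopologicalSpace α]
    [OpensMeasurableSpace α] {μ : Measure α} [IsFiniteMeasure μ] {G : Type*} [NormedAddCommGroup G]
    [SecondCountableTopologyEither α G] {f : α → G} (hf : Continuous f) {b : ℝ}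
    (hb : ∀ x, ‖f x‖ ≤ b) : Integrable f μ :=
  Integrable.of_bound hf.aestronglyMeasurable b (ae_of_all _ hb)

/-- The Maurey–Pisier inequality. -/
lemma integral_exp_sub_le (hF : ContDiff ℝ 1 F) (hB : ∀ x, |F x| ≤ B)
    (hL : ∀ x, ‖fderiv ℝ F x‖ ≤ L) (t : ℝ) :
    ∫ p : E × E, Real.exp (t * (F p.2 - F p.1)) ∂((stdGaussian E).prod (stdGaussian E)) ≤
      Real.exp (Real.pi ^ 2 * L ^ 2 / 4 * t ^ 2 / 2) := by
  have hF' : Continuous (fderiv ℝ F) := hF.continuous_fderiv one_ne_zero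
  have hFc := hF.continuous
  rw [← ENNReal.ofReal_le_ofReal_iff (Real.exp_pos _).le, ofReal_integral_eq_lintegral_ofReal]
  rotate_left
  · refine integrable_of_bound (by fun_prop) (b := Real.exp (|t| * (B + B))) fun p => ?_
    rw [Real.norm_of_nonneg (Real.exp_pos _).le, Real.exp_le_exp]
    refine (le_abs_self _).trans ?_
    rw [abs_mul]
    exact mul_le_mul_of_nonneg_left ((abs_sub _ _).trans (add_le_add (hB _) (hB _)))
      (abs_nonneg t)
  · exact ae_of_all _ fun _ => (Real.exp_pos _).le
  have hcont : Continuous fun q : (E × E) × ℝ => Real.exp (t * (Real.pi / 2) *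
      fderiv ℝ F (Real.cos (Real.pi / 2 * q.2) • q.1.1 + Real.sin (Real.pi / 2 * q.2) • q.1.2)
        (-Real.sin (Real.pi / 2 * q.2) • q.1.1 + Real.cos (Real.pi / 2 * q.2) • q.1.2)) := by
    refine Real.continuous_exp.comp (continuous_const.mul ?_)
    exact (hF'.comp (by fun_prop)).clm_apply (by fun_prop)
  calc _ ≤ ∫⁻ p : E × E, (∫⁻ u in Set.Ioc (0 : ℝ) 1, ENNReal.ofReal (Real.exp (t * (Real.pi / 2) *
      fderiv ℝ F (Real.cos (Real.pi / 2 * u) • p.1 + Real.sin (Real.pi / 2 * u) • p.2)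
        (-Real.sin (Real.pi / 2 * u) • p.1 + Real.cos (Real.pi / 2 * u) • p.2))))
        ∂((stdGaussian E).prod (stdGaussian E)) := by
        refine lintegral_mono fun p => ?_
        refine (ENNReal.ofReal_le_ofReal (exp_sub_le_integral hF t p.1 p.2)).trans_eq ?_
        refine ofReal_integral_eq_lintegral_ofReal ?_ (ae_of_all _ fun _ => (Real.exp_pos _).le)
        exact ((hcont.comp (Continuous.prodMk_right p)).integrableOn_Icc
          (a := 0) (b := 1)).mono_set Set.Ioc_subset_Icc_self
    _ = ∫⁻ u in Set.Ioc (0 : ℝ) 1, ∫⁻ p : E × E, ENNReal.ofReal (Real.exp (t * (Real.pi / 2) *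
      fderiv ℝ F (Real.cos (Real.pi / 2 * u) • p.1 + Real.sin (Real.pi / 2 * u) • p.2)
        (-Real.sin (Real.pi / 2 * u) • p.1 + Real.cos (Real.pi / 2 * u) • p.2)))
        ∂((stdGaussian E).prod (stdGaussian E)) :=
        lintegral_lintegral_swap hcont.measurable.ennreal_ofReal.aemeasurable
    _ ≤ ∫⁻ _ in Set.Ioc (0 : ℝ) 1,
          ENNReal.ofReal (Real.exp (Real.pi ^ 2 * L ^ 2 / 4 * t ^ 2 / 2)) := by
        refine lintegral_mono fun u => (lintegral_exp_fderiv_le hF hL _ _).trans_eq ?_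
        ring_nf
    _ = _ := by simp

lemma integrable_exp_of_bound (hF : ContDiff ℝ 1 F) (hB : ∀ x, |F x| ≤ B) (t : ℝ) :
    Integrable (fun x => Real.exp (t * F x)) (stdGaussian E) := by
  have hFc := hF.continuous
  refine integrable_of_bound (by fun_prop) (b := Real.exp (|t| * B)) fun p => ?_
  rw [Real.norm_of_nonneg (Real.exp_pos _).le, Real.exp_le_exp]
  refine (le_abs_self _).trans ?_
  rw [abs_mul]
  exact mul_le_mul_of_nonneg_left (hB _) (abs_nonneg t)

/-- Gaussian concentration for bounded smooth Lipschitz functions, with the Maurey–Pisier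
constant. -/
lemma hasSubgaussianMGF_sub_integral (hF : ContDiff ℝ 1 F) (hB : ∀ x, |F x| ≤ B)
    (hL : ∀ x, ‖fderiv ℝ F x‖ ≤ L) :
    HasSubgaussianMGF (fun x => F x - ∫ y, F y ∂(stdGaussian E))
      (Real.toNNReal (Real.pi ^ 2 * L ^ 2 / 4)) (stdGaussian E) := by
  have hFc := hF.continuous
  have hFi : Integrable F (stdGaussian E) := integrable_of_bound hFc hB
  set m := ∫ y, F y ∂(stdGaussian E) with hm
  refine ⟨fun t => ?_, fun t => ?_⟩
  · have := (integrable_exp_of_bound hF hB t).mul_const (Real.exp (-(t * m)))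
    refine this.congr (ae_of_all _ fun x => ?_)
    simp only [← Real.exp_add]
    ring_nf
  · rw [Real.coe_toNNReal _ (by positivity)]
    refine le_trans ?_ (integral_exp_sub_le hF hB hL t)
    have e1 : mgf (fun x => F x - m) (stdGaussian E) t =
        Real.exp (-(t * m)) * ∫ x, Real.exp (t * F x) ∂(stdGaussian E) := by
      rw [mgf, ← integral_const_mul]
      refine integral_congr_ae (ae_of_all _ fun x => ?_)
      simp only [← Real.exp_add]
      ring_nf
    have e2 : ∫ p : E × E, Real.exp (t * (F p.2 - F p.1)) ∂((stdGaussian E).prod (stdGaussian E)) =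
        (∫ x, Real.exp (-t * F x) ∂(stdGaussian E)) * ∫ x, Real.exp (t * F x) ∂(stdGaussian E) := by
      rw [← integral_prod_mul]
      refine integral_congr_ae (ae_of_all _ fun x => ?_)
      simp only [← Real.exp_add]
      ring_nf
    rw [e1, e2]
    refine mul_le_mul_of_nonneg_right ?_ (integral_nonneg fun _ => (Real.exp_pos _).le)
    -- Jensen for the independent copy: exp(-tm) is at most the mean of exp(-tF), so the symmetrized
    -- bound dominates the centred one.
    have := convexOn_exp.map_integral_le (μ := stdGaussian E) (f := fun x => -t * F x)
      Real.continuous_exp.continuousOn isClosed_univ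
      (ae_of_all _ fun _ => Set.mem_univ _) (hFi.const_mul _) (integrable_exp_of_bound hF hB _)
    rwa [integral_const_mul, ← hm, neg_mul] at this

/-- From cosh x = 1 + 2 sinh²(x/2) and |y| ≤ |sinh y|. -/
lemma two_add_sq_le_exp_add_exp_neg (x : ℝ) : 2 + x ^ 2 ≤ Real.exp x + Real.exp (-x) := by
  have h1 : |x / 2| ≤ |Real.sinh (x / 2)| := by
    rw [Real.abs_sinh]
    exact Real.self_le_sinh_iff.2 (abs_nonneg _)
  have h2 := sq_le_sq.2 h1
  have h3 := Real.cosh_sq (x / 2)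
  have h4 := Real.cosh_two_mul (x / 2)
  rw [mul_div_cancel₀ _ (two_ne_zero' ℝ), Real.cosh_eq] at h4
  nlinarith

/-- The variance bound with the Maurey–Pisier constant. -/
lemma variance_le_of_norm_fderiv_le (hF : ContDiff ℝ 1 F) (hB : ∀ x, |F x| ≤ B)
    (hL : ∀ x, ‖fderiv ℝ F x‖ ≤ L) :
    ∫ x, (F x - ∫ y, F y ∂(stdGaussian E)) ^ 2 ∂(stdGaussian E) ≤ Real.pi ^ 2 * L ^ 2 / 8 := by
  have hFc := hF.continuous
  have hFi : Integrable F (stdGaussian E) := integrable_of_bound hFc hB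
  have hF2 : Integrable (fun x => F x ^ 2) (stdGaussian E) :=
    integrable_of_bound (by fun_prop) (b := B ^ 2) fun x => by
      rw [norm_pow]; exact pow_le_pow_left₀ (norm_nonneg _) (hB x) 2
  set m := ∫ y, F y ∂(stdGaussian E) with hm
  set V := ∫ x, (F x - m) ^ 2 ∂(stdGaussian E) with hV
  set c := Real.pi ^ 2 * L ^ 2 / 4 with hc
  have hc0 : 0 ≤ c := by positivity
  have hV1 : V = ∫ x, F x ^ 2 ∂(stdGaussian E) - m ^ 2 := by
    have : ∀ x, (F x - m) ^ 2 = F x ^ 2 - 2 * m * F x + m ^ 2 := fun x => by ring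
    simp_rw [hV, this]
    have i1 : Integrable (fun x => F x ^ 2 - 2 * m * F x) (stdGaussian E) :=
      hF2.sub (hFi.const_mul _)
    rw [integral_add i1 (integrable_const _), integral_sub hF2 (hFi.const_mul _),
      integral_const_mul, ← hm]
    simp
    ring
  have hZ2 : ∫ p : E × E, (F p.2 - F p.1) ^ 2 ∂((stdGaussian E).prod (stdGaussian E)) = 2 * V := by
    have : ∀ p : E × E, (F p.2 - F p.1) ^ 2 =
        1 * F p.2 ^ 2 - 2 * (F p.1 * F p.2) + F p.1 ^ 2 * 1 := fun p => by ring
    simp_rw [this]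
    have i1 : Integrable (fun p : E × E => 1 * F p.2 ^ 2)
        ((stdGaussian E).prod (stdGaussian E)) := (integrable_const (1 : ℝ)).mul_prod hF2
    have i2 : Integrable (fun p : E × E => 2 * (F p.1 * F p.2))
        ((stdGaussian E).prod (stdGaussian E)) := (hFi.mul_prod hFi).const_mul 2
    have i3 : Integrable (fun p : E × E => F p.1 ^ 2 * 1)
        ((stdGaussian E).prod (stdGaussian E)) := hF2.mul_prod (integrable_const (1 : ℝ))
    have i12 : Integrable (fun p : E × E => 1 * F p.2 ^ 2 - 2 * (F p.1 * F p.2))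
        ((stdGaussian E).prod (stdGaussian E)) := i1.sub i2
    rw [integral_add i12 i3, integral_sub i1 i2,
      integral_prod_mul (fun _ => (1 : ℝ)) (fun x => F x ^ 2),
      integral_prod_mul (fun x => F x ^ 2) (fun _ => (1 : ℝ)), integral_const_mul,
      integral_prod_mul, ← hm, hV1]
    simp
    ring
  have hbd : ∀ p : E × E, |F p.2 - F p.1| ≤ B + B := fun p =>
    (abs_sub _ _).trans (add_le_add (hB _) (hB _))
  have hexp : ∀ t : ℝ, Integrable (fun p : E × E => Real.exp (t * (F p.2 - F p.1)))
      ((stdGaussian E).prod (stdGaussian E)) := by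
    intro t
    refine integrable_of_bound (by fun_prop) (b := Real.exp (|t| * (B + B))) fun p => ?_
    rw [Real.norm_of_nonneg (Real.exp_pos _).le, Real.exp_le_exp]
    refine (le_abs_self _).trans ?_
    rw [abs_mul]
    exact mul_le_mul_of_nonneg_left (hbd p) (abs_nonneg t)
  -- Adding the exponential bounds at t and -t isolates the second moment of F(Y) - F(X), which is
  -- 2V for an independent pair.
  have key : ∀ t : ℝ, 2 + t ^ 2 * (2 * V) ≤ 2 * Real.exp (c * t ^ 2 / 2) := by
    intro t
    have h1 := integral_exp_sub_le hF hB hL t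
    have h2 := integral_exp_sub_le hF hB hL (-t)
    rw [neg_sq] at h2
    rw [← hZ2, ← integral_const_mul]
    have i1 : Integrable (fun p : E × E => t ^ 2 * (F p.2 - F p.1) ^ 2)
        ((stdGaussian E).prod (stdGaussian E)) := by
      refine integrable_of_bound (by fun_prop) (b := t ^ 2 * (B + B) ^ 2) fun p => ?_
      rw [norm_mul, norm_pow, norm_pow, Real.norm_eq_abs, sq_abs]
      exact mul_le_mul_of_nonneg_left (pow_le_pow_left₀ (abs_nonneg _) (hbd p) 2) (sq_nonneg t)
    have h3 : ∫ p : E × E, (2 + t ^ 2 * (F p.2 - F p.1) ^ 2)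
          ∂((stdGaussian E).prod (stdGaussian E)) ≤
        ∫ p : E × E, (Real.exp (t * (F p.2 - F p.1)) + Real.exp (-t * (F p.2 - F p.1)))
          ∂((stdGaussian E).prod (stdGaussian E)) := by
      refine integral_mono ((integrable_const _).add i1) ((hexp t).add (hexp (-t))) fun p => ?_
      have := two_add_sq_le_exp_add_exp_neg (t * (F p.2 - F p.1))
      rw [mul_pow] at this
      simpa only [neg_mul] using this
    rw [integral_add (integrable_const _) i1, integral_add (hexp t) (hexp (-t))] at h3
    simp only [integral_const, probReal_univ, one_smul] at h3
    linarith
  -- Expand the exponential to first order and divide by t²; letting t → 0 gives 2V ≤ c.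
  have hlim : ∀ᶠ t : ℝ in 𝓝[>] 0, 2 * V ≤ c + c ^ 2 * t ^ 2 / 2 := by
    have hsmall : ∀ᶠ t : ℝ in 𝓝[>] 0, c * t ^ 2 / 2 < 1 := by
      have h0 : Continuous fun t : ℝ => c * t ^ 2 / 2 := by fun_prop
      refine ((h0.tendsto 0).mono_left nhdsWithin_le_nhds).eventually_lt_const ?_
      simp
    filter_upwards [hsmall, self_mem_nhdsWithin] with t ht ht0
    have ht0' : (0 : ℝ) < t := ht0
    have hx0 : 0 ≤ c * t ^ 2 / 2 := by positivity
    have h1 := (le_abs_self _).trans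
      (Real.abs_exp_sub_one_sub_id_le (x := c * t ^ 2 / 2) (by rw [abs_of_nonneg hx0]; exact ht.le))
    have h2 := key t
    have h3 : t ^ 2 * (2 * V) ≤ t ^ 2 * (c + c ^ 2 * t ^ 2 / 2) := by nlinarith
    exact le_of_mul_le_mul_left h3 (by positivity)
  have hcont : Continuous fun t : ℝ => c + c ^ 2 * t ^ 2 / 2 := by fun_prop
  have hge := ge_of_tendsto ((hcont.tendsto 0).mono_left nhdsWithin_le_nhds) hlim
  rw [hc] at hge
  simp at hge
  linarith

/-- Identity covariance; this is integration by parts for a linear function. -/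
lemma integral_inner_mul_dual_stdGaussian (e : E) (ℓ : StrongDual ℝ E) :
    ∫ y, inner ℝ e y * ℓ y ∂(stdGaussian E) = ℓ e := by
  have h := covarianceBilin_apply (IsGaussian.memLp_id (stdGaussian E) 2 (by simp)) e
    ((InnerProductSpace.toDual ℝ E).symm ℓ)
  rw [covarianceBilin_stdGaussian] at h
  simp only [id_eq, integral_id_stdGaussian, sub_zero,
    InnerProductSpace.toDual_symm_apply] at h
  rw [← h, innerSL_apply_apply, real_inner_comm, InnerProductSpace.toDual_symm_apply]

/-- Gaussian integration by parts. -/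
lemma integral_inner_mul_stdGaussian (hF : ContDiff ℝ 1 F) (hB : ∀ x, |F x| ≤ B)
    (hL : ∀ x, ‖fderiv ℝ F x‖ ≤ L) (e : E) :
    ∫ x, inner ℝ e x * F x ∂(stdGaussian E) = ∫ x, fderiv ℝ F x e ∂(stdGaussian E) := by
  have hFc := hF.continuous
  have hF' : Continuous (fderiv ℝ F) := hF.continuous_fderiv one_ne_zero
  have hL0 : 0 ≤ L := (norm_nonneg _).trans (hL 0)
  have hB0 : 0 ≤ B := (abs_nonneg _).trans (hB 0)
  set ν := stdGaussian E
  have hid : Integrable (fun x : E => x) ν :=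
    memLp_one_iff_integrable.1 (IsGaussian.memLp_id ν 1 (by simp))
  have hid2 : Integrable (fun x : E => ‖x‖ ^ 2) ν := by
    have := (IsGaussian.memLp_id ν 2 (by simp)).integrable_norm_pow (by simp)
    simpa using this
  have hFi : Integrable F ν := integrable_of_bound hFc hB
  have hinn : Integrable (fun x : E => inner ℝ e x) ν := hid.const_inner e
  have hinnF : Integrable (fun x : E => inner ℝ e x * F x) ν := by
    refine (hinn.norm.mul_const B).mono' (by fun_prop) (ae_of_all _ fun x => ?_)
    rw [norm_mul]
    exact mul_le_mul_of_nonneg_left (hB x) (norm_nonneg _)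
  -- Undo the rotation: ⟨e, Y⟩ becomes ⟨e, sin θ X + cos θ Y⟩ against F(X), and the Y part vanishes
  -- by independence and zero mean.
  have hrot : ∀ θ : ℝ, ∫ p : E × E, inner ℝ e p.2 * F (Real.cos θ • p.1 + Real.sin θ • p.2)
      ∂(ν.prod ν) = Real.sin θ * ∫ x, inner ℝ e x * F x ∂ν := by
    intro θ
    have hG : Continuous fun p : E × E =>
      inner ℝ e (Real.sin θ • p.1 + Real.cos θ • p.2) * F p.1 := by fun_prop
    have h1 := integral_map (μ := ν.prod ν)
      (ContinuousLinearMap.rotation (E := E) θ).continuous.measurable.aemeasurable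
      hG.aestronglyMeasurable
    rw [map_rotation_stdGaussian] at h1
    simp only [ContinuousLinearMap.rotation_apply] at h1
    have e1 : ∀ p : E × E, Real.sin θ • (Real.cos θ • p.1 + Real.sin θ • p.2) +
        Real.cos θ • (-Real.sin θ • p.1 + Real.cos θ • p.2) = p.2 := by
      intro p
      have : Real.sin θ • (Real.cos θ • p.1 + Real.sin θ • p.2) +
        Real.cos θ • (-Real.sin θ • p.1 + Real.cos θ • p.2) =
          (Real.sin θ ^ 2 + Real.cos θ ^ 2) • p.2 := by module
      rw [this, Real.sin_sq_add_cos_sq, one_smul]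
    simp only [e1] at h1
    rw [← h1]
    have e2 : ∀ p : E × E, inner ℝ e (Real.sin θ • p.1 + Real.cos θ • p.2) * F p.1 =
        Real.sin θ * ((inner ℝ e p.1 * F p.1) * 1) + Real.cos θ * (F p.1 * inner ℝ e p.2) := by
      intro p
      rw [inner_add_right, inner_smul_right, inner_smul_right]
      ring
    simp_rw [e2]
    rw [integral_add ((hinnF.mul_prod (integrable_const (1 : ℝ))).const_mul _)
      ((hFi.mul_prod hinn).const_mul _), integral_const_mul, integral_const_mul,
      integral_prod_mul (fun x => inner ℝ e x * F x) (fun _ => (1 : ℝ)), integral_prod_mul]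
    have h0 : ∫ x, inner ℝ e x ∂ν = 0 := integral_strongDual_stdGaussian (innerSL ℝ e)
    simp [h0]
  -- Differentiate the rotated identity at θ = 0. One side gives the mean of ⟨e, Y⟩ F'(X)(Y), which
  -- is that of F'(X)(e) by the linear case; the other gives the mean of ⟨e, X⟩ F(X).
  have hder := hasDerivAt_integral_of_dominated_loc_of_deriv_le (μ := ν.prod ν)
    (F := fun (θ : ℝ) (p : E × E) => inner ℝ e p.2 * F (Real.cos θ • p.1 + Real.sin θ • p.2))
    (F' := fun (θ : ℝ) (p : E × E) => inner ℝ e p.2 *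
      fderiv ℝ F (Real.cos θ • p.1 + Real.sin θ • p.2) (-Real.sin θ • p.1 + Real.cos θ • p.2))
    (x₀ := 0) (s := Set.univ) (bound := fun p : E × E =>
      ‖e‖ * L * (‖p.1‖ * ‖p.2‖) + ‖e‖ * L * (1 * ‖p.2‖ ^ 2)) Filter.univ_mem
    (Eventually.of_forall fun θ => by
      have : Continuous fun p : E × E =>
        inner ℝ e p.2 * F (Real.cos θ • p.1 + Real.sin θ • p.2) := by fun_prop
      exact this.aestronglyMeasurable)
    ?_ ?_ ?_ ?_ ?_
  · have h1 := hder.2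
    simp only [hrot] at h1
    have h2 := ((Real.hasDerivAt_sin 0).mul_const (∫ x, inner ℝ e x * F x ∂ν))
    have h3 := h1.unique h2
    simp only [Real.cos_zero, one_mul, Real.sin_zero, one_smul, zero_smul, add_zero, neg_zero,
      zero_add] at h3
    rw [← h3]
    have h4 := hder.1
    simp only [Real.cos_zero, Real.sin_zero, one_smul, zero_smul, add_zero, neg_zero,
      zero_add] at h4
    rw [integral_prod _ h4]
    refine integral_congr_ae (ae_of_all _ fun x => ?_)
    exact integral_inner_mul_dual_stdGaussian e (fderiv ℝ F x)
  · have : Integrable (fun p : E × E => F p.1 * inner ℝ e p.2) (ν.prod ν) := hFi.mul_prod hinn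
    simpa [mul_comm] using this
  · refine Continuous.aestronglyMeasurable ?_
    exact (by fun_prop : Continuous fun p : E × E => inner ℝ e p.2).mul
      ((hF'.comp (by fun_prop)).clm_apply (by fun_prop))
  · refine ae_of_all _ fun p θ _ => ?_
    rw [norm_mul]
    have h1 : ‖inner ℝ e p.2‖ ≤ ‖e‖ * ‖p.2‖ := norm_inner_le_norm e p.2
    have h2 : ‖-Real.sin θ • p.1 + Real.cos θ • p.2‖ ≤ ‖p.1‖ + ‖p.2‖ := by
      refine (norm_add_le _ _).trans ?_
      rw [norm_smul, norm_smul, norm_neg]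
      exact add_le_add (mul_le_of_le_one_left (norm_nonneg _) (Real.abs_sin_le_one θ))
        (mul_le_of_le_one_left (norm_nonneg _) (Real.abs_cos_le_one θ))
    have h3 := ((fderiv ℝ F (Real.cos θ • p.1 + Real.sin θ • p.2)).le_opNorm
      (-Real.sin θ • p.1 + Real.cos θ • p.2)).trans
      (mul_le_mul (hL _) h2 (norm_nonneg _) hL0)
    calc _ ≤ (‖e‖ * ‖p.2‖) * (L * (‖p.1‖ + ‖p.2‖)) :=
          mul_le_mul h1 h3 (norm_nonneg _) (by positivity)
      _ = _ := by ring
  · exact ((hid.norm.mul_prod hid.norm).const_mul _).add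
      (((integrable_const (1 : ℝ)).mul_prod hid2).const_mul _)
  · refine ae_of_all _ fun p θ _ => ?_
    exact ((hF.differentiable one_ne_zero _).hasFDerivAt.comp_hasDerivAt θ
      (hasDerivAt_rotation_fst p.1 p.2 θ)).const_mul _

end Gaussian

/-! ### Frobenius norm bounds. -/

section Frobenius

variable {ι : Type*} [Fintype ι]

/-- The squared Frobenius norm. -/
noncomputable def froSq (A : Matrix ι ι ℂ) : ℝ := ∑ i, ∑ j, ‖A i j‖ ^ 2

lemma froSq_nonneg (A : Matrix ι ι ℂ) : 0 ≤ froSq A :=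
  Finset.sum_nonneg fun _ _ => Finset.sum_nonneg fun _ _ => by positivity

lemma froSq_conjTranspose (A : Matrix ι ι ℂ) : froSq Aᴴ = froSq A := by
  rw [froSq, Finset.sum_comm]
  simp [froSq]

lemma norm_entry_sq_le_froSq (A : Matrix ι ι ℂ) (i j : ι) : ‖A i j‖ ^ 2 ≤ froSq A :=
  (Finset.single_le_sum (f := fun j => ‖A i j‖ ^ 2) (fun _ _ => by positivity)
    (Finset.mem_univ j)).trans
    (Finset.single_le_sum (f := fun i => ∑ j, ‖A i j‖ ^ 2)
      (fun _ _ => Finset.sum_nonneg fun _ _ => by positivity) (Finset.mem_univ i))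

lemma sum_norm_diag_sq_le_froSq (A : Matrix ι ι ℂ) : ∑ i, ‖A i i‖ ^ 2 ≤ froSq A :=
  Finset.sum_le_sum fun i _ => Finset.single_le_sum (f := fun j => ‖A i j‖ ^ 2)
    (fun _ _ => by positivity) (Finset.mem_univ i)

variable [DecidableEq ι]

lemma froSq_mul_le (A B : Matrix ι ι ℂ) : froSq (A * B) ≤ ‖A‖ ^ 2 * froSq B := by
  rw [froSq, Finset.sum_comm, froSq, Finset.sum_comm (f := fun i j => ‖B i j‖ ^ 2),
    Finset.mul_sum]
  exact Finset.sum_le_sum fun j _ => normSq_mulVec_le A fun i => B i j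

lemma froSq_mul_le' (A B : Matrix ι ι ℂ) : froSq (A * B) ≤ froSq A * ‖B‖ ^ 2 := by
  rw [← froSq_conjTranspose, conjTranspose_mul, mul_comm, ← l2_opNorm_conjTranspose B,
    ← froSq_conjTranspose A]
  exact froSq_mul_le _ _

lemma froSq_mul_mul_le {A : Matrix ι ι ℂ} {S : ℝ} (hA : ‖A‖ ≤ S) (B : Matrix ι ι ℂ) :
    froSq (A * B * A) ≤ S ^ 4 * froSq B := by
  have h2 : ‖A‖ ^ 2 ≤ S ^ 2 := pow_le_pow_left₀ (norm_nonneg _) hA 2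
  calc froSq (A * B * A) ≤ ‖A‖ ^ 2 * froSq B * ‖A‖ ^ 2 :=
        (froSq_mul_le' _ _).trans
          (mul_le_mul_of_nonneg_right (froSq_mul_le _ _) (by positivity))
    _ = ‖A‖ ^ 2 * ‖A‖ ^ 2 * froSq B := by ring
    _ ≤ S ^ 2 * S ^ 2 * froSq B :=
        mul_le_mul_of_nonneg_right (mul_le_mul h2 h2 (by positivity) (by positivity))
          (froSq_nonneg B)
    _ = _ := by ring

end Frobenius

/-! ### The resolvent as a smooth function of the Gaussian variables. -/

section Model

variable {ι : Type*} [Fintype ι]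

/-- The random matrix `Υ ∘ A_N` as a linear function of the Gaussian variables. -/
noncomputable def profileMap (Υ : Matrix ι ι ℝ) (N : ℝ) :
    EuclideanSpace ℝ (Sym2 ι) →L[ℝ] Matrix ι ι ℂ :=
  LinearMap.toContinuousLinearMap
    { toFun := fun b => Matrix.of fun i j => ((Υ i j * (b s(i, j) / √N) : ℝ) : ℂ)
      map_add' := fun b c => by ext i j; simp; ring
      map_smul' := fun r b => by ext i j; simp; ring }

lemma profileMap_apply (Υ : Matrix ι ι ℝ) (N : ℝ) (b : EuclideanSpace ℝ (Sym2 ι)) (i j : ι) :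
    profileMap Υ N b i j = ((Υ i j * (b s(i, j) / √N) : ℝ) : ℂ) := rfl

/-- The real part of an entry, as a real functional. -/
noncomputable def entryRe (i j : ι) : Matrix ι ι ℂ →L[ℝ] ℝ :=
  Complex.reCLM ∘L (LinearMap.toContinuousLinearMap
    (Matrix.entryLinearMap ℂ ℂ i j)).restrictScalars ℝ

/-- The imaginary part of an entry, as a real functional. -/
noncomputable def entryIm (i j : ι) : Matrix ι ι ℂ →L[ℝ] ℝ :=
  Complex.imCLM ∘L (LinearMap.toContinuousLinearMap
    (Matrix.entryLinearMap ℂ ℂ i j)).restrictScalars ℝ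

@[simp] lemma entryIm_apply (i j : ι) (M : Matrix ι ι ℂ) : entryIm i j M = (M i j).im := rfl

/-- Reduces identities between matrix-valued Gaussian integrals to real-valued functions. -/
lemma matrix_ext_of_functional {A B : Matrix ι ι ℂ}
    (h : ∀ φ : Matrix ι ι ℂ →L[ℝ] ℝ, φ A = φ B) : A = B := by
  ext i j
  exact Complex.ext (h (entryRe i j)) (h (entryIm i j))

lemma profileMap_isHermitian {Υ : Matrix ι ι ℝ} (hΥ : ∀ i j, Υ i j = Υ j i) (N : ℝ)
    (b : EuclideanSpace ℝ (Sym2 ι)) : (profileMap Υ N b).IsHermitian := by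
  ext i j
  rw [conjTranspose_apply, profileMap_apply, profileMap_apply, hΥ j i, Sym2.eq_swap]
  simp

lemma profileMap_transpose {Υ : Matrix ι ι ℝ} (hΥ : ∀ i j, Υ i j = Υ j i) (N : ℝ)
    (b : EuclideanSpace ℝ (Sym2 ι)) : (profileMap Υ N b)ᵀ = profileMap Υ N b := by
  ext i j
  rw [transpose_apply, profileMap_apply, profileMap_apply, hΥ j i, Sym2.eq_swap]

variable [DecidableEq ι]

/-- An unordered pair has at most two orderings. This is the source of the factor 2 in the Lipschitz
constant. -/
lemma sum_mk_le (f : Sym2 ι → ℝ) (hf : ∀ e, 0 ≤ f e) :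
    ∑ i, ∑ j, f s(i, j) ≤ 2 * ∑ e, f e := by
  rw [← Finset.sum_product', Finset.univ_product_univ,
    ← Finset.sum_fiberwise Finset.univ (fun p : ι × ι => s(p.1, p.2)), Finset.mul_sum]
  refine Finset.sum_le_sum fun e _ => ?_
  have h1 : ∀ p ∈ Finset.univ.filter (fun p : ι × ι => s(p.1, p.2) = e),
      f s(p.1, p.2) = f e := fun p hp => by rw [(Finset.mem_filter.1 hp).2]
  rw [Finset.sum_congr rfl h1, Finset.sum_const, nsmul_eq_mul]
  refine mul_le_mul_of_nonneg_right ?_ (hf e)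
  induction e with
  | _ a b =>
    have : Finset.univ.filter (fun p : ι × ι => s(p.1, p.2) = s(a, b)) ⊆ {(a, b), (b, a)} := by
      intro p hp
      have := (Finset.mem_filter.1 hp).2
      rw [Sym2.eq_iff] at this
      rcases this with ⟨h1, h2⟩ | ⟨h1, h2⟩ <;> simp [Prod.ext_iff, h1, h2]
    exact_mod_cast (Finset.card_le_card this).trans Finset.card_le_two

lemma froSq_profileMap_le {Υ : Matrix ι ι ℝ} {N γ : ℝ} (hN : 0 < N) (hγ : ∀ i j, |Υ i j| ≤ γ)
    (b : EuclideanSpace ℝ (Sym2 ι)) :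
    froSq (profileMap Υ N b) ≤ 2 * γ ^ 2 / N * ‖b‖ ^ 2 := by
  have h1 : ∀ i j, ‖profileMap Υ N b i j‖ ^ 2 ≤ γ ^ 2 / N * b s(i, j) ^ 2 := by
    intro i j
    rw [profileMap_apply, Complex.norm_real, Real.norm_eq_abs, sq_abs, mul_pow, div_pow,
      Real.sq_sqrt hN.le]
    have : Υ i j ^ 2 ≤ γ ^ 2 := sq_le_sq' (abs_le.1 (hγ i j)).1 (abs_le.1 (hγ i j)).2
    calc Υ i j ^ 2 * (b s(i, j) ^ 2 / N) ≤ γ ^ 2 * (b s(i, j) ^ 2 / N) :=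
          mul_le_mul_of_nonneg_right this (by positivity)
      _ = _ := by ring
  calc froSq (profileMap Υ N b) ≤ ∑ i, ∑ j, γ ^ 2 / N * b s(i, j) ^ 2 :=
        Finset.sum_le_sum fun i _ => Finset.sum_le_sum fun j _ => h1 i j
    _ = γ ^ 2 / N * ∑ i, ∑ j, b s(i, j) ^ 2 := by simp_rw [Finset.mul_sum]
    _ ≤ γ ^ 2 / N * (2 * ∑ e, b e ^ 2) :=
        mul_le_mul_of_nonneg_left (sum_mk_le (fun e => b e ^ 2) fun e => sq_nonneg _)
          (by positivity)
    _ = _ := by rw [EuclideanSpace.real_norm_sq_eq]; ring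

/-- The resolvent of the random matrix `Υ ∘ A_N + C`. -/
noncomputable def modelRes (Υ : Matrix ι ι ℝ) (N : ℝ) (C : Matrix ι ι ℂ) (lam : ι → ℂ)
    (b : EuclideanSpace ℝ (Sym2 ι)) : Matrix ι ι ℂ :=
  res (profileMap Υ N b + C) lam

variable {Υ : Matrix ι ι ℝ} {N : ℝ} {C : Matrix ι ι ℂ} {lam : ι → ℂ}

lemma modelRes_transpose (hΥ : ∀ i j, Υ i j = Υ j i) (hCt : Cᵀ = C)
    (b : EuclideanSpace ℝ (Sym2 ι)) : (modelRes Υ N C lam b)ᵀ = modelRes Υ N C lam b := by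
  rw [modelRes, res, transpose_nonsing_inv, transpose_sub, transpose_add, hCt,
    profileMap_transpose hΥ, diagonal_transpose]

lemma norm_modelRes_le (hΥ : ∀ i j, Υ i j = Υ j i) (hC : C.IsHermitian) {η : ℝ} (hη : 0 < η)
    (hlam : ∀ i, η ≤ (lam i).im) (b : EuclideanSpace ℝ (Sym2 ι)) :
    ‖modelRes Υ N C lam b‖ ≤ η⁻¹ :=
  norm_res_le ((profileMap_isHermitian hΥ N b).add hC) hη hlam

lemma modelRes_eq_inverse : modelRes Υ N C lam =
    Ring.inverse ∘ fun b => profileMap Υ N b + (C - diagonal lam) := by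
  ext1 b
  rw [modelRes, res, nonsing_inv_eq_ringInverse, Function.comp_apply, add_sub_assoc]

lemma isUnit_model (hΥ : ∀ i j, Υ i j = Υ j i) (hC : C.IsHermitian) (hlam : ∀ i, 0 < (lam i).im)
    (b : EuclideanSpace ℝ (Sym2 ι)) : IsUnit (profileMap Υ N b + (C - diagonal lam)) := by
  rw [← add_sub_assoc]
  exact isUnit_sub_diagonal ((profileMap_isHermitian hΥ N b).add hC) hlam

lemma contDiff_modelRes (hΥ : ∀ i j, Υ i j = Υ j i) (hC : C.IsHermitian)
    (hlam : ∀ i, 0 < (lam i).im) : ContDiff ℝ 1 (modelRes Υ N C lam) := by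
  rw [contDiff_iff_contDiffAt]
  intro b
  obtain ⟨u, hu⟩ := isUnit_model (N := N) hΥ hC hlam b
  rw [modelRes_eq_inverse]
  refine ContDiffAt.comp b ?_ ((profileMap Υ N).contDiff.contDiffAt.add contDiffAt_const)
  rw [← hu]
  exact contDiffAt_ringInverse ℝ u

lemma fderiv_modelRes (hΥ : ∀ i j, Υ i j = Υ j i) (hC : C.IsHermitian)
    (hlam : ∀ i, 0 < (lam i).im) (b v : EuclideanSpace ℝ (Sym2 ι)) :
    fderiv ℝ (modelRes Υ N C lam) b v =
      -(modelRes Υ N C lam b * profileMap Υ N v * modelRes Υ N C lam b) := by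
  obtain ⟨u, hu⟩ := isUnit_model (N := N) hΥ hC hlam b
  have h1 := hasFDerivAt_ringInverse (𝕜 := ℝ) u
  rw [hu] at h1
  have h2 : HasFDerivAt (fun b => profileMap Υ N b + (C - diagonal lam)) (profileMap Υ N) b :=
    (profileMap Υ N).hasFDerivAt.add_const _
  have h3 := h1.comp b h2
  rw [← modelRes_eq_inverse] at h3
  have h4 : modelRes Υ N C lam b = ((u⁻¹ : (Matrix ι ι ℂ)ˣ) : Matrix ι ι ℂ) := by
    rw [modelRes_eq_inverse, Function.comp_apply, ← hu, Ring.inverse_unit]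
  rw [h3.fderiv, h4]
  simp

variable {γ S : ℝ}

lemma fderiv_comp_modelRes (hΥ : ∀ i j, Υ i j = Υ j i) (hC : C.IsHermitian)
    (hlam : ∀ i, 0 < (lam i).im) (φ : Matrix ι ι ℂ →L[ℝ] ℝ) (b v : EuclideanSpace ℝ (Sym2 ι)) :
    fderiv ℝ (fun b => φ (modelRes Υ N C lam b)) b v =
      -φ (modelRes Υ N C lam b * profileMap Υ N v * modelRes Υ N C lam b) := by
  have h1 := φ.hasFDerivAt.comp b
    (((contDiff_modelRes (N := N) hΥ hC hlam).differentiable one_ne_zero) b).hasFDerivAt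
  have h2 : fderiv ℝ (fun b => φ (modelRes Υ N C lam b)) b =
      φ.comp (fderiv ℝ (modelRes Υ N C lam) b) := h1.fderiv
  rw [h2, ContinuousLinearMap.comp_apply, fderiv_modelRes hΥ hC hlam, map_neg]

/-- The derivative of the resolvent Q in direction v is -Q X(v) Q, with Frobenius norm at most η⁻²
√(2γ²/N) ‖v‖. Measuring the functional in Frobenius norm retains the factor N^(-1/2). -/
lemma norm_fderiv_comp_modelRes_le (hΥ : ∀ i j, Υ i j = Υ j i) (hC : C.IsHermitian) {η : ℝ}
    (hη : 0 < η) (hlam : ∀ i, η ≤ (lam i).im) (hN : 0 < N) (hγ : ∀ i j, |Υ i j| ≤ γ)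
    (φ : Matrix ι ι ℂ →L[ℝ] ℝ) {K : ℝ} (hK : 0 ≤ K) (hφ : ∀ M, |φ M| ≤ K * √(froSq M))
    (b : EuclideanSpace ℝ (Sym2 ι)) :
    ‖fderiv ℝ (fun b => φ (modelRes Υ N C lam b)) b‖ ≤ K * (η⁻¹ ^ 2 * √(2 * γ ^ 2 / N)) := by
  have hlam0 := fun i => hη.trans_le (hlam i)
  refine ContinuousLinearMap.opNorm_le_bound _ (by positivity) fun v => ?_
  rw [fderiv_comp_modelRes hΥ hC hlam0, norm_neg, Real.norm_eq_abs]
  refine (hφ _).trans ?_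
  rw [mul_assoc K]
  refine mul_le_mul_of_nonneg_left ?_ hK
  have h3 := (froSq_mul_mul_le (norm_modelRes_le (N := N) hΥ hC hη hlam b)
    (profileMap Υ N v)).trans (mul_le_mul_of_nonneg_left (froSq_profileMap_le hN hγ v)
      (by positivity))
  refine (Real.sqrt_le_sqrt h3).trans_eq ?_
  rw [Real.sqrt_mul (by positivity), Real.sqrt_mul (by positivity), Real.sqrt_sq (norm_nonneg _),
    show η⁻¹ ^ 4 = (η⁻¹ ^ 2) ^ 2 by ring, Real.sqrt_sq (by positivity), mul_assoc]

lemma abs_comp_modelRes_le (hΥ : ∀ i j, Υ i j = Υ j i) (hC : C.IsHermitian) {η : ℝ}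
    (hη : 0 < η) (hlam : ∀ i, η ≤ (lam i).im) (φ : Matrix ι ι ℂ →L[ℝ] ℝ)
    (b : EuclideanSpace ℝ (Sym2 ι)) : |φ (modelRes Υ N C lam b)| ≤ ‖φ‖ * η⁻¹ :=
  (φ.le_opNorm _).trans
    (mul_le_mul_of_nonneg_left (norm_modelRes_le hΥ hC hη hlam b) (norm_nonneg φ))

lemma contDiff_comp_modelRes (hΥ : ∀ i j, Υ i j = Υ j i) (hC : C.IsHermitian)
    (hlam : ∀ i, 0 < (lam i).im) (φ : Matrix ι ι ℂ →L[ℝ] ℝ) :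
    ContDiff ℝ 1 fun b => φ (modelRes Υ N C lam b) :=
  φ.contDiff.comp (contDiff_modelRes hΥ hC hlam)

lemma continuous_modelRes (hΥ : ∀ i j, Υ i j = Υ j i) (hC : C.IsHermitian)
    (hlam : ∀ i, 0 < (lam i).im) : Continuous (modelRes Υ N C lam) :=
  (contDiff_modelRes hΥ hC hlam).continuous

/-- The standard Gaussian law of the variables `(a_e)`. -/
noncomputable abbrev gaussLaw (ι : Type*) [Fintype ι] [DecidableEq ι] :
    Measure (EuclideanSpace ℝ (Sym2 ι)) := stdGaussian (EuclideanSpace ℝ (Sym2 ι))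

lemma integrable_modelRes (hΥ : ∀ i j, Υ i j = Υ j i) (hC : C.IsHermitian) {η : ℝ}
    (hη : 0 < η) (hlam : ∀ i, η ≤ (lam i).im) :
    Integrable (modelRes Υ N C lam) (gaussLaw ι) :=
  integrable_of_bound (continuous_modelRes hΥ hC fun i => hη.trans_le (hlam i))
    (norm_modelRes_le hΥ hC hη hlam)

/-- The expected resolvent. -/
noncomputable def meanRes (Υ : Matrix ι ι ℝ) (N : ℝ) (C : Matrix ι ι ℂ) (lam : ι → ℂ) :
    Matrix ι ι ℂ := ∫ b, modelRes Υ N C lam b ∂(gaussLaw ι)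

lemma integrable_coord (e : Sym2 ι) :
    Integrable (fun b : EuclideanSpace ℝ (Sym2 ι) => b e) (gaussLaw ι) := by
  have := IsGaussian.integrable_dual (gaussLaw ι) (EuclideanSpace.proj (𝕜 := ℝ) e)
  simpa using this

lemma integrable_coord_smul_modelRes (hΥ : ∀ i j, Υ i j = Υ j i) (hC : C.IsHermitian) {η : ℝ}
    (hη : 0 < η) (hlam : ∀ i, η ≤ (lam i).im) (e : Sym2 ι) :
    Integrable (fun b => b e • modelRes Υ N C lam b) (gaussLaw ι) := by
  have hQ := continuous_modelRes (N := N) hΥ hC fun i => hη.trans_le (hlam i)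
  refine ((integrable_coord e).norm.mul_const η⁻¹).mono' ?_ (ae_of_all _ fun b => ?_)
  · exact ((EuclideanSpace.proj (𝕜 := ℝ) e).continuous.smul hQ).aestronglyMeasurable
  · rw [norm_smul]
    exact mul_le_mul_of_nonneg_left (norm_modelRes_le hΥ hC hη hlam b) (norm_nonneg _)

/-- Matrix-valued Gaussian integration by parts for the resolvent. -/
lemma integral_coord_smul_modelRes (hΥ : ∀ i j, Υ i j = Υ j i) (hC : C.IsHermitian) {η : ℝ}
    (hη : 0 < η) (hlam : ∀ i, η ≤ (lam i).im) (e : Sym2 ι) :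
    ∫ b, b e • modelRes Υ N C lam b ∂(gaussLaw ι) =
      -∫ b, modelRes Υ N C lam b * profileMap Υ N (EuclideanSpace.single e 1) *
        modelRes Υ N C lam b ∂(gaussLaw ι) := by
  have hlam0 := fun i => hη.trans_le (hlam i)
  have hQ := continuous_modelRes (N := N) hΥ hC hlam0
  have hQb := norm_modelRes_le (N := N) hΥ hC hη hlam
  have hint : Integrable (fun b => modelRes Υ N C lam b *
      profileMap Υ N (EuclideanSpace.single e 1) * modelRes Υ N C lam b) (gaussLaw ι) := by
    refine integrable_of_bound ((hQ.mul continuous_const).mul hQ)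
      (b := η⁻¹ * ‖profileMap Υ N (EuclideanSpace.single e 1)‖ * η⁻¹) fun b => ?_
    refine (norm_mul_le _ _).trans (mul_le_mul ((norm_mul_le _ _).trans ?_) (hQb b)
      (norm_nonneg _) (by positivity))
    exact mul_le_mul_of_nonneg_right (hQb b) (norm_nonneg _)
  refine matrix_ext_of_functional fun φ => ?_
  rw [← φ.integral_comp_comm (integrable_coord_smul_modelRes hΥ hC hη hlam e), map_neg,
    ← φ.integral_comp_comm hint]
  obtain ⟨K, hK⟩ : ∃ K, ∀ b, ‖fderiv ℝ (fun b => φ (modelRes Υ N C lam b)) b‖ ≤ K := by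
    refine ⟨‖φ‖ * (η⁻¹ * ‖profileMap Υ N‖ * η⁻¹), fun b => ?_⟩
    refine ContinuousLinearMap.opNorm_le_bound _ (by positivity) fun v => ?_
    rw [fderiv_comp_modelRes hΥ hC hlam0, norm_neg, mul_assoc ‖φ‖]
    refine (φ.le_opNorm _).trans (mul_le_mul_of_nonneg_left ?_ (norm_nonneg _))
    refine (norm_mul_le _ _).trans ?_
    calc ‖modelRes Υ N C lam b * profileMap Υ N v‖ * ‖modelRes Υ N C lam b‖
        ≤ (η⁻¹ * (‖profileMap Υ N‖ * ‖v‖)) * η⁻¹ := by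
          refine mul_le_mul ((norm_mul_le _ _).trans ?_) (hQb b) (norm_nonneg _) (by positivity)
          exact mul_le_mul (hQb b) ((profileMap Υ N).le_opNorm v) (norm_nonneg _) (by positivity)
      _ = _ := by ring
  have h := integral_inner_mul_stdGaussian (contDiff_comp_modelRes (N := N) hΥ hC hlam0 φ)
    (abs_comp_modelRes_le hΥ hC hη hlam φ) hK (EuclideanSpace.single e 1)
  simp only [fderiv_comp_modelRes hΥ hC hlam0] at h
  rw [integral_neg] at h
  rw [← h]
  refine integral_congr_ae (ae_of_all _ fun b => ?_)
  simp [EuclideanSpace.inner_single_left]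

end Model

/-! ### The approximate Dyson equation for the expected resolvent. -/

section Bias

variable {ι : Type*}

/-- The entrywise square of a real matrix, as a complex matrix. -/
def sqProfile (Υ : Matrix ι ι ℝ) : Matrix ι ι ℂ := Υ.map fun x => ((x ^ 2 : ℝ) : ℂ)

/-- The variance profile of `Υ ∘ A_N`. -/
noncomputable def varProfile (Υ : Matrix ι ι ℝ) (N : ℝ) (i j : ι) : ℝ := Υ i j ^ 2 / N

lemma varProfile_nonneg {Υ : Matrix ι ι ℝ} {N : ℝ} (hN : 0 < N) (i j : ι) :
    0 ≤ varProfile Υ N i j :=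
  div_nonneg (sq_nonneg _) hN.le

variable [Fintype ι]

/-- The map `M ↦ Υ^{∘2} ∘ Mᵀ`. -/
noncomputable def hadamardMap (Υ : Matrix ι ι ℝ) : Matrix ι ι ℂ →L[ℂ] Matrix ι ι ℂ :=
  LinearMap.toContinuousLinearMap
    { toFun := fun M => sqProfile Υ ⊙ Mᵀ
      map_add' := fun A B => by ext; simp [mul_add]
      map_smul' := fun r A => by ext; simp [mul_left_comm] }

lemma hadamardMap_apply (Υ : Matrix ι ι ℝ) (M : Matrix ι ι ℂ) :
    hadamardMap Υ M = sqProfile Υ ⊙ Mᵀ := rfl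

/-- Cauchy–Schwarz over N weights of size at most γ²/N gains N^(-1/2). Together with the N^(-1/2) in
the gradient of the resolvent it makes the fluctuation of order 1/N. -/
lemma norm_shift_varProfile_le {Υ : Matrix ι ι ℝ} {N γ : ℝ} (hN : (Fintype.card ι : ℝ) = N)
    (hN0 : 0 < N) (hγ : ∀ i j, |Υ i j| ≤ γ) (M : Matrix ι ι ℂ) (i : ι) :
    ‖shift (varProfile Υ N) M.diag i‖ ≤ √(γ ^ 4 / N) * √(froSq M) := by
  refine (norm_shift_le (varProfile_nonneg hN0) _ i).trans ?_
  refine (Real.sum_mul_le_sqrt_mul_sqrt _ _ _).trans ?_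
  refine mul_le_mul (Real.sqrt_le_sqrt ?_) (Real.sqrt_le_sqrt (sum_norm_diag_sq_le_froSq M))
    (Real.sqrt_nonneg _) (Real.sqrt_nonneg _)
  have h1 : ∀ j, varProfile Υ N i j ^ 2 ≤ (γ ^ 2 / N) ^ 2 := by
    intro j
    have : Υ i j ^ 2 ≤ γ ^ 2 := sq_le_sq' (abs_le.1 (hγ i j)).1 (abs_le.1 (hγ i j)).2
    exact pow_le_pow_left₀ (varProfile_nonneg hN0 i j)
      (div_le_div_of_nonneg_right this hN0.le) 2
  calc ∑ j, varProfile Υ N i j ^ 2 ≤ ∑ _j : ι, (γ ^ 2 / N) ^ 2 :=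
        Finset.sum_le_sum fun j _ => h1 j
    _ = γ ^ 4 / N := by
        rw [Finset.sum_const, Finset.card_univ, nsmul_eq_mul, hN]
        field_simp

variable [DecidableEq ι]

/-- The map `M ↦ diag (∑_j s_ij M_jj)`. -/
noncomputable def shiftMap (s : ι → ι → ℝ) : Matrix ι ι ℂ →L[ℂ] Matrix ι ι ℂ :=
  LinearMap.toContinuousLinearMap
    { toFun := fun M => diagonal (shift s M.diag)
      map_add' := fun A B => by
        rw [diagonal_add]
        congr 1
        ext i
        simp [shift, mul_add, Finset.sum_add_distrib]
      map_smul' := fun r A => by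
        rw [← diagonal_smul]
        congr 1
        ext i
        simp [shift, Finset.mul_sum, mul_left_comm] }

lemma shiftMap_apply (s : ι → ι → ℝ) (M : Matrix ι ι ℂ) :
    shiftMap s M = diagonal (shift s M.diag) := rfl

variable {Υ : Matrix ι ι ℝ} {N : ℝ} {C : Matrix ι ι ℂ} {lam : ι → ℂ}

lemma profileMap_single (e : Sym2 ι) (i j : ι) :
    profileMap Υ N (EuclideanSpace.single e 1) i j =
      if s(i, j) = e then ((Υ i j / √N : ℝ) : ℂ) else 0 := by
  rw [profileMap_apply]
  split_ifs with h <;> simp [h]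
  ring

lemma profileMap_eq_sum (b : EuclideanSpace ℝ (Sym2 ι)) :
    profileMap Υ N b = ∑ e, b e • profileMap Υ N (EuclideanSpace.single e 1) := by
  ext i j
  rw [Matrix.sum_apply, Finset.sum_eq_single s(i, j)]
  · rw [Matrix.smul_apply, profileMap_single, if_pos rfl, profileMap_apply, Complex.real_smul,
      ← Complex.ofReal_mul]
    ring_nf
  · intro e _ he
    rw [Matrix.smul_apply, profileMap_single, if_neg (Ne.symm he), smul_zero]
  · simp

/-- The coordinate matrix of an edge {i, k} is supported at (i, k) and (k, i). In a product X M X,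
going out and back along the edge yields the diagonal term; crossing it twice in the same direction
yields the transposed entries. Since the profile vanishes on the diagonal, loops are not counted
twice. -/
lemma sum_profileMap_mul_mul (hΥ : ∀ i j, Υ i j = Υ j i) (hΥ0 : ∀ i, Υ i i = 0) (hN : 0 < N)
    (M : Matrix ι ι ℂ) :
    ∑ e, profileMap Υ N (EuclideanSpace.single e 1) * M *
      profileMap Υ N (EuclideanSpace.single e 1) =
    shiftMap (varProfile Υ N) M + (N⁻¹ : ℂ) • hadamardMap Υ M := by
  set c : ι → ι → ℂ := fun i j => ((Υ i j / √N : ℝ) : ℂ) with hc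
  have hcc : ∀ i j, c i j * c i j = ((Υ i j ^ 2 / N : ℝ) : ℂ) := by
    intro i j
    rw [hc, ← Complex.ofReal_mul, div_mul_div_comm, Real.mul_self_sqrt hN.le, sq]
  have hcs : ∀ i j, c i j = c j i := fun i j => by rw [hc]; simp only [hΥ i j]
  have hc0 : ∀ i, c i i = 0 := fun i => by rw [hc]; simp [hΥ0 i]
  ext i l
  rw [Matrix.sum_apply]
  simp only [Matrix.mul_apply, profileMap_single, Finset.sum_mul]
  rw [Finset.sum_comm]
  -- Only e = {i, k} survives, and {q, l} = {i, k} leaves two matchings, one for each term on the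
  -- right.
  have h1 : ∀ q k, ∑ e : Sym2 ι, (if s(i, k) = e then ((Υ i k / √N : ℝ) : ℂ) else 0) * M k q *
      (if s(q, l) = e then ((Υ q l / √N : ℝ) : ℂ) else 0) =
      (if i = q then (if k = l then c i l * M l i * c i l else 0) else 0) +
      (if i = l then (if k = q then c i k * M k k * c k l else 0) else 0) := by
    intro q k
    rw [Finset.sum_eq_single s(i, k)]
    · rw [if_pos rfl]
      change c i k * M k q * (if s(q, l) = s(i, k) then c q l else 0) = _
      by_cases h : s(q, l) = s(i, k)
      · rw [if_pos h]
        rcases Sym2.eq_iff.1 h with ⟨rfl, rfl⟩ | ⟨rfl, rfl⟩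
        · simp only [if_true]
          by_cases hql : q = l
          · subst hql; simp [hc0]
          · simp [hql]
        · simp only [if_true]
          by_cases hql : l = q
          · subst hql; simp [hc0]
          · simp [hql]
      · rw [if_neg h, mul_zero]
        have h1 : ¬ (i = q ∧ k = l) := fun hh => h (by rw [hh.1, hh.2])
        have h2 : ¬ (i = l ∧ k = q) := fun hh => h (by rw [hh.1, hh.2, Sym2.eq_swap])
        by_cases hiq : i = q <;> by_cases hil : i = l <;> simp_all
    · intro e _ he
      rw [if_neg (Ne.symm he)]; simp
    · simp
  have h2 : ∀ q, ∑ e : Sym2 ι, ∑ k, (if s(i, k) = e then ((Υ i k / √N : ℝ) : ℂ) else 0) * M k q *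
      (if s(q, l) = e then ((Υ q l / √N : ℝ) : ℂ) else 0) =
      (if i = q then c i l * M l i * c i l else 0) +
      (if i = l then c i q * M q q * c q l else 0) := by
    intro q
    rw [Finset.sum_comm]
    simp only [h1, Finset.sum_add_distrib]
    congr 1
    · split_ifs <;> simp
    · split_ifs <;> simp
  simp only [h2, Finset.sum_add_distrib, Finset.sum_ite_eq, Finset.mem_univ, if_true]
  rw [Matrix.add_apply, Matrix.smul_apply, shiftMap_apply, hadamardMap_apply, hadamard_apply,
    transpose_apply, add_comm]
  congr 1
  · rw [diagonal_apply]
    split_ifs with h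
    · subst h
      refine Finset.sum_congr rfl fun k _ => ?_
      rw [hcs k i, varProfile, ← hcc, diag_apply]
      ring
    · simp
  · rw [show c i l * M l i * c i l = c i l * c i l * M l i by ring, hcc, sqProfile, map_apply,
      smul_eq_mul]
    push_cast
    ring

lemma integrable_map_modelRes_mul (hΥ : ∀ i j, Υ i j = Υ j i) (hC : C.IsHermitian) {η : ℝ}
    (hη : 0 < η) (hlam : ∀ i, η ≤ (lam i).im) (T : Matrix ι ι ℂ →L[ℂ] Matrix ι ι ℂ) :
    Integrable (fun b => T (modelRes Υ N C lam b) * modelRes Υ N C lam b) (gaussLaw ι) := by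
  have hQ := continuous_modelRes (N := N) hΥ hC fun i => hη.trans_le (hlam i)
  have hQb := norm_modelRes_le (N := N) hΥ hC hη hlam
  refine integrable_of_bound ((T.continuous.comp hQ).mul hQ) (b := ‖T‖ * η⁻¹ * η⁻¹) fun b => ?_
  refine (norm_mul_le _ _).trans (mul_le_mul ?_ (hQb b) (norm_nonneg _) (by positivity))
  exact (T.le_opNorm _).trans (mul_le_mul_of_nonneg_left (hQb b) (norm_nonneg _))

lemma modelRes_mul_eq_one (hΥ : ∀ i j, Υ i j = Υ j i) (hC : C.IsHermitian)
    (hlam : ∀ i, 0 < (lam i).im) (b : EuclideanSpace ℝ (Sym2 ι)) :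
    profileMap Υ N b * modelRes Υ N C lam b + (C - diagonal lam) * modelRes Υ N C lam b = 1 := by
  rw [← add_mul, ← add_sub_assoc]
  exact sub_diagonal_mul_res ((profileMap_isHermitian hΥ N b).add hC) hlam

/-- Expand the noise in coordinates and integrate each by parts; the edge sum is the one computed in
`sum_profileMap_mul_mul`. -/
lemma integral_profileMap_mul_modelRes (hΥ : ∀ i j, Υ i j = Υ j i) (hΥ0 : ∀ i, Υ i i = 0)
    (hN : 0 < N) (hC : C.IsHermitian) {η : ℝ} (hη : 0 < η) (hlam : ∀ i, η ≤ (lam i).im) :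
    ∫ b, profileMap Υ N b * modelRes Υ N C lam b ∂(gaussLaw ι) =
      -(∫ b, shiftMap (varProfile Υ N) (modelRes Υ N C lam b) * modelRes Υ N C lam b ∂(gaussLaw ι)
        + (N⁻¹ : ℂ) • ∫ b, hadamardMap Υ (modelRes Υ N C lam b) * modelRes Υ N C lam b
          ∂(gaussLaw ι)) := by
  have hlam0 := fun i => hη.trans_le (hlam i)
  have hQ := continuous_modelRes (N := N) hΥ hC hlam0
  have hQb := norm_modelRes_le (N := N) hΥ hC hη hlam
  have e1 : ∀ b, profileMap Υ N b * modelRes Υ N C lam b =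
      ∑ e, profileMap Υ N (EuclideanSpace.single e 1) * (b e • modelRes Υ N C lam b) := by
    intro b
    conv_lhs => rw [profileMap_eq_sum, Finset.sum_mul]
    simp
  have hi1 := fun e => integrable_coord_smul_modelRes (N := N) hΥ hC hη hlam e
  have hi2 : ∀ e, Integrable (fun b => modelRes Υ N C lam b *
      profileMap Υ N (EuclideanSpace.single e 1) * modelRes Υ N C lam b) (gaussLaw ι) := by
    intro e
    refine integrable_of_bound ((hQ.mul continuous_const).mul hQ)
      (b := η⁻¹ * ‖profileMap Υ N (EuclideanSpace.single e 1)‖ * η⁻¹) fun b => ?_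
    refine (norm_mul_le _ _).trans (mul_le_mul ((norm_mul_le _ _).trans ?_) (hQb b)
      (norm_nonneg _) (by positivity))
    exact mul_le_mul_of_nonneg_right (hQb b) (norm_nonneg _)
  simp_rw [e1]
  rw [integral_finsetSum _ fun e _ => (hi1 e).const_mul _]
  have e2 : ∀ e, ∫ b, profileMap Υ N (EuclideanSpace.single e 1) * (b e • modelRes Υ N C lam b)
      ∂(gaussLaw ι) = -∫ b, profileMap Υ N (EuclideanSpace.single e 1) * (modelRes Υ N C lam b *
        profileMap Υ N (EuclideanSpace.single e 1) * modelRes Υ N C lam b) ∂(gaussLaw ι) := by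
    intro e
    rw [integral_const_mul_of_integrable (hi1 e), integral_coord_smul_modelRes hΥ hC hη hlam,
      integral_const_mul_of_integrable (hi2 e), mul_neg]
  simp_rw [e2]
  have hi3 : Integrable (fun b => (N⁻¹ : ℂ) • (hadamardMap Υ (modelRes Υ N C lam b) *
      modelRes Υ N C lam b)) (gaussLaw ι) :=
    (integrable_map_modelRes_mul hΥ hC hη hlam _).smul (N⁻¹ : ℂ)
  rw [Finset.sum_neg_distrib, ← integral_finsetSum _ fun e _ => (hi2 e).const_mul _,
    ← integral_smul, ← integral_add (integrable_map_modelRes_mul hΥ hC hη hlam _) hi3]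
  congr 1
  refine integral_congr_ae (ae_of_all _ fun b => ?_)
  simp only
  rw [← smul_mul_assoc, ← add_mul, ← sum_profileMap_mul_mul hΥ hΥ0 hN, Finset.sum_mul]
  exact Finset.sum_congr rfl fun e _ => by simp only [mul_assoc]

/-- The fluctuation of `R_N` along the resolvent. -/
noncomputable def fluct (Υ : Matrix ι ι ℝ) (N : ℝ) (C : Matrix ι ι ℂ) (lam : ι → ℂ)
    (b : EuclideanSpace ℝ (Sym2 ι)) : ι → ℂ :=
  shift (varProfile Υ N) (modelRes Υ N C lam b - meanRes Υ N C lam).diag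

/-- The approximate Dyson equation satisfied by the expected resolvent. -/
lemma sub_diagonal_mul_meanRes (hΥ : ∀ i j, Υ i j = Υ j i) (hΥ0 : ∀ i, Υ i i = 0)
    (hN : 0 < N) (hC : C.IsHermitian) {η : ℝ} (hη : 0 < η) (hlam : ∀ i, η ≤ (lam i).im) :
    (C - diagonal (lam + shift (varProfile Υ N) (meanRes Υ N C lam).diag)) * meanRes Υ N C lam =
      1 + (∫ b, diagonal (fluct Υ N C lam b) * modelRes Υ N C lam b ∂(gaussLaw ι) +
        (N⁻¹ : ℂ) • ∫ b, hadamardMap Υ (modelRes Υ N C lam b) * modelRes Υ N C lam b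
          ∂(gaussLaw ι)) := by
  have hlam0 := fun i => hη.trans_le (hlam i)
  have hi := integrable_modelRes (N := N) hΥ hC hη hlam
  have h1 := integral_profileMap_mul_modelRes (N := N) hΥ hΥ0 hN hC hη hlam
  have h2 : ∫ b, profileMap Υ N b * modelRes Υ N C lam b ∂(gaussLaw ι) =
      1 - (C - diagonal lam) * meanRes Υ N C lam := by
    rw [meanRes, ← integral_const_mul_of_integrable hi, ← sub_eq_zero]
    have : ∀ b, profileMap Υ N b * modelRes Υ N C lam b =
        1 - (C - diagonal lam) * modelRes Υ N C lam b := fun b =>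
      eq_sub_of_add_eq (modelRes_mul_eq_one hΥ hC hlam0 b)
    simp_rw [this]
    rw [integral_sub (integrable_const _) (hi.const_mul _)]
    simp
  have h3 : ∫ b, diagonal (fluct Υ N C lam b) * modelRes Υ N C lam b ∂(gaussLaw ι) =
      ∫ b, shiftMap (varProfile Υ N) (modelRes Υ N C lam b) * modelRes Υ N C lam b ∂(gaussLaw ι) -
        diagonal (shift (varProfile Υ N) (meanRes Υ N C lam).diag) * meanRes Υ N C lam := by
    have : ∀ b, diagonal (fluct Υ N C lam b) * modelRes Υ N C lam b =
        shiftMap (varProfile Υ N) (modelRes Υ N C lam b) * modelRes Υ N C lam b -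
        diagonal (shift (varProfile Υ N) (meanRes Υ N C lam).diag) * modelRes Υ N C lam b := by
      intro b
      rw [fluct, ← shiftMap_apply, map_sub, sub_mul, shiftMap_apply _ (meanRes Υ N C lam)]
    simp_rw [this]
    rw [integral_sub (integrable_map_modelRes_mul hΥ hC hη hlam _) (hi.const_mul _),
      integral_const_mul_of_integrable hi, meanRes]
  have h4 : diagonal (lam + shift (varProfile Υ N) (meanRes Υ N C lam).diag) =
      diagonal lam + diagonal (shift (varProfile Υ N) (meanRes Υ N C lam).diag) := by
    rw [diagonal_add]; rfl
  rw [h3, h4, ← sub_sub, sub_mul]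
  rw [h2] at h1
  rw [sub_eq_iff_eq_add] at h1
  rw [h1]
  abel

lemma map_meanRes (hΥ : ∀ i j, Υ i j = Υ j i) (hC : C.IsHermitian) {η : ℝ} (hη : 0 < η)
    (hlam : ∀ i, η ≤ (lam i).im) (φ : Matrix ι ι ℂ →L[ℝ] ℝ) :
    ∫ b, φ (modelRes Υ N C lam b) ∂(gaussLaw ι) = φ (meanRes Υ N C lam) :=
  φ.integral_comp_comm (integrable_modelRes hΥ hC hη hlam)

lemma meanRes_im_nonneg (hΥ : ∀ i j, Υ i j = Υ j i) (hC : C.IsHermitian) {η : ℝ} (hη : 0 < η)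
    (hlam : ∀ i, η ≤ (lam i).im) (i : ι) : 0 ≤ ((meanRes Υ N C lam).diag i).im := by
  rw [diag_apply, ← entryIm_apply, ← map_meanRes hΥ hC hη hlam]
  refine integral_nonneg fun b => ?_
  rw [entryIm_apply]
  exact (im_res_diag_pos ((profileMap_isHermitian hΥ N b).add hC)
    (fun i => hη.trans_le (hlam i)) i).le

variable {γ κ : ℝ}

/-- The complex functional `M ↦ ∑_j s_ij M_jj`. -/
noncomputable def shiftFunctional (s : ι → ι → ℝ) (i : ι) : Matrix ι ι ℂ →L[ℝ] ℂ :=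
  ((LinearMap.toContinuousLinearMap (Matrix.entryLinearMap ℂ ℂ i i)) ∘L
    (shiftMap s)).restrictScalars ℝ

lemma shiftFunctional_apply (s : ι → ι → ℝ) (i : ι) (M : Matrix ι ι ℂ) :
    shiftFunctional s i M = shift s M.diag i := by
  change shiftMap s M i i = _
  rw [shiftMap_apply, diagonal_apply_eq]

/-- The variance bound is applied to real and imaginary parts separately. The functional has
Frobenius constant √(γ⁴/N) and the resolvent has gradient η⁻² √(2γ²/N), whence N⁻². -/
lemma integral_norm_fluct_sq_le (hΥ : ∀ i j, Υ i j = Υ j i) (hN : (Fintype.card ι : ℝ) = N)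
    (hN0 : 0 < N) (hγ : ∀ i j, |Υ i j| ≤ γ) (hC : C.IsHermitian) {η : ℝ} (hη : 0 < η)
    (hlam : ∀ i, η ≤ (lam i).im) (i : ι) :
    ∫ b, ‖fluct Υ N C lam b i‖ ^ 2 ∂(gaussLaw ι) ≤ 8 * γ ^ 6 * η⁻¹ ^ 4 / N ^ 2 := by
  have hlam0 := fun i => hη.trans_le (hlam i)
  have key : ∀ ψ : ℂ →L[ℝ] ℝ, (∀ z, |ψ z| ≤ ‖z‖) →
      Integrable (fun b => (ψ (fluct Υ N C lam b i)) ^ 2) (gaussLaw ι) ∧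
      ∫ b, (ψ (fluct Υ N C lam b i)) ^ 2 ∂(gaussLaw ι) ≤ 4 * γ ^ 6 * η⁻¹ ^ 4 / N ^ 2 := by
    intro ψ hψ
    set φ := ψ ∘L shiftFunctional (varProfile Υ N) i with hφ
    have hφb : ∀ M, |φ M| ≤ √(γ ^ 4 / N) * √(froSq M) := by
      intro M
      refine (hψ _).trans ?_
      change ‖shiftFunctional (varProfile Υ N) i M‖ ≤ _
      rw [shiftFunctional_apply]
      exact norm_shift_varProfile_le hN hN0 hγ M i
    have e1 : ∀ b, ψ (fluct Υ N C lam b i) =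
        φ (modelRes Υ N C lam b) - ∫ b, φ (modelRes Υ N C lam b) ∂(gaussLaw ι) := by
      intro b
      rw [map_meanRes hΥ hC hη hlam, ← map_sub, fluct, ← shiftFunctional_apply]
      rfl
    have hcd := contDiff_comp_modelRes (N := N) hΥ hC hlam0 φ
    have hbd := abs_comp_modelRes_le (N := N) hΥ hC hη hlam φ
    have hv := variance_le_of_norm_fderiv_le hcd hbd
      (norm_fderiv_comp_modelRes_le hΥ hC hη hlam hN0 hγ φ (Real.sqrt_nonneg _) hφb)
    simp_rw [e1]
    refine ⟨?_, hv.trans ?_⟩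
    · have hc := hcd.continuous
      refine integrable_of_bound ((hc.sub continuous_const).pow 2)
        (b := (‖φ‖ * η⁻¹ + |∫ b, φ (modelRes Υ N C lam b) ∂(gaussLaw ι)|) ^ 2) fun b => ?_
      rw [norm_pow]
      exact pow_le_pow_left₀ (norm_nonneg _)
        ((norm_sub_le _ _).trans (add_le_add (hbd b) le_rfl)) 2
    · rw [mul_pow, mul_pow, Real.sq_sqrt (by positivity), Real.sq_sqrt (by positivity)]
      -- The crude bound π ≤ 4 turns π²/4 into 4 for each part, so 8 in total, whose square root is
      -- the 2√2 of the theorem.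
      have hpi : Real.pi ^ 2 ≤ 4 ^ 2 := pow_le_pow_left₀ Real.pi_pos.le Real.pi_le_four 2
      calc Real.pi ^ 2 * (γ ^ 4 / N * ((η⁻¹ ^ 2) ^ 2 * (2 * γ ^ 2 / N))) / 8
          = Real.pi ^ 2 * (γ ^ 6 * η⁻¹ ^ 4 / N ^ 2 / 4) := by field_simp; ring
        _ ≤ 4 ^ 2 * (γ ^ 6 * η⁻¹ ^ 4 / N ^ 2 / 4) := by
            refine mul_le_mul_of_nonneg_right hpi ?_
            have : γ ^ 6 = (γ ^ 3) ^ 2 := by ring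
            rw [this]; positivity
        _ = _ := by ring
  have h1 := key Complex.reCLM Complex.abs_re_le_norm
  have h2 := key Complex.imCLM Complex.abs_im_le_norm
  have e : ∀ b, ‖fluct Υ N C lam b i‖ ^ 2 = (Complex.reCLM (fluct Υ N C lam b i)) ^ 2 +
      (Complex.imCLM (fluct Υ N C lam b i)) ^ 2 := by
    intro b
    rw [← Complex.normSq_eq_norm_sq, Complex.normSq_apply, Complex.reCLM_apply,
      Complex.imCLM_apply]
    ring
  simp_rw [e]
  rw [integral_add h1.1 h2.1]
  refine (add_le_add h1.2 h2.2).trans_eq ?_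
  ring

/-- Jensen for the square root, obtained from nonnegativity of the variance of √Z. -/
lemma integral_sqrt_le {α : Type*} [MeasurableSpace α] {μ : Measure α} [IsProbabilityMeasure μ]
    {Z : α → ℝ} (hZ0 : ∀ x, 0 ≤ Z x) (hZ : Integrable Z μ) :
    ∫ x, √(Z x) ∂μ ≤ √(∫ x, Z x ∂μ) := by
  have hs : Integrable (fun x => √(Z x)) μ := by
    refine (hZ.add (integrable_const 1)).mono'
      (Real.continuous_sqrt.comp_aestronglyMeasurable hZ.1) (ae_of_all _ fun x => ?_)
    rw [Real.norm_of_nonneg (Real.sqrt_nonneg _), Pi.add_apply]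
    nlinarith [Real.sq_sqrt (hZ0 x), sq_nonneg (√(Z x) - 1)]
  refine Real.le_sqrt_of_sq_le ?_
  set m := ∫ x, √(Z x) ∂μ with hm
  have h1 : 0 ≤ ∫ x, (√(Z x) - m) ^ 2 ∂μ := integral_nonneg fun x => sq_nonneg _
  have h2 : ∀ x, (√(Z x) - m) ^ 2 = Z x - 2 * m * √(Z x) + m ^ 2 := fun x => by
    rw [sub_sq, Real.sq_sqrt (hZ0 x)]; ring
  simp_rw [h2] at h1
  have i1 : Integrable (fun x => Z x - 2 * m * √(Z x)) μ := hZ.sub (hs.const_mul _)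
  rw [integral_add i1 (integrable_const _), integral_sub hZ (hs.const_mul _),
    integral_const_mul, ← hm] at h1
  simp at h1
  linarith

lemma continuous_fluct (hΥ : ∀ i j, Υ i j = Υ j i) (hC : C.IsHermitian)
    (hlam : ∀ i, 0 < (lam i).im) (i : ι) : Continuous fun b => fluct Υ N C lam b i := by
  have h : ∀ b, fluct Υ N C lam b i = shiftFunctional (varProfile Υ N) i
      (modelRes Υ N C lam b - meanRes Υ N C lam) := fun b => by rw [shiftFunctional_apply, fluct]
  simp_rw [h]
  exact (shiftFunctional _ i).continuous.comp
    ((continuous_modelRes hΥ hC hlam).sub continuous_const)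

lemma norm_integral_fluct_mul_le (hΥ : ∀ i j, Υ i j = Υ j i) (hN : (Fintype.card ι : ℝ) = N)
    (hN0 : 0 < N) (hγ0 : 0 ≤ γ) (hγ : ∀ i j, |Υ i j| ≤ γ) (hC : C.IsHermitian) {η : ℝ}
    (hη : 0 < η) (hlam : ∀ i, η ≤ (lam i).im) :
    ‖∫ b, diagonal (fluct Υ N C lam b) * modelRes Υ N C lam b ∂(gaussLaw ι)‖ ≤
      2 * √2 * γ ^ 3 * η⁻¹ ^ 3 / N := by
  have hlam0 := fun i => hη.trans_le (hlam i)
  have hQ := continuous_modelRes (N := N) hΥ hC hlam0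
  have hQb := norm_modelRes_le (N := N) hΥ hC hη hlam
  have hfl := continuous_fluct (N := N) hΥ hC hlam0
  have hflb : ∀ b i, ‖fluct Υ N C lam b i‖ ≤ ‖shiftFunctional (varProfile Υ N) i‖ *
      (η⁻¹ + ‖meanRes Υ N C lam‖) := by
    intro b i
    rw [fluct, ← shiftFunctional_apply]
    exact ((shiftFunctional _ i).le_opNorm _).trans (mul_le_mul_of_nonneg_left
      ((norm_sub_le _ _).trans (add_le_add (hQb b) le_rfl)) (norm_nonneg _))
  have hi : Integrable (fun b => diagonal (fluct Υ N C lam b) * modelRes Υ N C lam b)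
      (gaussLaw ι) := by
    refine integrable_of_bound (b := (∑ i, ‖shiftFunctional (varProfile Υ N) i‖ *
      (η⁻¹ + ‖meanRes Υ N C lam‖)) * η⁻¹) (Continuous.mul ?_ hQ) fun b => ?_
    · exact Continuous.matrix_diagonal (continuous_pi hfl)
    · have hnn : ∀ i ∈ Finset.univ, 0 ≤ ‖shiftFunctional (varProfile Υ N) i‖ *
        (η⁻¹ + ‖meanRes Υ N C lam‖) := fun i _ => by positivity
      refine (norm_mul_le _ _).trans (mul_le_mul (opNorm_diagonal_le
        (Finset.sum_nonneg hnn) fun i => (hflb b i).trans ?_) (hQb b) (norm_nonneg _)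
        (Finset.sum_nonneg hnn))
      exact Finset.single_le_sum (f := fun i => ‖shiftFunctional (varProfile Υ N) i‖ *
        (η⁻¹ + ‖meanRes Υ N C lam‖)) hnn (Finset.mem_univ i)
  refine opNorm_le_of_bilin_le (by positivity) fun u v => ?_
  -- Z is the squared norm of u weighted by the fluctuations. Moving the diagonal factor onto u
  -- means that only the variance of each coordinate enters, with no supremum over coordinates
  -- inside the expectation.
  set Z : EuclideanSpace ℝ (Sym2 ι) → ℝ := fun b => ∑ i, ‖u i‖ ^ 2 * ‖fluct Υ N C lam b i‖ ^ 2
    with hZ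
  have hfi : ∀ i, Integrable (fun b => ‖fluct Υ N C lam b i‖ ^ 2) (gaussLaw ι) := fun i =>
    integrable_of_bound ((hfl i).norm.pow 2) (b := (‖shiftFunctional (varProfile Υ N) i‖ *
      (η⁻¹ + ‖meanRes Υ N C lam‖)) ^ 2) fun b => by
        rw [norm_pow, norm_norm]; exact pow_le_pow_left₀ (norm_nonneg _) (hflb b i) 2
  have hZ0 : ∀ b, 0 ≤ Z b := fun b => Finset.sum_nonneg fun i _ => by positivity
  have hZi : Integrable Z (gaussLaw ι) :=
    integrable_finsetSum _ fun i _ => (hfi i).const_mul _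
  have hZle : ∫ b, Z b ∂(gaussLaw ι) ≤ normSq u * (8 * γ ^ 6 * η⁻¹ ^ 4 / N ^ 2) := by
    rw [hZ, integral_finsetSum _ fun i _ => (hfi i).const_mul _, normSq, Finset.sum_mul]
    refine Finset.sum_le_sum fun i _ => ?_
    rw [integral_const_mul]
    exact mul_le_mul_of_nonneg_left
      (integral_norm_fluct_sq_le hΥ hN hN0 hγ hC hη hlam i) (by positivity)
  set T : Matrix ι ι ℂ →ₗ[ℂ] ℂ :=
    { toFun := fun M => star u ⬝ᵥ M *ᵥ v
      map_add' := fun A B => by rw [add_mulVec, dotProduct_add]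
      map_smul' := fun r A => by rw [smul_mulVec, dotProduct_smul]; rfl } with hT
  have hTi := (LinearMap.toContinuousLinearMap T).integral_comp_comm hi
  change ∫ b, star u ⬝ᵥ (diagonal (fluct Υ N C lam b) * modelRes Υ N C lam b) *ᵥ v ∂(gaussLaw ι) =
    star u ⬝ᵥ (∫ b, diagonal (fluct Υ N C lam b) * modelRes Υ N C lam b ∂(gaussLaw ι)) *ᵥ v at hTi
  rw [← hTi]
  have hpt : ∀ b, ‖star u ⬝ᵥ (diagonal (fluct Υ N C lam b) * modelRes Υ N C lam b) *ᵥ v‖ ≤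
      √(Z b) * (η⁻¹ * √(normSq v)) := by
    intro b
    rw [← mulVec_mulVec]
    have h1 : ‖star u ⬝ᵥ diagonal (fluct Υ N C lam b) *ᵥ modelRes Υ N C lam b *ᵥ v‖ ≤
        ∑ i, (‖u i‖ * ‖fluct Υ N C lam b i‖) * ‖(modelRes Υ N C lam b *ᵥ v) i‖ := by
      refine (norm_sum_le _ _).trans_eq (Finset.sum_congr rfl fun i _ => ?_)
      rw [mulVec_diagonal, norm_mul, norm_mul, Pi.star_apply, norm_star, mul_assoc]
    refine h1.trans ((Real.sum_mul_le_sqrt_mul_sqrt _ _ _).trans ?_)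
    simp only [mul_pow]
    refine mul_le_mul_of_nonneg_left ?_ (Real.sqrt_nonneg _)
    exact (sqrt_normSq_mulVec_le _ _).trans
      (mul_le_mul_of_nonneg_right (hQb b) (Real.sqrt_nonneg _))
  have hZc : Continuous Z := by
    refine continuous_finsetSum _ fun i _ => ?_
    exact continuous_const.mul ((hfl i).norm.pow 2)
  have hsi : Integrable (fun b => √(Z b)) (gaussLaw ι) := by
    refine (hZi.add (integrable_const 1)).mono' (Real.continuous_sqrt.comp hZc).aestronglyMeasurable
      (ae_of_all _ fun x => ?_)
    rw [Real.norm_of_nonneg (Real.sqrt_nonneg _), Pi.add_apply]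
    nlinarith [Real.sq_sqrt (hZ0 x), sq_nonneg (√(Z x) - 1)]
  refine (norm_integral_le_of_norm_le (hsi.mul_const _) (ae_of_all _ hpt)).trans ?_
  rw [integral_mul_const]
  have h3 : √(normSq u * (8 * γ ^ 6 * η⁻¹ ^ 4 / N ^ 2)) =
      √(normSq u) * (2 * √2 * γ ^ 3 * η⁻¹ ^ 2 / N) := by
    rw [Real.sqrt_mul (normSq_nonneg u)]
    congr 1
    rw [Real.sqrt_eq_iff_mul_self_eq (by positivity) (by positivity)]
    have := Real.mul_self_sqrt (zero_le_two (α := ℝ))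
    linear_combination -(4 * γ ^ 6 * η⁻¹ ^ 4 / N ^ 2) * this
  calc (∫ b, √(Z b) ∂(gaussLaw ι)) * (η⁻¹ * √(normSq v))
      ≤ √(normSq u * (8 * γ ^ 6 * η⁻¹ ^ 4 / N ^ 2)) * (η⁻¹ * √(normSq v)) := by
        refine mul_le_mul_of_nonneg_right ?_ (by positivity)
        exact (integral_sqrt_le hZ0 hZi).trans (Real.sqrt_le_sqrt hZle)
    _ = _ := by rw [h3]; ring

/-- The resolvent is symmetric, so the transpose in the Hadamard term disappears and the almost sure
bound applies directly. -/
lemma norm_integral_hadamard_mul_le (hΥ : ∀ i j, Υ i j = Υ j i) (hC : C.IsHermitian)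
    (hCt : Cᵀ = C) {η : ℝ} (hη : 0 < η) (hlam : ∀ i, η ≤ (lam i).im) (hκ0 : 0 ≤ κ)
    (hκ : ∀ᵐ b ∂(gaussLaw ι), ‖sqProfile Υ ⊙ modelRes Υ N C lam b‖ ≤ κ) :
    ‖∫ b, hadamardMap Υ (modelRes Υ N C lam b) * modelRes Υ N C lam b ∂(gaussLaw ι)‖ ≤
      κ * η⁻¹ := by
  refine (norm_integral_le_of_norm_le_const (C := κ * η⁻¹) ?_).trans_eq (by simp)
  filter_upwards [hκ] with b hb
  rw [hadamardMap_apply, modelRes_transpose hΥ hCt]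
  exact (norm_mul_le _ _).trans
    (mul_le_mul hb (norm_modelRes_le hΥ hC hη hlam b) (norm_nonneg _) hκ0)

/-- The expected resolvent nearly solves the Dyson equation. -/
lemma norm_meanRes_sub_res_le (hΥ : ∀ i j, Υ i j = Υ j i) (hΥ0 : ∀ i, Υ i i = 0)
    (hN : (Fintype.card ι : ℝ) = N) (hN0 : 0 < N) (hγ0 : 0 ≤ γ) (hγ : ∀ i j, |Υ i j| ≤ γ)
    (hC : C.IsHermitian) (hCt : Cᵀ = C) {η : ℝ} (hη : 0 < η) (hlam : ∀ i, η ≤ (lam i).im)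
    (hκ0 : 0 ≤ κ) (hκ : ∀ᵐ b ∂(gaussLaw ι), ‖sqProfile Υ ⊙ modelRes Υ N C lam b‖ ≤ κ) :
    ‖meanRes Υ N C lam - res C (lam + shift (varProfile Υ N) (meanRes Υ N C lam).diag)‖ ≤
      (2 * √2 * γ ^ 3 * η⁻¹ ^ 4 + κ * η⁻¹ ^ 2) / N := by
  have hnn := meanRes_im_nonneg (N := N) hΥ hC hη hlam
  have hle := le_add_shift_im (varProfile_nonneg (Υ := Υ) hN0) hlam hnn
  set w := lam + shift (varProfile Υ N) (meanRes Υ N C lam).diag with hw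
  have hw0 : ∀ i, 0 < (w i).im := fun i => hη.trans_le (hle i)
  have h1 := sub_diagonal_mul_meanRes hΥ hΥ0 hN0 hC hη hlam
  rw [← hw] at h1
  -- Multiplying by the resolvent costs one more factor η⁻¹ and isolates the mean.
  have h2 := congrArg (fun M => res C w * M) h1
  simp only [← mul_assoc, res_mul_sub_diagonal hC hw0, one_mul, mul_add, mul_one] at h2
  rw [h2, add_sub_cancel_left]
  have hres := norm_res_le hC hη hle
  have b1 := norm_integral_fluct_mul_le hΥ hN hN0 hγ0 hγ hC hη hlam
  have b2 := norm_integral_hadamard_mul_le hΥ hC hCt hη hlam hκ0 hκ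
  have b3 : ‖(N⁻¹ : ℂ)‖ = N⁻¹ := by
    rw [norm_inv, Complex.norm_real, Real.norm_of_nonneg hN0.le]
  refine (norm_add_le _ _).trans ?_
  have c1 := (norm_mul_le _ _).trans (mul_le_mul hres b1 (norm_nonneg _) (by positivity))
  have c2 := (norm_mul_le _ _).trans (mul_le_mul hres
    ((norm_smul_le (N⁻¹ : ℂ) _).trans (mul_le_mul_of_nonneg_left b2 (norm_nonneg _)))
    (norm_nonneg _) (by positivity))
  refine (add_le_add c1 c2).trans_eq ?_
  rw [b3]
  ring

end Bias

/-! ### Block-diagonal parts for an index partition. -/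

section Pinching

variable {ι κ : Type*} [DecidableEq κ]

/-- The block diagonal part of a matrix, for the blocks given by the fibres of `r`. -/
def pinch (r : ι → κ) (M : Matrix ι ι ℂ) : Matrix ι ι ℂ :=
  Matrix.of fun i j => if r i = r j then M i j else 0

lemma pinch_apply (r : ι → κ) (M : Matrix ι ι ℂ) (i j : ι) :
    pinch r M i j = if r i = r j then M i j else 0 := rfl

lemma pinch_sub (r : ι → κ) (A B : Matrix ι ι ℂ) : pinch r (A - B) = pinch r A - pinch r B := by
  ext i j
  simp only [pinch_apply, Matrix.sub_apply]
  split_ifs <;> simp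

lemma pinch_diagonal [DecidableEq ι] (r : ι → κ) (w : ι → ℂ) :
    pinch r (diagonal w) = diagonal w := by
  ext i j
  rw [pinch_apply, diagonal_apply]
  by_cases h : i = j <;> simp [h]

variable [Fintype ι]

lemma pinch_mulVec (r : ι → κ) (M : Matrix ι ι ℂ) (v : ι → ℂ) (i : ι) :
    (pinch r M *ᵥ v) i = (M *ᵥ fun j => if r j = r i then v j else 0) i := by
  simp only [mulVec, dotProduct, pinch_apply]
  refine Finset.sum_congr rfl fun j _ => ?_
  by_cases h : r i = r j
  · simp [h]
  · simp [h, Ne.symm h]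

variable [DecidableEq ι]

/-- On rows of class c the pinched matrix acts as M on the restriction of v to that class, and these
restrictions are orthogonal. -/
lemma norm_pinch_le [Fintype κ] (r : ι → κ) (M : Matrix ι ι ℂ) : ‖pinch r M‖ ≤ ‖M‖ := by
  refine opNorm_le_of_normSq_mulVec_le (norm_nonneg _) fun v => ?_
  set V : κ → ι → ℂ := fun c j => if r j = c then v j else 0 with hV
  have h1 : normSq (pinch r M *ᵥ v) = ∑ c, ∑ i with r i = c, ‖(M *ᵥ V c) i‖ ^ 2 := by
    rw [normSq, ← Finset.sum_fiberwise Finset.univ r]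
    refine Finset.sum_congr rfl fun c _ => Finset.sum_congr rfl fun i hi => ?_
    rw [pinch_mulVec, (Finset.mem_filter.1 hi).2]
  have h2 : normSq v = ∑ c, normSq (V c) := by
    simp only [normSq, hV]
    rw [Finset.sum_comm]
    refine Finset.sum_congr rfl fun i _ => ?_
    rw [Finset.sum_eq_single (r i)] <;> simp +contextual [eq_comm]
  rw [h1, h2, Finset.mul_sum]
  refine Finset.sum_le_sum fun c _ => ?_
  refine le_trans ?_ (normSq_mulVec_le M (V c))
  exact Finset.sum_le_sum_of_subset_of_nonneg (Finset.filter_subset _ _)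
    fun _ _ _ => by positivity

/-- At most two nonzero entries per row (Cauchy–Schwarz) and per column (exchange of sums) cost a
factor 2 each in the squared norm. -/
lemma norm_pinch_le_two_mul (r : ι → κ)
    (hr : ∀ i, (Finset.univ.filter fun j => r i = r j).card ≤ 2) (M : Matrix ι ι ℂ) {m : ℝ}
    (hm : 0 ≤ m) (h : ∀ i j, ‖pinch r M i j‖ ≤ m) : ‖pinch r M‖ ≤ 2 * m := by
  refine opNorm_le_of_normSq_mulVec_le (by positivity) fun v => ?_
  have h1 : ∀ i, ‖(pinch r M *ᵥ v) i‖ ^ 2 ≤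
      2 * m ^ 2 * ∑ j, if r i = r j then ‖v j‖ ^ 2 else 0 := by
    intro i
    have e1 : ‖(pinch r M *ᵥ v) i‖ ≤ ∑ j with r i = r j, m * ‖v j‖ := by
      rw [Finset.sum_filter]
      refine (norm_sum_le _ _).trans (Finset.sum_le_sum fun j _ => ?_)
      rw [norm_mul]
      split_ifs with hij
      · exact mul_le_mul_of_nonneg_right (h i j) (norm_nonneg _)
      · simp [pinch_apply, hij]
    have e2 := sq_sum_le_card_mul_sum_sq (s := Finset.univ.filter fun j => r i = r j)
      (f := fun j => m * ‖v j‖)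
    have e3 : (((Finset.univ.filter fun j => r i = r j).card : ℕ) : ℝ) ≤ 2 := by
      exact_mod_cast hr i
    calc ‖(pinch r M *ᵥ v) i‖ ^ 2 ≤ (∑ j with r i = r j, m * ‖v j‖) ^ 2 :=
          pow_le_pow_left₀ (norm_nonneg _) e1 2
      _ ≤ 2 * ∑ j with r i = r j, (m * ‖v j‖) ^ 2 :=
          e2.trans (mul_le_mul_of_nonneg_right e3 (Finset.sum_nonneg fun _ _ => sq_nonneg _))
      _ = _ := by
          rw [Finset.sum_filter, mul_assoc, Finset.mul_sum (a := m ^ 2)]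
          congr 1
          refine Finset.sum_congr rfl fun j _ => ?_
          split_ifs <;> ring
  calc normSq (pinch r M *ᵥ v)
      ≤ ∑ i, 2 * m ^ 2 * ∑ j, (if r i = r j then ‖v j‖ ^ 2 else 0) :=
        Finset.sum_le_sum fun i _ => h1 i
    _ = 2 * m ^ 2 * ∑ j, ∑ i, (if r i = r j then ‖v j‖ ^ 2 else 0) := by
        rw [← Finset.mul_sum, Finset.sum_comm]
    _ ≤ 2 * m ^ 2 * ∑ j, 2 * ‖v j‖ ^ 2 := by
        refine mul_le_mul_of_nonneg_left (Finset.sum_le_sum fun j _ => ?_) (by positivity)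
        rw [← Finset.sum_filter, Finset.sum_const, nsmul_eq_mul]
        refine mul_le_mul_of_nonneg_right ?_ (by positivity)
        have := hr j
        simp only [eq_comm (a := r j)] at this
        exact_mod_cast this
    _ = _ := by rw [← Finset.mul_sum, normSq]; ring

/-- Being block diagonal is commuting with the class projections, a property inherited by inverses;
hence `pinch_res`. -/
lemma pinch_eq_self_iff (r : ι → κ) (M : Matrix ι ι ℂ) :
    pinch r M = M ↔ ∀ c, Commute (diagonal fun i => if r i = c then (1 : ℂ) else 0) M := by
  constructor
  · intro h c
    ext i j
    rw [diagonal_mul, mul_diagonal, ← h, pinch_apply]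
    by_cases hij : r i = r j <;> simp [hij]
  · intro h
    ext i j
    have := congrFun (congrFun (h (r j)).eq i) j
    rw [diagonal_mul, mul_diagonal, if_pos rfl, mul_one] at this
    rw [pinch_apply, ← this]
    split_ifs <;> simp

lemma pinch_res (r : ι → κ) {C : Matrix ι ι ℂ} {w : ι → ℂ} (hC : C.IsHermitian)
    (hw : ∀ i, 0 < (w i).im) (hr : pinch r C = C) : pinch r (res C w) = res C w := by
  have hB : pinch r (C - diagonal w) = C - diagonal w := by rw [pinch_sub, hr, pinch_diagonal]
  rw [pinch_eq_self_iff] at hB ⊢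
  intro c
  have hBc := (hB c).eq
  generalize (diagonal fun i => if r i = c then (1 : ℂ) else 0) = P at hBc ⊢
  calc P * res C w = res C w * (C - diagonal w) * P * res C w := by
        rw [res_mul_sub_diagonal hC hw, one_mul]
    _ = res C w * (P * (C - diagonal w)) * res C w := by rw [hBc]; simp only [mul_assoc]
    _ = res C w * P := by rw [mul_assoc, mul_assoc, sub_diagonal_mul_res hC hw, mul_one]

end Pinching

/-! ### Eight directions that detect the modulus of a complex number. -/

section Octagon

/-- The vertices of a regular octagon. -/
noncomputable def octagon : Fin 8 → ℝ × ℝ :=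
  ![(1, 0), (-1, 0), (0, 1), (0, -1), (√2 / 2, √2 / 2), (√2 / 2, -(√2 / 2)),
    (-(√2 / 2), √2 / 2), (-(√2 / 2), -(√2 / 2))]

lemma octagon_sq_add_sq (k : Fin 8) : (octagon k).1 ^ 2 + (octagon k).2 ^ 2 = 1 := by
  have h : (√2 / 2) ^ 2 + (√2 / 2) ^ 2 = 1 := by
    rw [div_pow, Real.sq_sqrt zero_le_two]; norm_num
  fin_cases k <;> simp [octagon, h]

/-- One-sided tails suffice for a modulus bound at the cost of a constant. The value √3/2 is below
the optimal cos(π/8), is easy to verify, and is large enough for the final count. -/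
lemma exists_octagon_le (x y : ℝ) :
    ∃ k, √3 / 2 * √(x ^ 2 + y ^ 2) ≤ (octagon k).1 * x + (octagon k).2 * y := by
  by_contra! hcon
  set R := √3 / 2 * √(x ^ 2 + y ^ 2) with hR
  have hR2 : R ^ 2 = 3 / 4 * (x ^ 2 + y ^ 2) := by
    rw [hR, mul_pow, div_pow, Real.sq_sqrt (by positivity), Real.sq_sqrt (by positivity)]
    norm_num
  have h2 : √2 ^ 2 = 2 := Real.sq_sqrt zero_le_two
  have h0 : 0 < √2 := by positivity
  have c0 : x < R := by simpa [octagon] using hcon 0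
  have c1 : -x < R := by simpa [octagon] using hcon 1
  have c2 : y < R := by simpa [octagon] using hcon 2
  have c3 : -y < R := by simpa [octagon] using hcon 3
  have c4 : √2 / 2 * x + √2 / 2 * y < R := by simpa [octagon] using hcon 4
  have c5 : √2 / 2 * x + -(√2 / 2 * y) < R := by simpa [octagon] using hcon 5
  have c6 : -(√2 / 2 * x) + √2 / 2 * y < R := by simpa [octagon] using hcon 6
  have c7 : -(√2 / 2 * x) + -(√2 / 2 * y) < R := by simpa [octagon] using hcon 7
  have d1 : x ^ 2 < R ^ 2 := sq_lt_sq' (by linarith) c0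
  have d2 : y ^ 2 < R ^ 2 := sq_lt_sq' (by linarith) c2
  have d3 : (√2 / 2 * x + √2 / 2 * y) ^ 2 < R ^ 2 := sq_lt_sq' (by linarith) c4
  have d4 : (√2 / 2 * x - √2 / 2 * y) ^ 2 < R ^ 2 := sq_lt_sq' (by linarith) (by linarith)
  have e3 : (√2 / 2 * x + √2 / 2 * y) ^ 2 = (x + y) ^ 2 / 2 := by
    linear_combination (x + y) ^ 2 / 4 * h2
  have e4 : (√2 / 2 * x - √2 / 2 * y) ^ 2 = (x - y) ^ 2 / 2 := by
    linear_combination (x - y) ^ 2 / 4 * h2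
  rw [e3, hR2] at d3
  rw [e4, hR2] at d4
  rw [hR2] at d1 d2
  have f1 : 0 < 3 * x ^ 2 - y ^ 2 := by linarith
  have f2 : 0 < 3 * y ^ 2 - x ^ 2 := by linarith
  have f3 : 0 < x ^ 2 + y ^ 2 - 4 * (x * y) := by nlinarith
  have f4 : 0 < x ^ 2 + y ^ 2 + 4 * (x * y) := by nlinarith
  -- The products say x⁴ + y⁴ < (10/3) x²y² and x⁴ + y⁴ > 14 x²y², which are incompatible.
  nlinarith [mul_pos f1 f2, mul_pos f3 f4]

end Octagon

/-! ### Tail bounds for entries and for block-diagonal parts. -/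

section Concentration

variable {ι κ : Type*} [Fintype ι] [DecidableEq κ]
variable {Υ : Matrix ι ι ℝ} {N γ : ℝ} {C : Matrix ι ι ℂ} {lam : ι → ℂ}

/-- The real functional `M ↦ x Re M_ij + y Im M_ij`. -/
noncomputable def entryDir (c : ℝ × ℝ) (i j : ι) : Matrix ι ι ℂ →L[ℝ] ℝ :=
  c.1 • entryRe i j + c.2 • entryIm i j

lemma entryDir_apply (c : ℝ × ℝ) (i j : ι) (M : Matrix ι ι ℂ) :
    entryDir c i j M = c.1 * (M i j).re + c.2 * (M i j).im := rfl

lemma abs_entryDir_le {c : ℝ × ℝ} (hc : c.1 ^ 2 + c.2 ^ 2 = 1) (i j : ι) (M : Matrix ι ι ℂ) :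
    |entryDir c i j M| ≤ 1 * √(froSq M) := by
  rw [one_mul, entryDir_apply]
  refine Real.le_sqrt_of_sq_le (le_trans ?_ (norm_entry_sq_le_froSq M i j))
  rw [sq_abs, ← Complex.normSq_eq_norm_sq, Complex.normSq_apply]
  nlinarith [sq_nonneg (c.1 * (M i j).im - c.2 * (M i j).re)]

variable [DecidableEq ι]

lemma measure_entryDir_ge_le (hΥ : ∀ i j, Υ i j = Υ j i) (hN : 0 < N) (hγ : ∀ i j, |Υ i j| ≤ γ)
    (hC : C.IsHermitian) {η : ℝ} (hη : 0 < η) (hlam : ∀ i, η ≤ (lam i).im) {c : ℝ × ℝ}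
    (hc : c.1 ^ 2 + c.2 ^ 2 = 1) (i j : ι) {ε : ℝ} (hε : 0 ≤ ε) :
    (gaussLaw ι).real {b | ε ≤ entryDir c i j (modelRes Υ N C lam b - meanRes Υ N C lam)} ≤
      Real.exp (-(2 * ε ^ 2 / (Real.pi ^ 2 * (η⁻¹ ^ 2 * √(2 * γ ^ 2 / N)) ^ 2))) := by
  have hlam0 := fun i => hη.trans_le (hlam i)
  have hφ := abs_entryDir_le hc i j
  set φ := entryDir c i j
  have hg := norm_fderiv_comp_modelRes_le hΥ hC hη hlam hN hγ φ zero_le_one hφ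
  simp only [one_mul] at hg
  have h := (hasSubgaussianMGF_sub_integral (contDiff_comp_modelRes (N := N) hΥ hC hlam0 φ)
    (abs_comp_modelRes_le hΥ hC hη hlam φ) hg).measure_ge_le hε
  rw [map_meanRes hΥ hC hη hlam, Real.coe_toNNReal _ (by positivity)] at h
  simp only [← map_sub] at h
  refine h.trans_eq ?_
  congr 1
  generalize (η⁻¹ ^ 2 * √(2 * γ ^ 2 / N)) ^ 2 = L2
  rw [← neg_div', neg_inj]
  rw [show 2 * (Real.pi ^ 2 * L2 / 4) = Real.pi ^ 2 * L2 / 2 by ring, div_div_eq_mul_div]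
  ring

/-- Concentration of the block diagonal part of the resolvent around its mean. -/
lemma measure_norm_pinch_ge_le [Nonempty ι] (hΥ : ∀ i j, Υ i j = Υ j i) (hN : 0 < N)
    (hγ : ∀ i j, |Υ i j| ≤ γ) (hC : C.IsHermitian) {η : ℝ} (hη : 0 < η)
    (hlam : ∀ i, η ≤ (lam i).im) (r : ι → κ)
    (hr : ∀ i, (Finset.univ.filter fun j => r i = r j).card ≤ 2) {t : ℝ} (ht : 0 < t) :
    (gaussLaw ι).real {b | t ≤ ‖pinch r (modelRes Υ N C lam b - meanRes Υ N C lam)‖} ≤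
      (Finset.univ.filter fun q : ι × ι => r q.1 = r q.2).card * (8 *
      Real.exp (-(3 * t ^ 2 / (8 * (Real.pi ^ 2 * (η⁻¹ ^ 2 * √(2 * γ ^ 2 / N)) ^ 2))))) := by
  set P := Finset.univ.filter fun q : ι × ι => r q.1 = r q.2 with hP
  -- A norm of at least t forces some entry within a class to have modulus at least t/2, hence some
  -- octagon direction to reach √3/2 · t/2.
  have hsub : {b | t ≤ ‖pinch r (modelRes Υ N C lam b - meanRes Υ N C lam)‖} ⊆
      ⋃ q ∈ P, ⋃ k ∈ (Finset.univ : Finset (Fin 8)), {b | √3 / 2 * (t / 2) ≤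
        entryDir (octagon k) q.1 q.2 (modelRes Υ N C lam b - meanRes Υ N C lam)} := by
    intro b hb
    simp only [Set.mem_ofPred_eq] at hb
    set D := modelRes Υ N C lam b - meanRes Υ N C lam
    obtain ⟨q, hq⟩ := Finite.exists_max fun q : ι × ι => ‖pinch r D q.1 q.2‖
    have h1 := hb.trans (norm_pinch_le_two_mul r hr D (norm_nonneg _) fun i j => hq (i, j))
    have hqr : r q.1 = r q.2 := by
      by_contra hne
      rw [pinch_apply, if_neg hne, norm_zero] at h1
      linarith
    rw [pinch_apply, if_pos hqr] at h1
    obtain ⟨k, hk⟩ := exists_octagon_le (D q.1 q.2).re (D q.1 q.2).im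
    simp only [Set.mem_iUnion]
    refine ⟨q, by simp [hP, hqr], k, Finset.mem_univ k, ?_⟩
    rw [Set.mem_ofPred_eq, entryDir_apply]
    refine le_trans ?_ hk
    have h2 : √((D q.1 q.2).re ^ 2 + (D q.1 q.2).im ^ 2) = ‖D q.1 q.2‖ := by
      rw [← Real.sqrt_sq (norm_nonneg (D q.1 q.2)), ← Complex.normSq_eq_norm_sq,
        Complex.normSq_apply]
      ring_nf
    rw [h2]
    exact mul_le_mul_of_nonneg_left (by linarith) (by positivity)
  refine (measureReal_mono hsub (measure_ne_top _ _)).trans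
    ((measureReal_biUnion_finset_le _ _).trans ?_)
  have h8 : ∀ q ∈ P, (gaussLaw ι).real (⋃ k ∈ (Finset.univ : Finset (Fin 8)),
      {b | √3 / 2 * (t / 2) ≤
        entryDir (octagon k) q.1 q.2 (modelRes Υ N C lam b - meanRes Υ N C lam)}) ≤ 8 *
      Real.exp (-(3 * t ^ 2 / (8 * (Real.pi ^ 2 * (η⁻¹ ^ 2 * √(2 * γ ^ 2 / N)) ^ 2)))) := by
    intro q _
    refine (measureReal_biUnion_finset_le _ _).trans ?_
    refine (Finset.sum_le_sum fun k _ => measure_entryDir_ge_le hΥ hN hγ hC hη hlam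
      (octagon_sq_add_sq k) q.1 q.2 (by positivity)).trans_eq ?_
    rw [Finset.sum_const, Finset.card_univ, Fintype.card_fin, nsmul_eq_mul, mul_pow, div_pow,
      Real.sq_sqrt (by positivity)]
    push_cast
    congr 3
    rw [show 2 * (3 / 2 ^ 2 * (t / 2) ^ 2) = 3 * t ^ 2 / 8 by ring, div_div]
  refine (Finset.sum_le_sum h8).trans_eq ?_
  rw [Finset.sum_const, nsmul_eq_mul]

end Concentration

/-! ### Bias and fluctuation combined. -/

section Deviation

variable {ι κ : Type*} [Fintype ι]
variable {Υ : Matrix ι ι ℝ} {N n γ K S δ d q : ℝ} {C : Matrix ι ι ℂ} {lam : ι → ℂ}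

lemma norm_shift_varProfile_le_mul (hN : (Fintype.card ι : ℝ) = N) (hN0 : 0 < N)
    (hγ : ∀ i j, |Υ i j| ≤ γ) {g : ι → ℂ} {τ : ℝ} (hg : ∀ i, ‖g i‖ ≤ τ) (i : ι) :
    ‖shift (varProfile Υ N) g i‖ ≤ γ ^ 2 * τ := by
  have h : ∀ j, varProfile Υ N i j * ‖g j‖ ≤ γ ^ 2 / N * τ := fun j => by
    have : Υ i j ^ 2 ≤ γ ^ 2 := sq_le_sq' (abs_le.1 (hγ i j)).1 (abs_le.1 (hγ i j)).2
    exact mul_le_mul (div_le_div_of_nonneg_right this hN0.le) (hg j) (norm_nonneg _)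
      (by positivity)
  refine (norm_shift_le (varProfile_nonneg hN0) g i).trans
    ((Finset.sum_le_sum fun j _ => h j).trans_eq ?_)
  rw [Finset.sum_const, Finset.card_univ, nsmul_eq_mul, hN]
  field_simp

variable [DecidableEq ι] [DecidableEq κ]

/-- The block diagonal part of the expected resolvent is close to the deterministic equivalent. -/
lemma norm_pinch_meanRes_sub_le [Fintype κ] (hΥ : ∀ i j, Υ i j = Υ j i) (hΥ0 : ∀ i, Υ i i = 0)
    (hN : (Fintype.card ι : ℝ) = N) (hn : 0 < n) (hnN : n ≤ N) (hγ0 : 0 ≤ γ)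
    (hγ : ∀ i j, |Υ i j| ≤ γ) (hC : C.IsHermitian) (hCt : Cᵀ = C) (r : ι → κ) (hr : pinch r C = C)
    (hS : 0 < S) (hlam : ∀ i, S⁻¹ ≤ (lam i).im) (hK0 : 0 ≤ K)
    (hK : ∀ᵐ b ∂(gaussLaw ι), ‖sqProfile Υ ⊙ modelRes Υ N C lam b‖ ≤ K) (hδ : 0 < δ)
    (hsmall : γ ^ 2 * ((2 * √2 * γ ^ 3 * S ^ 4 + K * S ^ 2) / n) ≤ (1 - δ) * S⁻¹) :
    ‖pinch r (meanRes Υ N C lam) -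
        res C (lam + shift (varProfile Υ N) (dysonSol C (varProfile Υ N) lam))‖ ≤
      1 / n * (1 + γ ^ 2 * S ^ 2 / δ) * (2 * √2 * γ ^ 3 * S ^ 4 + K * S ^ 2) := by
  have hN0 : 0 < N := hn.trans_le hnN
  have hS' : 0 < S⁻¹ := inv_pos.2 hS
  have hs := varProfile_nonneg (Υ := Υ) hN0
  have hlam0 := fun i => hS'.trans_le (hlam i)
  have hnn := meanRes_im_nonneg (N := N) hΥ hC hS' hlam
  have hbias := norm_meanRes_sub_res_le hΥ hΥ0 hN hN0 hγ0 hγ hC hCt hS' hlam hK0 hK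
  rw [inv_inv] at hbias
  set A := 2 * √2 * γ ^ 3 * S ^ 4 + K * S ^ 2 with hA
  have hA0 : 0 ≤ A := by positivity
  set G := meanRes Υ N C lam
  set s := varProfile Υ N
  have hw0 := add_shift_im_pos hs hlam0 hnn
  set G' := res C (lam + shift s G.diag) with hG'
  have hτ : ‖G - G'‖ ≤ A / n := hbias.trans (div_le_div_of_nonneg_left hA0 hn hnN)
  -- The parameter is moved so that the diagonal of G' solves the equation exactly: the shift of G
  -- at `lam` equals the shift of G' at `lam'`.
  set lam' : ι → ℂ := lam + shift s (G.diag - G'.diag) with hlam'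
  have hshift : lam' + shift s G'.diag = lam + shift s G.diag := by
    ext i
    simp only [hlam', Pi.add_apply, ← shift_sub]
    ring
  have hd : ∀ i, ‖shift s (G.diag - G'.diag) i‖ ≤ γ ^ 2 * (A / n) :=
    norm_shift_varProfile_le_mul hN hN0 hγ fun i => (norm_entry_le (G - G') i i).trans hτ
  -- The smallness hypothesis lets the displacement use up at most the fraction 1 - δ of the
  -- imaginary part.
  have hlamδ : ∀ i, δ * S⁻¹ ≤ (lam' i).im := fun i => by
    have h1 := (Complex.abs_im_le_norm _).trans ((hd i).trans hsmall)
    have h2 := (abs_le.1 h1).1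
    have h3 := hlam i
    simp only [hlam', Pi.add_apply, Complex.add_im]
    linarith
  have hsol' : IsDysonSol C s lam' G'.diag := by
    refine ⟨fun i => im_res_diag_pos hC hw0 i, fun i => ?_⟩
    rw [hshift, diag_apply]
  have hst := hsol'.norm_res_sub_res_le hC hs (mul_pos hδ hS') hS'
    (ε := γ ^ 2 * (A / n)) (by positivity) hlamδ hlam
    (isDysonSol_dysonSol hC hs hlam0) fun i => by simpa [hlam'] using hd i
  rw [hshift, ← hG'] at hst
  -- G' is already block diagonal, so pinching does not increase its distance to the mean.
  have hpin : ‖pinch r G - G'‖ ≤ A / n := by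
    have hpG : pinch r G' = G' := pinch_res r hC hw0 hr
    rw [← hpG, ← pinch_sub]
    exact (norm_pinch_le r _).trans hτ
  refine (norm_sub_le_norm_sub_add_norm_sub _ G' _).trans ((add_le_add hpin hst).trans_eq ?_)
  field_simp

/-- The tail exponent 27l/(2π²) exceeds 4l/3 because π² ≤ 81/8. One part l pays for the union bound;
since l ≥ log 8, the remaining l/3 gains a factor 1/2, which lowers the constant from 8 to 4. -/
lemma four_thirds_mul_le_of_pi {l : ℝ} (hl : 0 ≤ l) : 4 / 3 * l ≤ 27 / 2 * l / Real.pi ^ 2 := by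
  have hpi : Real.pi ^ 2 ≤ 81 / 8 := by nlinarith [Real.pi_lt_d2, Real.pi_pos]
  rw [le_div_iff₀ (by positivity)]
  nlinarith [mul_le_mul_of_nonneg_left hpi hl]

/-- A union bound over `q` entries, at the scale of the deviation estimate. -/
lemma measure_norm_pinch_ge_le_rpow [Nonempty ι] (hΥ : ∀ i j, Υ i j = Υ j i) (hN : 8 ≤ N)
    (hγ0 : 0 < γ) (hγ : ∀ i j, |Υ i j| ≤ γ) (hC : C.IsHermitian) (hS : 0 < S)
    (hlam : ∀ i, S⁻¹ ≤ (lam i).im) (r : ι → κ)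
    (hr : ∀ i, (Finset.univ.filter fun j => r i = r j).card ≤ 2)
    (hq : ((Finset.univ.filter fun q : ι × ι => r q.1 = r q.2).card : ℝ) ≤ q) (hNq : N ≤ q)
    (hd : 1 < d) :
    (gaussLaw ι).real {b | 6 * γ * S ^ 2 * √(2 / N * Real.log (q / N ^ (1 - d))) ≤
        ‖pinch r (modelRes Υ N C lam b - meanRes Υ N C lam)‖} ≤ 4 * N ^ (1 - d) := by
  have hN0 : 0 < N := by linarith
  have hq0 : 0 < q := by linarith
  set D := N ^ (1 - d) with hD
  have hD0 : 0 < D := Real.rpow_pos_of_pos hN0 _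
  have hD1 : D ≤ 1 := Real.rpow_le_one_of_one_le_of_nonpos (by linarith) (by linarith)
  set l := Real.log (q / D) with hl
  have hqD : 8 ≤ q / D := by
    rw [le_div_iff₀ hD0]
    nlinarith
  have hl8 : Real.log 8 ≤ l := Real.log_le_log (by norm_num) hqD
  have hl0 : 0 < l := (Real.log_pos (by norm_num)).trans_le hl8
  have ht : 0 < 6 * γ * S ^ 2 * √(2 / N * l) := by positivity
  refine (measure_norm_pinch_ge_le hΥ hN0 hγ hC (inv_pos.2 hS) hlam r hr ht).trans ?_
  have hexp : 3 * (6 * γ * S ^ 2 * √(2 / N * l)) ^ 2 /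
      (8 * (Real.pi ^ 2 * (S⁻¹⁻¹ ^ 2 * √(2 * γ ^ 2 / N)) ^ 2)) = 27 / 2 * l / Real.pi ^ 2 := by
    rw [inv_inv, mul_pow _ (√_), mul_pow _ (√_), Real.sq_sqrt (by positivity),
      Real.sq_sqrt (by positivity)]
    field_simp
    ring
  rw [hexp]
  have h1 : Real.exp (-(27 / 2 * l / Real.pi ^ 2)) ≤ D / q * (1 / 2) := by
    have e1 : Real.exp (-l) = D / q := by
      rw [Real.exp_neg, hl, Real.exp_log (by positivity), inv_div]
    have e2 : Real.exp (-(l / 3)) ≤ 1 / 2 := by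
      have : Real.log 8 = 3 * Real.log 2 := by
        rw [show (8 : ℝ) = 2 ^ 3 by norm_num, Real.log_pow]; norm_num
      rw [one_div, ← Real.exp_log (zero_lt_two' ℝ), ← Real.exp_neg, Real.exp_le_exp]
      linarith
    rw [← e1]
    refine le_trans ?_ (mul_le_mul_of_nonneg_left e2 (Real.exp_pos _).le)
    rw [← Real.exp_add, Real.exp_le_exp]
    linarith [four_thirds_mul_le_of_pi hl0.le]
  refine (mul_le_mul hq (mul_le_mul_of_nonneg_left h1 (by norm_num)) (by positivity)
    hq0.le).trans_eq ?_
  field_simp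
  norm_num

/-- The deviation estimate for the block diagonal part of the resolvent. -/
theorem measure_norm_pinch_modelRes_sub_ge_le [Fintype κ] [Nonempty ι]
    (hΥ : ∀ i j, Υ i j = Υ j i) (hΥ0 : ∀ i, Υ i i = 0)
    (hN : (Fintype.card ι : ℝ) = N) (hn : 0 < n) (hnN : n ≤ N) (hN8 : 8 ≤ N) (hγ0 : 0 < γ)
    (hγ : ∀ i j, |Υ i j| ≤ γ) (hC : C.IsHermitian) (hCt : Cᵀ = C) (r : ι → κ) (hr : pinch r C = C)
    (hr2 : ∀ i, (Finset.univ.filter fun j => r i = r j).card ≤ 2)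
    (hq : ((Finset.univ.filter fun q : ι × ι => r q.1 = r q.2).card : ℝ) ≤ q) (hNq : N ≤ q)
    (hS : 0 < S) (hlam : ∀ i, S⁻¹ ≤ (lam i).im) (hK0 : 0 ≤ K)
    (hK : ∀ᵐ b ∂(gaussLaw ι), ‖sqProfile Υ ⊙ modelRes Υ N C lam b‖ ≤ K) (hδ : 0 < δ)
    (hsmall : γ ^ 2 * ((2 * √2 * γ ^ 3 * S ^ 4 + K * S ^ 2) / n) ≤ (1 - δ) * S⁻¹) (hd : 1 < d) :
    (gaussLaw ι).real {b | 6 * γ * S ^ 2 * √(2 / N * Real.log (q / N ^ (1 - d))) +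
        1 / n * (1 + γ ^ 2 * S ^ 2 / δ) * (2 * √2 * γ ^ 3 * S ^ 4 + K * S ^ 2) ≤
        ‖pinch r (modelRes Υ N C lam b) -
          res C (lam + shift (varProfile Υ N) (dysonSol C (varProfile Υ N) lam))‖} ≤
      4 * N ^ (1 - d) := by
  refine le_trans (measureReal_mono (fun b hb => ?_) (measure_ne_top _ _))
    (measure_norm_pinch_ge_le_rpow hΥ hN8 hγ0 hγ hC hS hlam r hr2 hq hNq hd)
  have h1 := norm_pinch_meanRes_sub_le hΥ hΥ0 hN hn hnN hγ0.le hγ hC hCt r hr hS hlam hK0 hK hδ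
    hsmall
  rw [Set.mem_ofPred_eq] at hb ⊢
  have h2 := hb.trans (norm_sub_le_norm_sub_add_norm_sub _ (pinch r (meanRes Υ N C lam)) _)
  rw [pinch_sub]
  linarith

end Deviation

/-! ### Positive imaginary part in terms of the quadratic form. -/

section ImaginaryPart

variable {ι : Type*}

lemma imPart_isHermitian (A : Matrix ι ι ℂ) : (imPart A).IsHermitian := by
  rw [imPart, IsHermitian, conjTranspose_smul, conjTranspose_sub, conjTranspose_conjTranspose]
  have : star (1 / (2 * Complex.I)) = -(1 / (2 * Complex.I)) := by simp
  rw [this, neg_smul, ← smul_neg, neg_sub]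

lemma imPart_diag (A : Matrix ι ι ℂ) (i : ι) : imPart A i i = ((A i i).im : ℂ) := by
  have h : A i i - star (A i i) = (2 * (A i i).im : ℝ) * Complex.I := Complex.sub_conj _
  rw [imPart, Matrix.smul_apply, Matrix.sub_apply, conjTranspose_apply, h, smul_eq_mul]
  have := Complex.I_ne_zero
  push_cast
  field_simp

lemma imPart_diagonal [DecidableEq ι] (w : ι → ℂ) :
    imPart (diagonal w) = diagonal fun i => ((w i).im : ℂ) := by
  ext i j
  by_cases hij : i = j
  · subst hij
    rw [imPart_diag, diagonal_apply_eq, diagonal_apply_eq]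
  · simp [imPart, hij]

variable [Fintype ι]

lemma star_dotProduct_imPart_mulVec (A : Matrix ι ι ℂ) (u : ι → ℂ) :
    star u ⬝ᵥ imPart A *ᵥ u = (imForm A u : ℂ) := by
  have h : star u ⬝ᵥ Aᴴ *ᵥ u = star (star u ⬝ᵥ A *ᵥ u) := by
    rw [star_star_dotProduct, star_dotProduct_mulVec_conj]
  have h2 := Complex.sub_conj (star u ⬝ᵥ A *ᵥ u)
  rw [imPart, smul_mulVec, dotProduct_smul, sub_mulVec, dotProduct_sub, h, imForm, smul_eq_mul,
    RCLike.star_def, h2]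
  have := Complex.I_ne_zero
  push_cast
  field_simp

lemma posDef_imPart_iff (A : Matrix ι ι ℂ) :
    (imPart A).PosDef ↔ ∀ u : ι → ℂ, u ≠ 0 → 0 < imForm A u := by
  rw [posDef_iff_dotProduct_mulVec]
  simp only [star_dotProduct_imPart_mulVec, Complex.zero_lt_real]
  exact ⟨fun h => h.2, fun h => ⟨imPart_isHermitian A, h⟩⟩

end ImaginaryPart

/-! ### The index partition of the model and the structure of C_N and the profile. -/

section Blocks

variable {n m p : ℕ}

/-- The class of an index: the two blocks of size `p` are identified. -/
def blockClass : Idx n m p → (Fin n ⊕ Fin m) ⊕ Fin p := Sum.map id (Sum.elim id id)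

/-- Identifying the two blocks of size p index by index turns id₄ ⊗ Δ into a pinching with classes
of at most two elements. -/
lemma blockDelta_eq_pinch (M : Matrix (Idx n m p) (Idx n m p) ℂ) :
    blockDelta M = pinch blockClass M := by
  ext ((i | i) | (i | i)) ((j | j) | (j | j)) <;>
    simp only [blockDelta, blocks, diagPart, pinch_apply, blockClass, fromBlocks_apply₁₁,
      fromBlocks_apply₁₂, fromBlocks_apply₂₁, fromBlocks_apply₂₂, Sum.map_inl, Sum.map_inr,
      Sum.elim_inl, Sum.elim_inr, id, Sum.inl.injEq, Sum.inr.injEq, reduceCtorEq, if_false,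
      Matrix.zero_apply, diagonal_apply] <;>
    · split_ifs with h
      · subst h; rfl
      · rfl

lemma card_blockClass_inl (a : Fin n ⊕ Fin m) :
    (Finset.univ.filter fun j : Idx n m p => blockClass (.inl a) = blockClass j).card ≤ 1 := by
  refine Finset.card_le_one.2 fun x hx y hy => ?_
  simp only [Finset.mem_filter, Finset.mem_univ, true_and] at hx hy
  rcases x with x | x | x <;> rcases y with y | y | y <;> simp_all [blockClass]

lemma card_blockClass_inr (a : Fin p ⊕ Fin p) :
    (Finset.univ.filter fun j : Idx n m p => blockClass (.inr a) = blockClass j).card ≤ 2 := by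
  refine (Finset.card_le_card (t := {.inr (.inl (Sum.elim id id a)),
    .inr (.inr (Sum.elim id id a))}) fun x hx => ?_).trans Finset.card_le_two
  simp only [Finset.mem_filter, Finset.mem_univ, true_and] at hx
  rcases x with x | x | x <;> simp_all [blockClass]

lemma card_blockClass_le_two (i : Idx n m p) :
    (Finset.univ.filter fun j : Idx n m p => blockClass i = blockClass j).card ≤ 2 := by
  rcases i with a | a
  · exact (card_blockClass_inl a).trans one_le_two
  · exact card_blockClass_inr a

/-- Indices of the first two blocks contribute one pair each and those of the last two at most two
each: n + m + 4p = N + 2p, the count inside the logarithm. -/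
lemma card_blockClass_pairs_le :
    (Finset.univ.filter fun q : Idx n m p × Idx n m p =>
      blockClass q.1 = blockClass q.2).card ≤ size n m p + 2 * p := by
  rw [Finset.card_filter, Fintype.sum_prod_type, Fintype.sum_sum_type]
  simp only [← Finset.card_filter]
  refine (add_le_add (Finset.sum_le_sum fun a _ => card_blockClass_inl a)
    (Finset.sum_le_sum fun a _ => card_blockClass_inr a)).trans_eq ?_
  simp [size]
  ring

lemma card_idx : Fintype.card (Idx n m p) = size n m p := by
  simp [size]
  ring

lemma matC_isHermitian : ((matC n m p).map Complex.ofReal).IsHermitian := by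
  ext ((i | i) | (i | i)) ((j | j) | (j | j)) <;>
    simp [matC, blocks, one_apply, eq_comm, apply_ite]

lemma matC_transpose :
    ((matC n m p).map Complex.ofReal)ᵀ = (matC n m p).map Complex.ofReal := by
  ext ((i | i) | (i | i)) ((j | j) | (j | j)) <;>
    simp [matC, blocks, one_apply, eq_comm]

lemma pinch_matC :
    pinch blockClass ((matC n m p).map Complex.ofReal) = (matC n m p).map Complex.ofReal := by
  ext ((i | i) | (i | i)) ((j | j) | (j | j)) <;>
    simp +contextual [pinch_apply, blockClass, matC, blocks, one_apply, apply_ite]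

variable {h : Polynomial ℝ} {Υx : Matrix (Fin n) (Fin p) ℝ}

lemma profileL_symm (i j : Idx n m p) : profileL m h Υx i j = profileL m h Υx j i := by
  rcases i with (i | i) | (i | i) <;> rcases j with (j | j) | (j | j) <;>
    simp [profileL, blocks, ones, mul_comm]

lemma profileL_diag (i : Idx n m p) : profileL m h Υx i i = 0 := by
  rcases i with (i | i) | (i | i) <;> simp [profileL, blocks]

end Blocks

/-! ### From the matrix equation to the vector Dyson equation. -/

section Translation

variable {n m p : ℕ} {Υ : Matrix (Idx n m p) (Idx n m p) ℝ}

lemma mem_DPlus_iff {Λ : Matrix (Idx n m p) (Idx n m p) ℂ} :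
    Λ ∈ DPlus n m p ↔ ∃ lam : Idx n m p → ℂ, Λ = diagonal lam ∧ ∀ i, 0 < (lam i).im := by
  constructor
  · rintro ⟨hd, hpos⟩
    refine ⟨Λ.diag, hd.diagonal_diag.symm, ?_⟩
    rw [← hd.diagonal_diag, imPart_diagonal, posDef_diagonal_iff] at hpos
    simpa using hpos
  · rintro ⟨lam, rfl, hlam⟩
    refine ⟨isDiag_diagonal lam, ?_⟩
    rw [imPart_diagonal, posDef_diagonal_iff]
    simpa using hlam

lemma mapR_eq_diagonal (M : Matrix (Idx n m p) (Idx n m p) ℂ) :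
    mapR Υ M = diagonal (shift (varProfile Υ (size n m p)) M.diag) := rfl

lemma resolvent_shift_eq_res (lam : Idx n m p → ℂ) (M : Matrix (Idx n m p) (Idx n m p) ℂ) :
    ((matC n m p).map Complex.ofReal - diagonal lam - mapR Υ M)⁻¹ =
      res ((matC n m p).map Complex.ofReal)
        (lam + shift (varProfile Υ (size n m p)) M.diag) := by
  rw [res, mapR_eq_diagonal, sub_sub, diagonal_add]
  rfl

lemma resolventL_eq_modelRes (a : Sym2 (Idx n m p) → ℝ) (lam : Idx n m p → ℂ) :
    resolventL Υ a (diagonal lam) = modelRes Υ (size n m p)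
      ((matC n m p).map Complex.ofReal) lam (WithLp.toLp 2 a) := by
  rw [resolventL, modelRes, res]
  congr 2
  ext i j
  simp [matL, symMatrix, profileMap_apply]

/-- The solution of the matrix Dyson equation. -/
noncomputable def squareEquivalent (Υ : Matrix (Idx n m p) (Idx n m p) ℝ)
    (Λ : Matrix (Idx n m p) (Idx n m p) ℂ) : Matrix (Idx n m p) (Idx n m p) ℂ :=
  res ((matC n m p).map Complex.ofReal) (Λ.diag + shift (varProfile Υ (size n m p))
    (dysonSol ((matC n m p).map Complex.ofReal) (varProfile Υ (size n m p)) Λ.diag))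

lemma isSquareEquivalent_squareEquivalent (hN : 0 < size n m p) :
    IsSquareEquivalent Υ (squareEquivalent Υ) := by
  have hC := matC_isHermitian (n := n) (m := m) (p := p)
  have hs := varProfile_nonneg (Υ := Υ) (N := size n m p) (by exact_mod_cast hN)
  have key : ∀ lam : Idx n m p → ℂ, (∀ i, 0 < (lam i).im) → ∀ i, 0 < ((lam +
      shift (varProfile Υ (size n m p)) (dysonSol ((matC n m p).map Complex.ofReal)
        (varProfile Υ (size n m p)) lam)) i).im := fun lam hlam =>
    add_shift_im_pos hs hlam fun i => ((isDysonSol_dysonSol hC hs hlam).im_pos i).le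
  refine ⟨fun Λ hΛ => ?_, fun Λ hΛ i a b => ?_, fun Λ hΛ => ?_⟩
  · obtain ⟨lam, rfl, hlam⟩ := mem_DPlus_iff.1 hΛ
    refine ⟨?_, (posDef_imPart_iff _).2 fun u hu => ?_⟩
    · rw [blockDelta_eq_pinch, squareEquivalent, diag_diagonal]
      exact pinch_res _ hC (key lam hlam) pinch_matC
    · rw [squareEquivalent, diag_diagonal]
      exact imForm_res_pos hC (key lam hlam) hu
  · obtain ⟨lam, rfl, hlam⟩ := mem_DPlus_iff.1 hΛ
    have hU : IsOpen {z : ℂ | 0 < z.im} := isOpen_lt continuous_const Complex.continuous_im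
    have hpos : ∀ z ∈ {z : ℂ | 0 < z.im}, ∀ j, 0 < (Function.update lam i z j).im := by
      intro z hz j
      by_cases hj : j = i
      · subst hj; simpa using hz
      · simpa [hj] using hlam j
    have hdiff : ∀ j, Differentiable ℂ fun z => Function.update lam i z j := by
      intro j
      by_cases hj : j = i
      · subst hj; simp
      · simp [hj]
    refine DifferentiableOn.analyticOnNhd (fun z hz => ?_) hU
    simp only [squareEquivalent, diag_diagonal]
    refine (differentiableAt_res hC (key _ (hpos z hz)) (fun j => ?_) a b).differentiableWithinAt
    refine (hdiff j z).add ?_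
    exact DifferentiableAt.fun_sum fun l _ => ((differentiableOn_dysonSol hC hs hU hpos
      (fun j => (hdiff j).differentiableOn) l).differentiableAt (hU.mem_nhds hz)).const_mul _
  · obtain ⟨lam, rfl, hlam⟩ := mem_DPlus_iff.1 hΛ
    have hd : (squareEquivalent Υ (diagonal lam)).diag = dysonSol ((matC n m p).map Complex.ofReal)
        (varProfile Υ (size n m p)) lam := by
      ext i
      rw [(isDysonSol_dysonSol hC hs hlam).eq, diag_apply, squareEquivalent, diag_diagonal]
    rw [resolvent_shift_eq_res, hd, blockDelta_eq_pinch,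
      pinch_res _ hC (key lam hlam) pinch_matC, squareEquivalent, diag_diagonal]

/-- The diagonal of any candidate solves the vector equation, hence is determined; the fixed-point
equation then recovers the remaining entries. Analyticity plays no role in uniqueness. -/
lemma IsSquareEquivalent.eqOn (hN : 0 < size n m p)
    {Q : Matrix (Idx n m p) (Idx n m p) ℂ → Matrix (Idx n m p) (Idx n m p) ℂ}
    (hQ : IsSquareEquivalent Υ Q) : Set.EqOn Q (squareEquivalent Υ) (DPlus n m p) := by
  intro Λ hΛ
  have hC := matC_isHermitian (n := n) (m := m) (p := p)
  have hs := varProfile_nonneg (Υ := Υ) (N := size n m p) (by exact_mod_cast hN)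
  have hB := (posDef_imPart_iff _).1 (hQ.mapsTo hΛ).2
  have hfix := hQ.fixedPoint Λ hΛ
  obtain ⟨lam, rfl, hlam⟩ := mem_DPlus_iff.1 hΛ
  have him : ∀ i, 0 < ((Q (diagonal lam)).diag i).im := fun i => by
    rw [diag_apply, ← imForm_single]
    exact hB _ (by simp)
  have hpos := add_shift_im_pos hs hlam fun i => (him i).le
  rw [resolvent_shift_eq_res, blockDelta_eq_pinch, pinch_res _ hC hpos pinch_matC] at hfix
  have hsol : IsDysonSol ((matC n m p).map Complex.ofReal) (varProfile Υ (size n m p)) lam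
      (Q (diagonal lam)).diag := ⟨him, fun i => congrFun (congrFun hfix i) i⟩
  rw [hsol.unique hC hs hlam (isDysonSol_dysonSol hC hs hlam)] at hfix
  rw [hfix, squareEquivalent, diag_diagonal]

end Translation

/-! ### The joint law of the matrix entries. -/

section GaussianFamily

variable {ι Ω : Type*} [Fintype ι] [DecidableEq ι] [MeasurableSpace Ω] {μ : Measure Ω}
  {a : Sym2 ι → Ω → ℝ}

lemma IsGOEFamily.hasLaw_toLp (ha : IsGOEFamily μ a) :
    HasLaw (fun ω => WithLp.toLp 2 fun e => a e ω) (gaussLaw ι) μ := by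
  have h := ha.indep.hasLaw_pi ha.law
  have hm : Measurable (WithLp.toLp 2 : (Sym2 ι → ℝ) → EuclideanSpace ℝ (Sym2 ι)) := by fun_prop
  refine ⟨hm.comp_aemeasurable h.aemeasurable, ?_⟩
  rw [gaussLaw, ← map_pi_eq_stdGaussian, ← h.map_eq,
    AEMeasurable.map_map_of_aemeasurable hm.aemeasurable h.aemeasurable]
  rfl

end GaussianFamily

/-! ### Boundedness of the profile along the sequence of dimensions. -/

section Bounds

lemma integrable_abs_pow_gaussianReal (k : ℕ) :
    Integrable (fun x : ℝ => |x| ^ k) (gaussianReal 0 1) := by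
  have h := (memLp_id_gaussianReal' (μ := 0) (v := 1) (k : ENNReal)
    (ENNReal.natCast_ne_top k)).integrable_norm_pow'
  simpa using h

/-- For scales in [0, γ] the polynomial is dominated by one sum of absolute monomials, which has
finite Gaussian mean. -/
lemma exists_abs_integral_eval_le (P : Polynomial ℝ) (γ : ℝ) :
    ∃ B, 0 ≤ B ∧ ∀ s, 0 ≤ s → s ≤ γ → |∫ x, P.eval (x * s) ∂(gaussianReal 0 1)| ≤ B := by
  have hi : Integrable (fun x : ℝ => ∑ k ∈ Finset.range (P.natDegree + 1),
      |P.coeff k| * (|x| ^ k * |γ| ^ k)) (gaussianReal 0 1) :=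
    integrable_finsetSum _ fun k _ =>
      ((integrable_abs_pow_gaussianReal k).mul_const _).const_mul _
  refine ⟨∫ x, ∑ k ∈ Finset.range (P.natDegree + 1), |P.coeff k| * (|x| ^ k * |γ| ^ k)
      ∂(gaussianReal 0 1), integral_nonneg fun x => Finset.sum_nonneg fun k _ => by positivity,
    fun s hs0 hs => ?_⟩
  rw [← Real.norm_eq_abs]
  refine norm_integral_le_of_norm_le hi (ae_of_all _ fun x => ?_)
  rw [Polynomial.eval_eq_sum_range]
  refine (norm_sum_le _ _).trans (Finset.sum_le_sum fun k _ => ?_)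
  rw [norm_mul, norm_pow, norm_mul, mul_pow, Real.norm_eq_abs, Real.norm_eq_abs, Real.norm_eq_abs]
  gcongr

variable {n m p : ℕ} {Υx : Matrix (Fin n) (Fin p) ℝ} {γ : ℝ}

lemma HasBoundedFactorization.abs_le (hγ : 0 ≤ γ) (h : HasBoundedFactorization γ Υx) (i : Fin n)
    (j : Fin p) : |Υx i j| ≤ γ := by
  obtain ⟨r, U, V, rfl, hU, hV⟩ := h
  rw [mul_apply]
  have h1 : ∑ s, |U s i| * |V s j| ≤ √(∑ s, U s i ^ 2) * √(∑ s, V s j ^ 2) := by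
    simpa using Real.sum_mul_le_sqrt_mul_sqrt Finset.univ (fun s => |U s i|) fun s => |V s j|
  have h2 : |∑ s, Uᵀ i s * V s j| ≤ ∑ s, |U s i| * |V s j| := by
    refine (Finset.abs_sum_le_sum_abs _ _).trans_eq ?_
    simp [abs_mul]
  refine h2.trans (h1.trans ?_)
  calc √(∑ s, U s i ^ 2) * √(∑ s, V s j ^ 2) ≤ √γ * √γ :=
        mul_le_mul (hU i) (hV j) (Real.sqrt_nonneg _) (Real.sqrt_nonneg _)
    _ = γ := Real.mul_self_sqrt hγ

lemma dTwo_le (hγ : 0 ≤ γ) (h : ∀ i j, |Υx i j| ≤ γ) (i : Fin n) : dTwo Υx i ≤ γ := by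
  refine Real.sqrt_le_iff.2 ⟨hγ, div_le_of_le_mul₀ (by positivity) (by positivity) ?_⟩
  calc ∑ j, Υx i j ^ 2 ≤ ∑ _j : Fin p, γ ^ 2 :=
        Finset.sum_le_sum fun j _ => sq_le_sq' (abs_le.1 (h i j)).1 (abs_le.1 (h i j)).2
    _ = _ := by simp [mul_comm]

/-- The diagonal entries of `D_lin` and `D_chaos` are bounded, uniformly in the dimensions. -/
lemma exists_dLin_dChaos_le (h : Polynomial ℝ) (hγ : 0 ≤ γ) :
    ∃ B, 0 ≤ B ∧ ∀ (n p : ℕ) (Υx : Matrix (Fin n) (Fin p) ℝ), (∀ i j, |Υx i j| ≤ γ) →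
      ∀ i, |dLin h Υx i| ≤ B ∧ |dChaos h Υx i| ≤ B := by
  choose B hB0 hB using fun l => exists_abs_integral_eval_le (Polynomial.derivative^[l] h) γ
  have hS : 0 ≤ ∑ l ∈ Finset.Icc 2 h.natDegree, 1 / (l.factorial : ℝ) * B l :=
    Finset.sum_nonneg fun l _ => mul_nonneg (by positivity) (hB0 l)
  refine ⟨B 1 + ∑ l ∈ Finset.Icc 2 h.natDegree, 1 / (l.factorial : ℝ) * B l,
    add_nonneg (hB0 1) hS, fun n p Υx hΥ i => ?_⟩
  have hd := fun l => hB l (dTwo Υx i) (Real.sqrt_nonneg _) (dTwo_le hγ hΥ i)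
  refine ⟨(hd 1).trans (le_add_of_nonneg_right hS), le_trans ?_ (le_add_of_nonneg_left (hB0 1))⟩
  refine (Finset.abs_sum_le_sum_abs _ _).trans (Finset.sum_le_sum fun l _ => ?_)
  rw [abs_mul, abs_of_nonneg (by positivity)]
  exact mul_le_mul_of_nonneg_left (hd l) (by positivity)

lemma abs_le_gammaMax (Υ : Matrix (Idx n m p) (Idx n m p) ℝ) (i j : Idx n m p) :
    |Υ i j| ≤ gammaMax Υ :=
  le_ciSup (f := fun q : Idx n m p × Idx n m p => |Υ q.1 q.2|) (Set.finite_range _).bddAbove (i, j)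

/-- The all-ones block in position (2, 4) has the positive entries c_p, whatever the data. -/
lemma gammaMax_profileL_pos (h : Polynomial ℝ) (hm : 0 < m) (hp : 0 < p) :
    0 < gammaMax (profileL m h Υx) := by
  refine lt_of_lt_of_le ?_ (abs_le_gammaMax _ (.inl (.inr ⟨0, hm⟩)) (.inr (.inr ⟨0, hp⟩)))
  have : 0 < size n m p := by unfold size; omega
  simp [profileL, blocks, ones, this.ne', hp.ne']

lemma gammaMax_profileL_le {h : Polynomial ℝ} {B c : ℝ} (hn : 0 < n) (hγ : 0 ≤ γ) (hB0 : 0 ≤ B)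
    (hΥ : ∀ i j, |Υx i j| ≤ γ) (hB : ∀ i, |dLin h Υx i| ≤ B ∧ |dChaos h Υx i| ≤ B)
    (hcn : √((size n m p : ℝ) / n) ≤ c) (hcp : √((size n m p : ℝ) / p) ≤ c) :
    gammaMax (profileL m h Υx) ≤ c * (B + B * γ + 1) := by
  have hc : 0 ≤ c := (Real.sqrt_nonneg _).trans hcn
  have : Nonempty (Idx n m p × Idx n m p) := ⟨.inl (.inl ⟨0, hn⟩), .inl (.inl ⟨0, hn⟩)⟩
  have hBγ : 0 ≤ B * γ := mul_nonneg hB0 hγ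
  have b0 : (0 : ℝ) ≤ c * (B + B * γ + 1) := by positivity
  have b1 : ∀ i, √((size n m p : ℝ) / n) * |dChaos h Υx i| ≤ c * (B + B * γ + 1) := fun i =>
    mul_le_mul hcn (by linarith [(hB i).2]) (abs_nonneg _) hc
  have b2 : ∀ i j, √((size n m p : ℝ) / n) * (|dLin h Υx i| * |Υx i j|) ≤ c * (B + B * γ + 1) :=
    fun i j => mul_le_mul hcn (by
      linarith [mul_le_mul (hB i).1 (hΥ i j) (abs_nonneg _) hB0]) (by positivity) hc
  have b3 : √((size n m p : ℝ) / p) ≤ c * (B + B * γ + 1) := by nlinarith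
  have a1 := abs_of_nonneg (Real.sqrt_nonneg ((size n m p : ℝ) / n))
  have a2 := abs_of_nonneg (Real.sqrt_nonneg ((size n m p : ℝ) / p))
  refine ciSup_le ?_
  simp only [profileL]
  generalize √((size n m p : ℝ) / n) = cn at a1 b1 b2
  generalize √((size n m p : ℝ) / p) = cp at a2 b3
  rintro ⟨(i | i) | (i | i), (j | j) | (j | j)⟩ <;>
    simp [blocks, ones, abs_mul, a1, a2, b0, b1, b2, b3, mul_comm |Υx _ _|]

lemma eventually_sqrt_size_div_le {n m p : ℕ → ℕ} (hn : ∀ k, 0 < n k) (hm : ∀ k, 0 < m k)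
    (hp : ∀ k, 0 < p k) {φm φp : ℝ} (hφm : 0 < φm) (hφp : 0 < φp)
    (hratio_m : Tendsto (fun k => (n k : ℝ) / m k) atTop (𝓝 φm))
    (hratio_p : Tendsto (fun k => (n k : ℝ) / p k) atTop (𝓝 φp)) :
    ∃ c, ∀ᶠ k in atTop, √((size (n k) (m k) (p k) : ℝ) / n k) ≤ c ∧
      √((size (n k) (m k) (p k) : ℝ) / p k) ≤ c := by
  have h1 : Tendsto (fun k => √((size (n k) (m k) (p k) : ℝ) / n k)) atTop
      (𝓝 (√(1 + φm⁻¹ + 2 * φp⁻¹))) := by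
    refine (((tendsto_const_nhds.add (hratio_m.inv₀ hφm.ne')).add
      ((hratio_p.inv₀ hφp.ne').const_mul 2)).sqrt).congr fun k => ?_
    have := hn k
    have := hm k
    have := hp k
    congr 1
    simp only [size]
    push_cast
    field_simp
  have h2 : Tendsto (fun k => √((size (n k) (m k) (p k) : ℝ) / p k)) atTop
      (𝓝 (√(φp + φp * φm⁻¹ + 2))) := by
    refine (((hratio_p.add (hratio_p.mul (hratio_m.inv₀ hφm.ne'))).add
      tendsto_const_nhds).sqrt).congr fun k => ?_
    have := hn k
    have := hm k
    have := hp k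
    congr 1
    simp only [size]
    push_cast
    field_simp
  refine ⟨max (√(1 + φm⁻¹ + 2 * φp⁻¹) + 1) (√(φp + φp * φm⁻¹ + 2) + 1), ?_⟩
  filter_upwards [h1.eventually_lt_const (lt_add_one _), h2.eventually_lt_const (lt_add_one _)]
    with k hk1 hk2
  exact ⟨hk1.le.trans (le_max_left _ _), hk2.le.trans (le_max_right _ _)⟩

/-- The entries of the profile stay bounded along the sequence of dimensions. -/
lemma exists_eventually_gammaMax_le (h : Polynomial ℝ) {n m p : ℕ → ℕ} (hn : ∀ k, 0 < n k)
    (hm : ∀ k, 0 < m k) (hp : ∀ k, 0 < p k) {φm φp : ℝ} (hφm : 0 < φm) (hφp : 0 < φp)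
    (hratio_m : Tendsto (fun k => (n k : ℝ) / m k) atTop (𝓝 φm))
    (hratio_p : Tendsto (fun k => (n k : ℝ) / p k) atTop (𝓝 φp))
    {Υx : ∀ k, Matrix (Fin (n k)) (Fin (p k)) ℝ} (hγ : 0 ≤ γ)
    (hΥx : ∀ k, HasBoundedFactorization γ (Υx k)) :
    ∃ B, ∀ᶠ k in atTop, gammaMax (profileL (m k) h (Υx k)) ≤ B := by
  obtain ⟨c, hc⟩ := eventually_sqrt_size_div_le hn hm hp hφm hφp hratio_m hratio_p
  obtain ⟨B, hB0, hB⟩ := exists_dLin_dChaos_le h hγ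
  refine ⟨c * (B + B * γ + 1), hc.mono fun k hk => ?_⟩
  have hle := fun i j => (hΥx k).abs_le hγ i j
  exact gammaMax_profileL_le (hn k) hγ hB0 hle (hB _ _ _ hle) hk.1 hk.2

end Bounds

/-! ### The role of the exponent 1/5. -/

section Threshold

/-- After multiplication by S the condition involves S⁵ and S³. The fifth power of the threshold E
balances S⁵ exactly; S³ is absorbed because `hX` forces E ≤ 1. -/
lemma smallness_of_threshold {γ K δ n S E : ℝ} (hγ : 0 < γ) (hK : 0 < K) (hδ : δ < 1) (hn : 0 < n)
    (hS : 0 < S) (hE : E = (γ ^ 2 / ((1 - δ) * n) * (2 * √2 * γ ^ 3 + K)) ^ (1 / 5 : ℝ))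
    (hX : γ ^ 2 * (2 * √2 * γ ^ 3 + K) ≤ (1 - δ) * n) (hSE : S * E ≤ 1) :
    γ ^ 2 * ((2 * √2 * γ ^ 3 * S ^ 4 + K * S ^ 2) / n) ≤ (1 - δ) * S⁻¹ := by
  have hδ' : 0 < 1 - δ := sub_pos.2 hδ
  have hE5 : E ^ 5 = γ ^ 2 / ((1 - δ) * n) * (2 * √2 * γ ^ 3 + K) := by
    rw [hE, ← Real.rpow_natCast, ← Real.rpow_mul (by positivity)]
    norm_num
  have hE0 : 0 < E := by rw [hE]; positivity
  have hE1 : E ≤ 1 := by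
    refine le_of_pow_le_pow_left₀ (n := 5) (by norm_num) zero_le_one ?_
    rw [hE5, one_pow, div_mul_eq_mul_div]
    exact (div_le_one (by positivity)).2 hX
  have h5 : S ^ 5 * E ^ 5 ≤ 1 := by
    rw [← mul_pow]
    exact pow_le_one₀ (by positivity) hSE
  have h3 : S ^ 3 * E ^ 5 ≤ 1 := by
    calc S ^ 3 * E ^ 5 = (S * E) ^ 3 * E ^ 2 := by ring
      _ ≤ 1 * 1 := mul_le_mul (pow_le_one₀ (by positivity) hSE) (pow_le_one₀ hE0.le hE1)
          (by positivity) zero_le_one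
      _ = 1 := one_mul 1
  have hE5' : E ^ 5 * ((1 - δ) * n) = γ ^ 2 * (2 * √2 * γ ^ 3 + K) := by
    rw [hE5]; field_simp
  have key : γ ^ 2 * (2 * √2 * γ ^ 3 * S ^ 5 + K * S ^ 3) ≤ (1 - δ) * n := by
    refine le_of_mul_le_mul_right ?_ (pow_pos hE0 5)
    calc γ ^ 2 * (2 * √2 * γ ^ 3 * S ^ 5 + K * S ^ 3) * E ^ 5
        = γ ^ 2 * (2 * √2 * γ ^ 3 * (S ^ 5 * E ^ 5) + K * (S ^ 3 * E ^ 5)) := by ring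
      _ ≤ γ ^ 2 * (2 * √2 * γ ^ 3 * 1 + K * 1) := by gcongr
      _ = _ := by rw [mul_one, mul_one, ← hE5', mul_comm]
  calc γ ^ 2 * ((2 * √2 * γ ^ 3 * S ^ 4 + K * S ^ 2) / n)
      = γ ^ 2 * (2 * √2 * γ ^ 3 * S ^ 5 + K * S ^ 3) / n * S⁻¹ := by field_simp
    _ ≤ (1 - δ) * S⁻¹ := by
        refine mul_le_mul_of_nonneg_right ?_ (inv_nonneg.2 hS.le)
        rwa [div_le_iff₀ hn]

end Threshold

/-! ### The deviation estimate for the concrete profile. -/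

section Profile

variable {n m p : ℕ} {h : Polynomial ℝ} {Υx : Matrix (Fin n) (Fin p) ℝ}

lemma inv_imPart_diagonal {lam : Idx n m p → ℂ} (hlam : ∀ i, 0 < (lam i).im) :
    (imPart (diagonal lam))⁻¹ = diagonal fun i => (((lam i).im⁻¹ : ℝ) : ℂ) := by
  refine inv_eq_left_inv ?_
  rw [imPart_diagonal, diagonal_mul_diagonal, ← diagonal_one]
  congr 1
  ext i
  rw [← Complex.ofReal_mul, inv_mul_cancel₀ (hlam i).ne', Complex.ofReal_one]

lemma le_im_of_posSemidef {lam : Idx n m p → ℂ} {E : ℝ}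
    (hE : (imPart (diagonal lam) - (E : ℂ) • 1).PosSemidef) (i : Idx n m p) : E ≤ (lam i).im := by
  have h := hE.diag_nonneg (i := i)
  rw [Matrix.sub_apply, imPart_diagonal, diagonal_apply_eq, Matrix.smul_apply, one_apply_eq,
    smul_eq_mul, mul_one, ← Complex.ofReal_sub, Complex.zero_le_real] at h
  linarith

/-- The deviation estimate in a fixed dimension. -/
theorem measure_blockDelta_resolventL_sub_ge_le (hn : 0 < n) (hm : 0 < m) (hp : 0 < p)
    (h8 : 8 ≤ n) {K δ d : ℝ} (hK : 0 < K) (hδ : 0 < δ) (hδ1 : δ < 1) (hd : 1 < d)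
    (hX : gammaMax (profileL m h Υx) ^ 2 * (2 * √2 * gammaMax (profileL m h Υx) ^ 3 + K) ≤
      (1 - δ) * n)
    {Ω : Type*} [MeasurableSpace Ω] {μ : Measure Ω}
    {a : Sym2 (Idx n m p) → Ω → ℝ} (ha : IsGOEFamily μ a)
    {Λ : Matrix (Idx n m p) (Idx n m p) ℂ} (hΛ : Λ ∈ DPlus n m p)
    (hη : (imPart Λ - (etaN (profileL m h Υx) K δ : ℂ) • 1).PosSemidef)
    (hbd : ∀ᵐ ω ∂μ, ‖((profileL m h Υx).map fun x => ((x ^ 2 : ℝ) : ℂ)) ⊙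
        resolventL (profileL m h Υx) (fun e => a e ω) Λ‖ ≤ K) :
    μ.real {ω | epsN (profileL m h Υx) K δ d Λ ≤
        ‖blockDelta (resolventL (profileL m h Υx) (fun e => a e ω) Λ) -
          squareEquivalent (profileL m h Υx) Λ‖} ≤ 4 * (size n m p : ℝ) ^ (1 - d) := by
  obtain ⟨lam, rfl, hlam⟩ := mem_DPlus_iff.1 hΛ
  have hnr : (0 : ℝ) < n := by exact_mod_cast hn
  have hγ0 := gammaMax_profileL_pos (Υx := Υx) h hm hp
  have hγ := abs_le_gammaMax (profileL m h Υx)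
  have hΥ := profileL_symm (m := m) (h := h) (Υx := Υx)
  have hC := matC_isHermitian (n := n) (m := m) (p := p)
  have : Nonempty (Idx n m p) := ⟨.inl (.inl ⟨0, hn⟩)⟩
  have hE := le_im_of_posSemidef hη
  set S := ‖(imPart (diagonal lam))⁻¹‖ with hS
  have hinv : ∀ i, (lam i).im⁻¹ ≤ S := fun i => by
    have h1 := norm_entry_le (imPart (diagonal lam))⁻¹ i i
    rw [inv_imPart_diagonal hlam, diagonal_apply_eq, Complex.norm_real,
      Real.norm_of_nonneg (inv_nonneg.2 (hlam i).le), ← inv_imPart_diagonal hlam] at h1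
    exact h1
  have hS0 : 0 < S := (inv_pos.2 (hlam (Classical.arbitrary _))).trans_le (hinv _)
  have hSlam : ∀ i, S⁻¹ ≤ (lam i).im := fun i => inv_le_of_inv_le₀ (hlam i) (hinv i)
  have hE0 : 0 < etaN (profileL m h Υx) K δ := by
    have := sub_pos.2 hδ1
    unfold etaN
    positivity
  -- For diagonal Λ, S is the largest 1 / Im Λ_ii, so the lower bound on Im Λ becomes S η_N ≤ 1.
  have hSE : S * etaN (profileL m h Υx) K δ ≤ 1 := by
    rw [← le_div_iff₀ hE0, one_div, hS, inv_imPart_diagonal hlam]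
    refine opNorm_diagonal_le (inv_nonneg.2 hE0.le) fun i => ?_
    rw [Complex.norm_real, Real.norm_of_nonneg (inv_nonneg.2 (hlam i).le)]
    exact inv_anti₀ hE0 (hE i)
  have hsmall := smallness_of_threshold hγ0 hK hδ1 hnr hS0 rfl hX hSE
  have hlaw := ha.hasLaw_toLp
  have hcont := continuous_modelRes (N := size n m p) hΥ hC hlam
  have hsize : n ≤ size n m p := by unfold size; omega
  have hnN : (n : ℝ) ≤ size n m p := by exact_mod_cast hsize
  have hN8 : (8 : ℝ) ≤ size n m p := by exact_mod_cast h8.trans hsize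
  simp only [resolventL_eq_modelRes, blockDelta_eq_pinch] at hbd ⊢
  have hmul : Continuous fun M : Matrix (Idx n m p) (Idx n m p) ℂ =>
      ‖sqProfile (profileL m h Υx) ⊙ M‖ := by
    refine continuous_norm.comp (continuous_matrix fun i j => ?_)
    exact continuous_const.mul (by fun_prop)
  have hpin : Continuous fun M : Matrix (Idx n m p) (Idx n m p) ℂ => pinch blockClass M := by
    refine continuous_matrix fun i j => ?_
    simp only [pinch_apply]
    split_ifs <;> fun_prop
  have hbd' : ∀ᵐ b ∂(gaussLaw (Idx n m p)), ‖sqProfile (profileL m h Υx) ⊙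
      modelRes (profileL m h Υx) (size n m p) ((matC n m p).map Complex.ofReal) lam b‖ ≤ K := by
    rw [← hlaw.map_eq]
    exact (ae_map_iff hlaw.aemeasurable
      (measurableSet_le (hmul.comp hcont).measurable measurable_const)).2 hbd
  have hmain := measure_norm_pinch_modelRes_sub_ge_le hΥ profileL_diag
    (by exact_mod_cast card_idx) hnr hnN hN8 hγ0 hγ hC matC_transpose blockClass pinch_matC
    card_blockClass_le_two (by exact_mod_cast card_blockClass_pairs_le) (q := size n m p + 2 * p)
    (le_add_of_nonneg_right (by positivity)) hS0 hSlam hK.le hbd' hδ hsmall hd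
  rw [squareEquivalent, diag_diagonal]
  have hmeas : Measurable fun b => ‖pinch blockClass (modelRes (profileL m h Υx) (size n m p)
      ((matC n m p).map Complex.ofReal) lam b) - res ((matC n m p).map Complex.ofReal) (lam +
        shift (varProfile (profileL m h Υx) (size n m p)) (dysonSol
          ((matC n m p).map Complex.ofReal) (varProfile (profileL m h Υx) (size n m p)) lam))‖ :=
    (continuous_norm.comp ((hpin.comp hcont).sub continuous_const)).measurable
  -- The estimate is proved on the standard Gaussian space and pulled back along the joint law of
  -- the entries.
  rw [← hlaw.map_eq, map_measureReal_apply_of_aemeasurable hlaw.aemeasurable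
    (measurableSet_le measurable_const hmeas)] at hmain
  exact hmain

end Profile

end RFRidge

theorem theorem3p2
    -- the odd polynomial activation function
    (h : Polynomial ℝ) (hodd : ∀ x : ℝ, h.eval (-x) = -h.eval x)
    -- the dimensions, growing proportionally
    (n m p : ℕ → ℕ) (hn : ∀ k, 0 < n k) (hm : ∀ k, 0 < m k) (hp : ∀ k, 0 < p k)
    (hn_lim : Tendsto n atTop atTop) (hm_lim : Tendsto m atTop atTop)
    (hp_lim : Tendsto p atTop atTop)
    (φm φp : ℝ) (hφm : 0 < φm) (hφp : 0 < φp)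
    (hratio_m : Tendsto (fun k => (n k : ℝ) / m k) atTop (𝓝 φm))
    (hratio_p : Tendsto (fun k => (n k : ℝ) / p k) atTop (𝓝 φp))
    -- the profiles of the data
    (Υx : ∀ k, Matrix (Fin (n k)) (Fin (p k)) ℝ)
    (γ : ℝ) (hγ : 0 < γ) (hΥx : ∀ k, HasBoundedFactorization γ (Υx k)) :
    ∃ Q : ∀ k, Matrix (Idx (n k) (m k) (p k)) (Idx (n k) (m k) (p k)) ℂ →
        Matrix (Idx (n k) (m k) (p k)) (Idx (n k) (m k) (p k)) ℂ,
      -- existence and uniqueness of the analytic solution, in every dimension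
      (∀ k, IsSquareEquivalent (profileL (m k) h (Υx k)) (Q k) ∧
        ∀ Q', IsSquareEquivalent (profileL (m k) h (Υx k)) Q' →
          Set.EqOn Q' (Q k) (DPlus (n k) (m k) (p k))) ∧
      -- the deviation estimate
      ∀ κ : ℝ, 0 < κ → ∀ δ : ℝ, 0 < δ → δ < 1 →
        ∀ᶠ k in atTop, ∀ d : ℝ, 1 < d →
          ∀ (Ω : Type*) [MeasurableSpace Ω] (μ : Measure Ω) [IsProbabilityMeasure μ]
            (a : Sym2 (Idx (n k) (m k) (p k)) → Ω → ℝ), IsGOEFamily μ a →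
          ∀ Λ ∈ DPlus (n k) (m k) (p k),
            (imPart Λ - (etaN (profileL (m k) h (Υx k)) κ δ : ℂ) • 1).PosSemidef →
            (∀ᵐ ω ∂μ, ‖((profileL (m k) h (Υx k)).map fun x => ((x ^ 2 : ℝ) : ℂ)) ⊙
                resolventL (profileL (m k) h (Υx k)) (fun e => a e ω) Λ‖ ≤ κ) →
            μ.real {ω | epsN (profileL (m k) h (Υx k)) κ δ d Λ ≤
                ‖blockDelta (resolventL (profileL (m k) h (Υx k)) (fun e => a e ω) Λ) - Q k Λ‖}
              ≤ 4 * (size (n k) (m k) (p k) : ℝ) ^ (1 - d) := by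
  refine ⟨fun k => squareEquivalent (profileL (m k) h (Υx k)), fun k => ?_, ?_⟩
  · have hN : 0 < size (n k) (m k) (p k) := by
      have := hn k
      unfold size
      omega
    exact ⟨isSquareEquivalent_squareEquivalent hN, fun Q' hQ' => hQ'.eqOn hN⟩
  · intro κ hκ δ hδ hδ1
    obtain ⟨B, hB⟩ := exists_eventually_gammaMax_le h hn hm hp hφm hφp hratio_m hratio_p hγ.le hΥx
    -- With `gammaMax` bounded by B, this makes η_N at most 1. The further requirement that n be at
    -- least 8 ensures N ≥ 8, hence a logarithm of at least log 8 in the tail bound.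
    have hlarge : ∀ᶠ k in atTop, B ^ 2 * (2 * √2 * B ^ 3 + κ) / (1 - δ) ≤ n k :=
      (tendsto_natCast_atTop_atTop.comp hn_lim).eventually_ge_atTop _
    filter_upwards [hB, hlarge, hn_lim.eventually_ge_atTop 8] with k hk hk1 hk8
    have hγ0 := (gammaMax_profileL_pos (Υx := Υx k) h (hm k) (hp k)).le
    rw [div_le_iff₀ (sub_pos.2 hδ1)] at hk1
    have hX : gammaMax (profileL (m k) h (Υx k)) ^ 2 *
        (2 * √2 * gammaMax (profileL (m k) h (Υx k)) ^ 3 + κ) ≤ (1 - δ) * n k := by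
      rw [mul_comm (1 - δ)]
      refine le_trans ?_ hk1
      gcongr
    intro d hd Ω _ μ _ a ha Λ hΛ hη hbd
    exact measure_blockDelta_resolventL_sub_ge_le (hn k) (hm k) (hp k) hk8 hκ hδ hδ1 hd hX ha hΛ
      hη hbd
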